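/- Let $\rho_0,\rho_1,\pi_0$ be probability measures on $\mathbb R^d$ with finite first moments. Let $X_0\sim\rho_0$ and $X_1\sim\rho_1$ be independent, let $X_t=(1-t)X_0+tX_1$ for $t\in[0,1]$ (linear interpolation), and let $\rho_t$ be the law of $X_t$. *Velocity distribution.* Let $\pi_1(\cdot\,;x,t)$ be a jointly measurable regular conditional distribution of the velocity $X_1-X_0$ given $X_t=x$. Let $D\subseteq[0,1]\times\mathbb R^d$ be a measurable set of pairs $(t,x)$ at which it is defined and has a finite mean $v^*(x,t)=\int v\,\pi_1(dv;x,t)$, where $D$ has full measure for every $t$, i.e. $(t,X_t)\in D$ almost surely for every $t\in[0,1]$. *Expected acceleration.* For $(t,x)\in D$ let $V_0\sim\pi_0$ and $V_1\sim\pi_1(\cdot\,;x,t)$ be independent, let $V_\tau=(1-\tau)V_0+\tau V_1$, and let $a(x,t,u,\tau)=\mathbb E[V_1-V_0\mid V_\tau=u]$ for $\tau\in[0,1]$ (a jointly measurable version). ODEs are understood in integral form, that is, with absolutely continuous solutions. Assume that the inner ODE is well posed: for every $(t,x)\in D$ and $\pi_0$-almost every $u_0$, the equation $du_\tau=a(x,t,u_\tau,\tau)\,d\tau$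 has at most one solution on $[0,1]$ starting from $u_0$. *Coupled ODEs.* $$du_\tau(z_t,t)=a(z_t,t,u_\tau,\tau)\,d\tau,\quad u_0(z_t,t)\sim\pi_0,\ \tau\in[0,1];\qquad dz_t=u_1(z_t,t)\,dt,\quad z_0\sim\rho_0,\ t\in[0,1],$$ where, at each time $t$ at which a velocity is drawn, the initial velocity $u_0(Z_t,t)$ has law $\pi_0$ and is independent of the current location $Z_t$. Then the following hold. 1. For every $(t,x)\in D$, the inner ODE turns $\pi_0$ into the velocity distribution: if $(u_\tau)_{\tau\in[0,1]}$ is a random solution of the inner ODE at $(x,t)$ with $u_0\sim\pi_0$, then $u_1\sim\pi_1(\cdot\,;x,t)$. 2. Assume that for $\rho_0$-almost every $x_0$ the equation $dz_t=v^*(z_t,t)\,dt$ has at most one solution from $x_0$ on $[0,1]$ among the curves with $(t,z_t)\in D$ for almost every $t$. Let $Z=\{Z_t:t\in[0,1]\}$ be any process generated by the coupled ODEs: $Z_0\sim\rho_0$ and almost surely $Z_t=Z_0+\int_0^t u_1(Z_s,s)\,ds$ for all $t\in[0,1]$, where for almost every $s$ the velocity $u_1(Z_s,s)$ is the value at $\tau=1$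 of a solution of the inner ODE at $(Z_s,s)$ started from $u_0(Z_s,s)$; moreover $(s,Z_s)\in D$ almost surely for almost every $s$, and $(s,\omega)\mapsto u_1(Z_s,s)(\omega)$ is measurable with $\mathbb E\int_0^1|u_1(Z_s,s)|\,ds<\infty$. Then $Z_t$ and $X_t$ have the same distribution for every $t\in[0,1]$. 3. Let $Z$ be generated by the coupled ODEs with piecewise straight paths: for a partition $0=s_0\le s_1\le\dots\le s_J=1$, $Z_0\sim\rho_0$, and $Z_t=Z_{s_j}+(t-s_j)\,u_1(Z_{s_j},s_j)$ for $t\in[s_j,s_{j+1}]$, where $u_1(Z_{s_j},s_j)$ is obtained from the inner ODE at $(Z_{s_j},s_j)$ started from a draw $u_0\sim\pi_0$ independent of $Z_{s_j}$. Then, without the assumption of part 2, $Z_t$ and $X_t$ have the same distribution for every $t\in[0,1]$. -/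

import Mathlib

open MeasureTheory ProbabilityTheory Set

noncomputable section

/-- The linear interpolation `(1 - t) x₀ + t x₁` of a pair `p = (x₀, x₁)`. On the probability space
`(E × E, ρ₀ ⊗ ρ₁)`, the maps `interp t` form the process `X` with independent end points
`X₀ ∼ ρ₀`, `X₁ ∼ ρ₁`. -/
def interp {d : ℕ} (t : ℝ)
    (p : EuclideanSpace ℝ (Fin d) × EuclideanSpace ℝ (Fin d)) : EuclideanSpace ℝ (Fin d) :=
  (1 - t) • p.1 + t • p.2

/-- The law `ρ_t` of `X_t = (1 - t) X₀ + t X₁`, with `(X₀, X₁) ∼ ρ₀ ⊗ ρ₁`. -/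
def locationLaw {d : ℕ} (ρ₀ ρ₁ : Measure (EuclideanSpace ℝ (Fin d))) (t : ℝ) :
    Measure (EuclideanSpace ℝ (Fin d)) :=
  (ρ₀.prod ρ₁).map (interp t)

/-- `π₁ (t, x)`, for `(t, x)` in `D`, is the velocity distribution at `(x, t)`: for every `t` in
`[0, 1]` the kernel `x ↦ π₁ (t, x)` is a regular conditional distribution of the velocity
`X₁ - X₀` given `X_t = x`. The set `D` is the set of space-time locations at which the velocity
distribution is defined (with finite mean); it carries all of `ρ_t`, for every `t`. -/
structure IsVelocityDistribution {d : ℕ} (ρ₀ ρ₁ : Measure (EuclideanSpace ℝ (Fin d)))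
    (D : Set (ℝ × EuclideanSpace ℝ (Fin d)))
    (π₁ : Kernel (ℝ × EuclideanSpace ℝ (Fin d)) (EuclideanSpace ℝ (Fin d))) : Prop where
  measurableSet : MeasurableSet D
  ae_mem : ∀ t ∈ Icc (0 : ℝ) 1, ∀ᵐ x ∂(locationLaw ρ₀ ρ₁ t), (t, x) ∈ D
  disintegration : ∀ t ∈ Icc (0 : ℝ) 1,
    (locationLaw ρ₀ ρ₁ t) ⊗ₘ (π₁.comap (fun x => (t, x)) measurable_prodMk_left) =
      (ρ₀.prod ρ₁).map (fun p => (interp t p, p.2 - p.1))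
  integrable : ∀ t ∈ Icc (0 : ℝ) 1, ∀ x, (t, x) ∈ D → Integrable id (π₁ (t, x))

/-- The field `b` is (a version of) `b τ u = E[V₁ - V₀ | V_τ = u]`, where `(V₀, V₁) ∼ μ ⊗ ν` and
`V_τ = (1 - τ) V₀ + τ V₁`. -/
def IsExpectedDrift {d : ℕ} (μ ν : Measure (EuclideanSpace ℝ (Fin d)))
    (b : ℝ → EuclideanSpace ℝ (Fin d) → EuclideanSpace ℝ (Fin d)) : Prop :=
  ∀ τ ∈ Icc (0 : ℝ) 1,
    (fun p => b τ (interp τ p)) =ᵐ[μ.prod ν]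
      (μ.prod ν)[fun p => p.2 - p.1 | MeasurableSpace.comap (interp τ) inferInstance]

/-- The curve `γ` solves `γ' = b s γ` on `[0, 1]` in the sense of Carathéodory. -/
def SolvesODE {d : ℕ} (b : ℝ → EuclideanSpace ℝ (Fin d) → EuclideanSpace ℝ (Fin d))
    (γ : ℝ → EuclideanSpace ℝ (Fin d)) : Prop :=
  IntervalIntegrable (fun s => b s (γ s)) volume 0 1 ∧
    ∀ t ∈ Icc (0 : ℝ) 1, γ t = γ 0 + ∫ s in (0 : ℝ)..t, b s (γ s)

/-- Among the curves with `(s, γ s)` in `D` for almost every `s`, the equation `γ' = b s γ` on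
`[0, 1]` has at most one solution with `γ 0 = x₀`. -/
def UniqueODEFrom {d : ℕ} (b : ℝ → EuclideanSpace ℝ (Fin d) → EuclideanSpace ℝ (Fin d))
    (D : Set (ℝ × EuclideanSpace ℝ (Fin d))) (x₀ : EuclideanSpace ℝ (Fin d)) : Prop :=
  ∀ γ γ' : ℝ → EuclideanSpace ℝ (Fin d),
    SolvesODE b γ → SolvesODE b γ' →
    (∀ᵐ s ∂(volume.restrict (Icc (0 : ℝ) 1)), (s, γ s) ∈ D) →
    (∀ᵐ s ∂(volume.restrict (Icc (0 : ℝ) 1)), (s, γ' s) ∈ D) →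
    γ 0 = x₀ → γ' 0 = x₀ → ∀ t ∈ Icc (0 : ℝ) 1, γ t = γ' t

/-- The mean `v*(x, t)` of the velocity distribution at `(x, t)`. -/
def meanVelocity {d : ℕ}
    (π₁ : Kernel (ℝ × EuclideanSpace ℝ (Fin d)) (EuclideanSpace ℝ (Fin d)))
    (t : ℝ) (x : EuclideanSpace ℝ (Fin d)) : EuclideanSpace ℝ (Fin d) :=
  ∫ v, v ∂(π₁ (t, x))

/-- The process `τ ↦ U τ` is generated by the inner equation
`du_τ = a (z, t, u_τ, τ) dτ`, `u₀ ∼ π₀`, at the (possibly random) location `z = Y` and time `t`: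
the initial velocity is drawn from `π₀` independently of the location `Y`. -/
structure IsInnerFlow {d : ℕ} {Ω : Type*} [MeasurableSpace Ω] (P : Measure Ω)
    (π₀ : Measure (EuclideanSpace ℝ (Fin d)))
    (a : EuclideanSpace ℝ (Fin d) → ℝ → EuclideanSpace ℝ (Fin d) → ℝ → EuclideanSpace ℝ (Fin d))
    (t : ℝ) (Y : Ω → EuclideanSpace ℝ (Fin d)) (U : ℝ → Ω → EuclideanSpace ℝ (Fin d)) :
    Prop where
  measurable : ∀ τ ∈ Icc (0 : ℝ) 1, Measurable (U τ)
  initial : P.map (U 0) = π₀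
  indep : IndepFun (U 0) Y P
  ode : ∀ᵐ ω ∂P, SolvesODE (fun τ u => a (Y ω) t u τ) (fun τ => U τ ω)

/-- The process `Z` is generated by the coupled equations
`du_τ(z_t, t) = a (z_t, t, u_τ, τ) dτ`, `u₀(z_t, t) ∼ π₀`, and `dz_t = u₁(z_t, t) dt`, `z₀ ∼ ρ₀`.
Here `U t τ` is `u_τ(Z_t, t)`. The paths of `Z` are absolutely continuous with integrable velocity,
and `Z_t` stays where the velocity distribution is defined, for almost every time `t`. -/
structure IsCoupledFlow {d : ℕ} {Ω : Type*} [MeasurableSpace Ω] (P : Measure Ω)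
    (ρ₀ π₀ : Measure (EuclideanSpace ℝ (Fin d)))
    (D : Set (ℝ × EuclideanSpace ℝ (Fin d)))
    (a : EuclideanSpace ℝ (Fin d) → ℝ → EuclideanSpace ℝ (Fin d) → ℝ → EuclideanSpace ℝ (Fin d))
    (Z : ℝ → Ω → EuclideanSpace ℝ (Fin d)) (U : ℝ → ℝ → Ω → EuclideanSpace ℝ (Fin d)) :
    Prop where
  measurable : ∀ t ∈ Icc (0 : ℝ) 1, Measurable (Z t)
  initial : P.map (Z 0) = ρ₀
  mem_domain : ∀ᵐ t ∂(volume.restrict (Icc (0 : ℝ) 1)), ∀ᵐ ω ∂P, (t, Z t ω) ∈ D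
  inner : ∀ᵐ t ∂(volume.restrict (Icc (0 : ℝ) 1)), IsInnerFlow P π₀ a t (Z t) (U t)
  integrable : Integrable (fun q : ℝ × Ω => U q.1 1 q.2)
    ((volume.restrict (Icc (0 : ℝ) 1)).prod P)
  outer : ∀ᵐ ω ∂P, ∀ t ∈ Icc (0 : ℝ) 1, Z t ω = Z 0 ω + ∫ s in (0 : ℝ)..t, U s 1 ω

/-- The process `Z` is generated by the coupled equations along the partition
`0 = s 0 ≤ s 1 ≤ … ≤ s J = 1`: at each time `s j` a velocity `u₁(Z_{s j}, s j)` is produced by the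
inner equation from a new draw `u₀ ∼ π₀`, and `Z` follows it up to time `s (j + 1)`. -/
structure IsPiecewiseStraightFlow {d : ℕ} {Ω : Type*} [MeasurableSpace Ω] (P : Measure Ω)
    (ρ₀ π₀ : Measure (EuclideanSpace ℝ (Fin d)))
    (a : EuclideanSpace ℝ (Fin d) → ℝ → EuclideanSpace ℝ (Fin d) → ℝ → EuclideanSpace ℝ (Fin d))
    (J : ℕ) (s : ℕ → ℝ)
    (Z : ℝ → Ω → EuclideanSpace ℝ (Fin d)) (U : ℕ → ℝ → Ω → EuclideanSpace ℝ (Fin d)) :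
    Prop where
  start : s 0 = 0
  stop_eq : s J = 1
  mono : ∀ j < J, s j ≤ s (j + 1)
  measurable : ∀ t ∈ Icc (0 : ℝ) 1, Measurable (Z t)
  initial : P.map (Z 0) = ρ₀
  inner : ∀ j < J, IsInnerFlow P π₀ a (s j) (Z (s j)) (U j)
  outer : ∀ j < J, ∀ᵐ ω ∂P, ∀ t ∈ Icc (s j) (s (j + 1)),
    Z t ω = Z (s j) ω + (t - s j) • U j 1 ω

end

/-! One principle carries parts 1 and 2. Let a process have absolutely continuous paths with
integrable velocity `V`, and suppose that the conditional mean of `V s` given the location at time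
`s` is `b s` at that location (`IsDriven`). If the equation `γ' = b s γ` has at most one solution
from almost every starting point, then the one-dimensional marginals depend only on `b` and on the
initial law (`IsDriven.map_eq_map`), and they are those of any random solution
(`IsDriven.map_eq_map_of_isSolutionFrom`). This is a probabilistic form of the superposition
principle for the continuity equation; no regularity of `b` beyond measurability and integrability
along the process is needed.

The principle is proved by discretizing time. On a grid of mesh `1 / n`, replace the process by the
Markov chain whose transitions are the conditional laws of the next location given the current one
(`exists_chain`); its marginals at the grid times are exactly those of the process. An increment of
the chain is a martingale increment plus its conditional mean. Velocities truncated at level `M`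
give martingale increments of order `M / n`, and orthogonality makes their sum of order `M / √n`.
The conditional mean is `b / n` up to an error controlled by the continuity of translations in `L¹`.
Hence the chain nearly solves `γ' = b s γ` (`IsDriven.exists_approx`).

To pass to the limit with a merely measurable `b`, `exists_gauge` supplies a lower semicontinuous
`Φ`, integrable along the process, that dominates `2 ^ k ‖b - w k‖` for bounded continuous fields `w
k` and is infinite off the admissible set. Since the marginals agree, the mean of `∫ Φ` along the
chain stays bounded. Curves with bounded `∫ Φ` are equicontinuous up to small errors, and their
limits are admissible solutions (`exists_subseq_tendsto_solution`). Two families of approximations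
are realized over the same initial data; by uniqueness their subsequential limits coincide, so their
limit laws do too (`eq_of_tendsto_solution`).

For part 1 the process is the interpolation from `π₀` to the velocity distribution, whose drift is
`a` by definition. Conditioning on a random location (`IsInnerFlow.map_prodMk_eq_compProd`) then
shows that, given `Z_s`, the velocity produced by the inner equation is distributed as `X₁ - X₀`
given `X_s`. So in part 2 both `Z` and `X` are driven by the mean velocity, and the principle
applies again. In part 3 the pair of location and velocity has the law of `(X_s, X₁ - X₀)` at each
partition time, and a straight step preserves the law of the interpolation. -/

open Filter Topology ENNReal

/-! ### Compactness and stability of approximate solutions -/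

section Deterministic

variable {E : Type*} [NormedAddCommGroup E] [NormedSpace ℝ E] [FiniteDimensional ℝ E]

/-- Arzelà–Ascoli for curves on `[0, 1]` with a common starting point and a common modulus of
continuity. -/
lemma exists_subseq_tendsto_of_modulus (η : ℕ → ℝ → E) (x₀ : E) (M c : ℕ → ℝ)
    (hc : Tendsto c atTop (𝓝 0)) (h0 : ∀ n, η n 0 = x₀)
    (hη : ∀ k n, ∀ s ∈ Icc (0 : ℝ) 1, ∀ t ∈ Icc (0 : ℝ) 1,
      ‖η n t - η n s‖ ≤ M k * |t - s| + c k) :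
    ∃ (γ : ℝ → E) (φ : ℕ → ℕ), Continuous γ ∧ StrictMono φ ∧
      ∀ t ∈ Icc (0 : ℝ) 1, Tendsto (fun n => η (φ n) t) atTop (𝓝 (γ t)) := by
  have hmod : ∀ ε > 0, ∃ δ > 0, ∀ n, ∀ s ∈ Icc (0 : ℝ) 1, ∀ t ∈ Icc (0 : ℝ) 1,
      |t - s| < δ → ‖η n t - η n s‖ < ε := by
    intro ε hε
    obtain ⟨k, hk⟩ := (hc.eventually (gt_mem_nhds (half_pos hε))).exists
    -- Half of `ε` is spent on `c k`, half on the Lipschitz part; the slope is enlarged to `|M k| +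
    -- 1` because `M k` may vanish or be negative.
    refine ⟨ε / 2 / (|M k| + 1), by positivity, fun n s hs t ht hst => ?_⟩
    have h1 := hη k n s hs t ht
    have h2 : M k * |t - s| ≤ (|M k| + 1) * |t - s| := by
      gcongr; linarith [le_abs_self (M k)]
    have h3 : (|M k| + 1) * |t - s| < ε / 2 := by
      rw [lt_div_iff₀ (by positivity)] at hst; linarith
    linarith
  have hcont : ∀ n, Continuous fun t : Icc (0 : ℝ) 1 => η n t := by
    intro n
    rw [Metric.continuous_iff]
    intro t ε hε
    obtain ⟨δ, hδ, h⟩ := hmod ε hε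
    refine ⟨δ, hδ, fun s hs => ?_⟩
    rw [dist_eq_norm]
    exact h n t t.2 s s.2 (by simpa [Subtype.dist_eq, Real.dist_eq] using hs)
  let f : ℕ → BoundedContinuousFunction (Icc (0 : ℝ) 1) E := fun n =>
    BoundedContinuousFunction.mkOfCompact ⟨_, hcont n⟩
  have hf : ∀ n t, f n t = η n t := fun n t => rfl
  have hcomp : IsCompact (closure (range f)) := by
    refine BoundedContinuousFunction.arzela_ascoli (Metric.closedBall x₀ (M 0 * 1 ⊔ 0 + c 0))
      (isCompact_closedBall _ _) _ ?_ ?_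
    · rintro _ x ⟨n, rfl⟩
      rw [hf, Metric.mem_closedBall, dist_eq_norm, ← h0 n]
      refine (hη 0 n 0 (by simp) x x.2).trans ?_
      gcongr
      rw [sub_zero, abs_of_nonneg x.2.1]
      rcases le_total 0 (M 0) with h | h
      · exact le_max_of_le_left (mul_le_mul_of_nonneg_left x.2.2 h)
      · exact le_max_of_le_right (mul_nonpos_of_nonpos_of_nonneg h x.2.1)
    · intro x
      rw [Metric.equicontinuousAt_iff]
      intro ε hε
      obtain ⟨δ, hδ, h⟩ := hmod ε hε
      refine ⟨δ, hδ, ?_⟩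
      rintro y hy ⟨_, n, rfl⟩
      rw [dist_eq_norm]
      refine h n y y.2 x x.2 ?_
      rw [abs_sub_comm]
      simpa [Subtype.dist_eq, Real.dist_eq] using hy
  obtain ⟨g, -, φ, hφ, hg⟩ := hcomp.tendsto_subseq (x := f)
    (fun n => subset_closure (mem_range_self n))
  refine ⟨fun t => g (projIcc 0 1 zero_le_one t), φ, g.continuous.comp continuous_projIcc, hφ,
    fun t ht => ?_⟩
  have := (BoundedContinuousFunction.tendsto_iff_tendstoUniformly.1 hg).tendsto_at ⟨t, ht⟩
  simp only [projIcc_of_mem _ ht]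
  exact this

/-- Interchange of limits: the errors `c k` are uniform in the index `i`, so a three-term estimate
reduces the claim to one fixed `k`. -/
lemma tendsto_of_forall_enorm_sub_le {ι E : Type*} [NormedAddCommGroup E] {l : Filter ι} (u : ι → E) (v : ℕ → ι → E)
    (a : E) (A : ℕ → E) (c : ℕ → ℝ≥0∞) (hc : Tendsto c atTop (𝓝 0))
    (hu : ∀ k i, ‖u i - v k i‖ₑ ≤ c k) (ha : ∀ k, ‖a - A k‖ₑ ≤ c k)
    (hv : ∀ k, Tendsto (v k) l (𝓝 (A k))) : Tendsto u l (𝓝 a) := by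
  rw [EMetric.tendsto_nhds]
  intro ε hε
  obtain ⟨k, hk⟩ := (hc.eventually (gt_mem_nhds (ENNReal.div_pos hε.ne'
    (by norm_num : (3 : ℝ≥0∞) ≠ ∞)))).exists
  filter_upwards [(EMetric.tendsto_nhds.1 (hv k)) (ε / 3)
    (ENNReal.div_pos hε.ne' (by norm_num))] with i hi
  calc edist (u i) a ≤ edist (u i) (v k i) + edist (v k i) (A k) + edist (A k) a :=
        edist_triangle4 _ _ _ _
    _ < ε / 3 + ε / 3 + ε / 3 := by
        refine ENNReal.add_lt_add (ENNReal.add_lt_add ?_ hi) ?_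
        · rw [edist_eq_enorm_sub]; exact (hu k i).trans_lt hk
        · rw [edist_comm, edist_eq_enorm_sub]; exact (ha k).trans_lt hk
    _ = ε := ENNReal.add_thirds ε

variable [MeasurableSpace E] [BorelSpace E]

/-- Stability of the equation `γ' = b s γ` along approximate solutions: `Φ` is a lower
semicontinuous gauge which controls the error of the continuous approximations `w k` of `b`. -/
lemma exists_subseq_tendsto_solution (b : ℝ → E → E) (hb : Measurable (Function.uncurry b))
    (Φ : ℝ × E → ℝ≥0∞) (hΦ : LowerSemicontinuous Φ) (w : ℕ → ℝ × E → E)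
    (hw : ∀ k, Continuous (w k)) (M : ℕ → ℝ) (hM : ∀ k p, ‖w k p‖ ≤ M k)
    (hbw : ∀ k s y, 2 ^ k * ‖b s y - w k (s, y)‖ₑ ≤ Φ (s, y))
    (σ : ℕ → ℝ → ℝ) (ξ : ℕ → ℝ → E) (hσ : ∀ n, Measurable (σ n)) (hξ : ∀ n, Measurable (ξ n))
    (hσlim : ∀ s ∈ Icc (0 : ℝ) 1, Tendsto (fun n => σ n s) atTop (𝓝 s))
    (C : ℝ≥0∞) (hC : C ≠ ∞)
    (hbound : ∀ n, ∫⁻ s in Icc (0 : ℝ) 1, Φ (σ n s, ξ n s) ≤ C) (x₀ : E)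
    (hres : Tendsto (fun n => ∫⁻ s in Icc (0 : ℝ) 1,
      ‖ξ n s - (x₀ + ∫ r in (0 : ℝ)..s, b (σ n r) (ξ n r))‖ₑ) atTop (𝓝 0)) :
    ∃ (γ : ℝ → E) (φ : ℕ → ℕ), StrictMono φ ∧
      IntervalIntegrable (fun s => b s (γ s)) volume 0 1 ∧
      (∀ t ∈ Icc (0 : ℝ) 1, γ t = x₀ + ∫ s in (0 : ℝ)..t, b s (γ s)) ∧
      ∫⁻ s in Icc (0 : ℝ) 1, Φ (s, γ s) ≤ C ∧
      ∀ t ∈ Icc (0 : ℝ) 1, Tendsto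
        (fun n => x₀ + ∫ r in (0 : ℝ)..t, b (σ (φ n) r) (ξ (φ n) r)) atTop (𝓝 (γ t)) := by
  set μ : Measure ℝ := volume.restrict (Icc (0 : ℝ) 1) with hμ
  have hbw' : ∀ k s y, ‖b s y - w k (s, y)‖ₑ ≤ (2 ^ k)⁻¹ * Φ (s, y) := by
    intro k s y
    rw [mul_comm, ← div_eq_mul_inv, ENNReal.le_div_iff_mul_le (by simp) (by simp), mul_comm]
    exact hbw k s y
  have hcfin : ∀ k : ℕ, (2 ^ k : ℝ≥0∞)⁻¹ * C ≠ ∞ := fun k =>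
    ENNReal.mul_ne_top (by simp) hC
  have hclim : Tendsto (fun k : ℕ => (2 ^ k : ℝ≥0∞)⁻¹ * C) atTop (𝓝 0) := by
    have : Tendsto (fun k : ℕ => (2 ^ k : ℝ≥0∞)⁻¹) atTop (𝓝 0) := by
      simp_rw [ENNReal.inv_pow]
      exact ENNReal.tendsto_pow_atTop_nhds_zero_of_lt_one (by norm_num)
    simpa using ENNReal.Tendsto.mul_const this (Or.inr hC)
  -- general facts on curves with bounded gauge
  have key : ∀ (τ : ℝ → ℝ) (y : ℝ → E), Measurable τ → Measurable y →
      ∫⁻ s, Φ (τ s, y s) ∂μ ≤ C →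
      (∀ k, Integrable (fun s => w k (τ s, y s)) μ) ∧ Integrable (fun s => b (τ s) (y s)) μ ∧
      ∀ k, ∫⁻ s, ‖b (τ s) (y s) - w k (τ s, y s)‖ₑ ∂μ ≤ (2 ^ k)⁻¹ * C := by
    intro τ y hτ hy hle
    have h1 : ∀ k, Integrable (fun s => w k (τ s, y s)) μ := fun k =>
      Integrable.of_bound (((hw k).measurable.comp (hτ.prodMk hy)).aestronglyMeasurable) (M k)
        (ae_of_all _ fun s => hM k _)
    have h2 : ∀ k, ∫⁻ s, ‖b (τ s) (y s) - w k (τ s, y s)‖ₑ ∂μ ≤ (2 ^ k)⁻¹ * C := by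
      intro k
      calc _ ≤ ∫⁻ s, (2 ^ k)⁻¹ * Φ (τ s, y s) ∂μ := lintegral_mono fun s => hbw' k _ _
        _ = (2 ^ k)⁻¹ * ∫⁻ s, Φ (τ s, y s) ∂μ := lintegral_const_mul' _ _ (by simp)
        _ ≤ _ := by gcongr
    -- A single approximation suffices for integrability: `w 0` is bounded and `b - w 0` is
    -- integrable.
    refine ⟨h1, ?_, h2⟩
    have h3 : Integrable (fun s => b (τ s) (y s) - w 0 (τ s, y s)) μ := by
      refine ⟨?_, (h2 0).trans_lt (hcfin 0).lt_top⟩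
      exact ((hb.comp (hτ.prodMk hy)).sub
        ((hw 0).measurable.comp (hτ.prodMk hy))).aestronglyMeasurable
    exact (h3.add (h1 0)).congr (ae_of_all _ fun s => by simp)
  have hsub : ∀ (f : ℝ → E), ∀ s ∈ Icc (0 : ℝ) 1, ∀ t ∈ Icc (0 : ℝ) 1,
      ‖∫ r in s..t, f r‖ₑ ≤ ∫⁻ r, ‖f r‖ₑ ∂μ := by
    intro f s hs t ht
    rw [← ofReal_norm, intervalIntegral.norm_intervalIntegral_eq, ofReal_norm]
    refine (enorm_integral_le_lintegral_enorm _).trans (lintegral_mono' (Measure.restrict_mono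
      ?_ le_rfl) le_rfl)
    exact uIoc_subset_uIcc.trans (uIcc_subset_Icc hs ht)
  have hii : ∀ f : ℝ → E, Integrable f μ → ∀ s ∈ Icc (0 : ℝ) 1, ∀ t ∈ Icc (0 : ℝ) 1,
      IntervalIntegrable f volume s t := by
    intro f hf s hs t ht
    rw [intervalIntegrable_iff]
    exact IntegrableOn.mono_set hf (uIoc_subset_uIcc.trans (uIcc_subset_Icc hs ht))
  have z0 : (0 : ℝ) ∈ Icc (0 : ℝ) 1 := by simp
  -- compactness
  obtain ⟨γ, φ₁, hγ, hφ₁, hlim₁⟩ := exists_subseq_tendsto_of_modulus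
    (fun n t => x₀ + ∫ r in (0 : ℝ)..t, b (σ n r) (ξ n r)) x₀ M
    (fun k => ((2 ^ k)⁻¹ * C).toReal)
    ((ENNReal.tendsto_toReal zero_ne_top).comp hclim) (by simp)
    (by
      intro k n s hs t ht
      obtain ⟨h1, h2, h3⟩ := key (σ n) (ξ n) (hσ n) (hξ n) (hbound n)
      rw [add_sub_add_left_eq_sub, intervalIntegral.integral_interval_sub_left
        (hii _ h2 _ z0 _ ht) (hii _ h2 _ z0 _ hs)]
      -- Although `b` is unbounded, this split bounds the increment by `M k * |t - s|` plus `2⁻ᵏ C`,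
      -- uniformly in `n`: an equicontinuity estimate for every `k`.
      have e : ∫ r in s..t, b (σ n r) (ξ n r) = (∫ r in s..t, w k (σ n r, ξ n r)) +
          ∫ r in s..t, (b (σ n r) (ξ n r) - w k (σ n r, ξ n r)) := by
        rw [intervalIntegral.integral_sub (hii _ h2 _ hs _ ht) (hii _ (h1 k) _ hs _ ht)]
        abel
      rw [e]
      refine (norm_add_le _ _).trans (add_le_add ?_ ?_)
      · exact intervalIntegral.norm_integral_le_of_norm_le_const fun r _ => hM k _
      · rw [← toReal_enorm]
        exact ENNReal.toReal_mono (hcfin k) ((hsub _ s hs t ht).trans (h3 k)))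
  -- almost everywhere convergence of `ξ`
  have hmeasη : ∀ n, AEStronglyMeasurable
      (fun s => x₀ + ∫ r in (0 : ℝ)..s, b (σ n r) (ξ n r)) μ := by
    intro n
    obtain ⟨-, h2, -⟩ := key (σ n) (ξ n) (hσ n) (hξ n) (hbound n)
    refine ContinuousOn.aestronglyMeasurable ?_ measurableSet_Icc
    refine continuousOn_const.add ?_
    have := intervalIntegral.continuousOn_primitive_interval
      (f := fun r => b (σ n r) (ξ n r)) (a := 0) (b := 1) (μ := volume)
      (by rw [uIcc_of_le zero_le_one]; exact h2)
    rwa [uIcc_of_le zero_le_one] at this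
  have hmeas : ∀ n, AEStronglyMeasurable
      (fun s => ξ n s - (x₀ + ∫ r in (0 : ℝ)..s, b (σ n r) (ξ n r))) μ := fun n =>
    (hξ n).aestronglyMeasurable.sub (hmeasη n)
  -- The residual tends to zero only in `L¹` of time; a further subsequence makes `ξ` itself
  -- converge at almost every time.
  obtain ⟨φ₂, hφ₂, hae⟩ := (tendstoInMeasure_of_tendsto_eLpNorm (μ := μ) (p := 1) one_ne_zero
    (fun n => hmeas (φ₁ n)) (g := 0) aestronglyMeasurable_const
    (by
      simp only [sub_zero, eLpNorm_one_eq_lintegral_enorm]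
      exact hres.comp hφ₁.tendsto_atTop)).exists_seq_tendsto_ae
  set φ := φ₁ ∘ φ₂ with hφdef
  have hφ : StrictMono φ := hφ₁.comp hφ₂
  have hlim : ∀ t ∈ Icc (0 : ℝ) 1, Tendsto
      (fun n => x₀ + ∫ r in (0 : ℝ)..t, b (σ (φ n) r) (ξ (φ n) r)) atTop (𝓝 (γ t)) :=
    fun t ht => (hlim₁ t ht).comp hφ₂.tendsto_atTop
  have hpair : ∀ᵐ s ∂μ, Tendsto (fun n => (σ (φ n) s, ξ (φ n) s)) atTop (𝓝 (s, γ s)) := by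
    filter_upwards [hae, ae_restrict_mem measurableSet_Icc] with s hs hs1
    refine ((hσlim s hs1).comp hφ.tendsto_atTop).prodMk_nhds ?_
    have := hs.add (hlim s hs1)
    simpa [hφdef] using this
  -- Lower semicontinuity with Fatou's lemma transfers the gauge bound to the limit curve, so `b` is
  -- also well approximated by `w k` along `γ`.
  have hΦγ : ∫⁻ s, Φ (s, γ s) ∂μ ≤ C := by
    calc _ ≤ ∫⁻ s, liminf (fun n => Φ (σ (φ n) s, ξ (φ n) s)) atTop ∂μ := by
          refine lintegral_mono_ae ?_
          filter_upwards [hpair] with s hs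
          exact (hΦ.le_liminf (s, γ s)).trans (liminf_le_liminf_of_le hs)
      _ ≤ liminf (fun n => ∫⁻ s, Φ (σ (φ n) s, ξ (φ n) s) ∂μ) atTop :=
          lintegral_liminf_le' fun n =>
            (hΦ.measurable.comp ((hσ _).prodMk (hξ _))).aemeasurable
      _ ≤ C := by
          refine (liminf_le_liminf (Eventually.of_forall fun n => hbound (φ n))).trans ?_
          simp
  obtain ⟨hγ1, hγ2, hγ3⟩ := key id γ measurable_id hγ.measurable hΦγ
  simp only [id] at hγ1 hγ2 hγ3
  refine ⟨γ, φ, hφ, hii _ hγ2 _ z0 _ (by simp), fun t ht => ?_, hΦγ, hlim⟩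
  refine tendsto_nhds_unique (hlim t ht) (tendsto_const_nhds.add ?_)
  -- Replacing `b` by `w k` costs at most `2⁻ᵏ C`, along the approximations and along the limit
  -- alike. For fixed `k` the field is continuous and bounded, and dominated convergence applies.
  refine tendsto_of_forall_enorm_sub_le _ (fun k n => ∫ r in (0 : ℝ)..t, w k (σ (φ n) r, ξ (φ n) r))
    _ (fun k => ∫ r in (0 : ℝ)..t, w k (r, γ r)) _ hclim ?_ ?_ ?_
  · intro k n
    obtain ⟨h1, h2, h3⟩ := key (σ (φ n)) (ξ (φ n)) (hσ _) (hξ _) (hbound _)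
    rw [← intervalIntegral.integral_sub (hii _ h2 _ z0 _ ht) (hii _ (h1 k) _ z0 _ ht)]
    exact (hsub _ _ z0 _ ht).trans (h3 k)
  · intro k
    rw [← intervalIntegral.integral_sub (hii _ hγ2 _ z0 _ ht) (hii _ (hγ1 k) _ z0 _ ht)]
    exact (hsub _ _ z0 _ ht).trans (hγ3 k)
  · intro k
    refine intervalIntegral.tendsto_integral_filter_of_dominated_convergence (fun _ => M k) ?_ ?_
      intervalIntegrable_const ?_
    · exact Eventually.of_forall fun n =>
        ((hw k).measurable.comp ((hσ _).prodMk (hξ _))).aestronglyMeasurable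
    · exact Eventually.of_forall fun n => ae_of_all _ fun r _ => hM k _
    · have := (ae_restrict_iff' measurableSet_Icc).1 hpair
      filter_upwards [this] with r hr hrt
      have hr1 : r ∈ Icc (0 : ℝ) 1 := (uIoc_subset_uIcc.trans (uIcc_subset_Icc z0 ht)) hrt
      exact ((hw k).tendsto _).comp (hr hr1)

end Deterministic

/-! ### Convergence in mean and continuity of translations -/

/-- A bounded sequence which tends to zero along the subsequences on which an auxiliary sequence
with bounded expectations stays bounded, tends to zero in mean. -/
lemma tendsto_lintegral_zero_of_subseq {Ω : Type*} [MeasurableSpace Ω] {μ : Measure Ω}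
    [IsFiniteMeasure μ] (d : ℕ → Ω → ℝ≥0∞) (hd : ∀ n, Measurable (d n)) (B : ℝ≥0∞) (hB : B ≠ ∞)
    (hdB : ∀ n ω, d n ω ≤ B) (C : ℕ → Ω → ℝ≥0∞) (hC : ∀ n, Measurable (C n)) (K : ℝ≥0∞)
    (hK : K ≠ ∞) (hCK : ∀ n, ∫⁻ ω, C n ω ∂μ ≤ K)
    (h : ∀ᵐ ω ∂μ, ∀ c : ℝ≥0∞, c ≠ ∞ → ∀ φ : ℕ → ℕ, StrictMono φ → (∀ n, C (φ n) ω ≤ c) →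
      ∃ ψ : ℕ → ℕ, StrictMono ψ ∧ Tendsto (fun n => d (φ (ψ n)) ω) atTop (𝓝 0)) :
    Tendsto (fun n => ∫⁻ ω, d n ω ∂μ) atTop (𝓝 0) := by
  have htrunc : ∀ c : ℝ≥0∞, c ≠ ∞ →
      Tendsto (fun n => ∫⁻ ω, {ω | C n ω ≤ c}.indicator (d n) ω ∂μ) atTop (𝓝 0) := by
    intro c hc
    have hz : (0 : ℝ≥0∞) = ∫⁻ _, 0 ∂μ := by simp
    rw [hz]
    refine tendsto_lintegral_of_dominated_convergence (fun _ => B)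
      (fun n => (hd n).indicator (measurableSet_le (hC n) measurable_const))
      (fun n => ae_of_all _ fun ω => (indicator_le_self' (by simp) _).trans (hdB n ω))
      (by simpa using ENNReal.mul_ne_top hB (measure_ne_top μ _)) ?_
    filter_upwards [h] with ω hω
    rw [ENNReal.tendsto_nhds_zero]
    intro ε hε
    by_contra hcon
    -- Indices at which the truncated sequence exceeds `ε` automatically satisfy `C n ω ≤ c`, since
    -- the indicator vanishes elsewhere; so the subsequence hypothesis applies to them.
    rw [not_eventually] at hcon
    obtain ⟨φ, hφ, hφP⟩ := extraction_of_frequently_atTop hcon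
    have hle : ∀ n, C (φ n) ω ≤ c := by
      intro n
      by_contra hn
      exact hφP n (by rw [indicator_of_notMem (by simpa using hn)]; exact zero_le)
    obtain ⟨ψ, hψ, hlim⟩ := hω c hc φ hφ hle
    obtain ⟨n, hn⟩ := ((ENNReal.tendsto_nhds_zero.1 hlim) ε hε).exists
    exact hφP (ψ n) (by rw [indicator_of_mem (by exact hle (ψ n))]; exact hn)
  rw [ENNReal.tendsto_nhds_zero]
  intro ε hε
  -- By Markov's inequality the event `c ≤ C n` has measure at most `K / c`, and it contributes at
  -- most `B * (K / c)`.
  obtain ⟨c, hc0, hc, hcε⟩ : ∃ c : ℝ≥0∞, c ≠ 0 ∧ c ≠ ∞ ∧ B * (K / c) ≤ ε / 2 := by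
    have h1 : Tendsto (fun n : ℕ => B * (K / (n : ℝ≥0∞))) atTop (𝓝 (B * 0)) := by
      refine ENNReal.Tendsto.const_mul ?_ (Or.inr hB)
      have := ENNReal.Tendsto.const_mul (a := K) ENNReal.tendsto_inv_nat_nhds_zero (Or.inr hK)
      simpa [div_eq_mul_inv] using this
    rw [mul_zero] at h1
    obtain ⟨n, hn, hn0⟩ := (((ENNReal.tendsto_nhds_zero.1 h1) (ε / 2)
      (ENNReal.half_pos hε.ne')).and (eventually_gt_atTop 0)).exists
    exact ⟨n, by exact_mod_cast hn0.ne', ENNReal.natCast_ne_top n, hn⟩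
  filter_upwards [(ENNReal.tendsto_nhds_zero.1 (htrunc c hc)) (ε / 2) (ENNReal.half_pos hε.ne')]
    with n hn
  calc ∫⁻ ω, d n ω ∂μ
      ≤ ∫⁻ ω, {ω | C n ω ≤ c}.indicator (d n) ω + {ω | c ≤ C n ω}.indicator (fun _ => B) ω ∂μ := by
        refine lintegral_mono fun ω => ?_
        rcases le_total (C n ω) c with h1 | h1
        · rw [indicator_of_mem (by exact h1)]; exact le_self_add
        · rw [indicator_of_mem (s := {ω | c ≤ C n ω}) (by exact h1)]
          exact (hdB n ω).trans le_add_self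
    _ = (∫⁻ ω, {ω | C n ω ≤ c}.indicator (d n) ω ∂μ) + B * μ {ω | c ≤ C n ω} := by
        rw [lintegral_add_left ((hd n).indicator (measurableSet_le (hC n) measurable_const)),
          lintegral_indicator_const (measurableSet_le measurable_const (hC n))]
    _ ≤ ε / 2 + B * (K / c) := by
        gcongr
        exact (meas_ge_le_lintegral_div (hC n).aemeasurable hc0 hc).trans (by gcongr; exact hCK n)
    _ ≤ ε / 2 + ε / 2 := by gcongr
    _ = ε := ENNReal.add_halves ε

/-- Continuity of translations in `L¹(ℝ)`. -/
lemma tendsto_lintegral_translate_sub {E : Type*} [NormedAddCommGroup E] [NormedSpace ℝ E]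
    (f : ℝ → E) (hf : Integrable f) :
    Tendsto (fun r : ℝ => ∫⁻ s, ‖f (s + r) - f s‖ₑ) (𝓝 0) (𝓝 0) := by
  rw [ENNReal.tendsto_nhds_zero]
  intro ε hε
  -- The distance from `f` to `g` enters twice, once translated, hence `ε / 4`; the other `ε / 2` is
  -- left for `g`.
  obtain ⟨g, hgc, hg, hgcont, hgm⟩ := (memLp_one_iff_integrable.2 hf).exists_hasCompactSupport_eLpNorm_sub_le
    one_ne_top (ε := ε / 4) (ENNReal.div_pos hε.ne' (by simp)).ne'
  rw [eLpNorm_one_eq_lintegral_enorm] at hg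
  simp only [Pi.sub_apply] at hg
  have hgint : Integrable g := memLp_one_iff_integrable.1 hgm
  have hglim : Tendsto (fun r : ℝ => ∫⁻ s, ‖g (s + r) - g s‖ₑ) (𝓝 0) (𝓝 0) := by
    obtain ⟨R, hR⟩ := hgc.isCompact.isBounded.subset_closedBall 0
    obtain ⟨B, hB⟩ := hgcont.bounded_above_of_compact_support hgc
    have hz : (0 : ℝ≥0∞) = ∫⁻ _ : ℝ, 0 := by simp
    rw [hz]
    -- For `|r| < 1` the translated and original supports both lie in the ball of radius `R + 1`,
    -- which gives an integrable majorant independent of `r`.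
    refine tendsto_lintegral_filter_of_dominated_convergence
      ((Metric.closedBall (0 : ℝ) (R + 1)).indicator fun _ => ENNReal.ofReal (B + B)) ?_ ?_ ?_ ?_
    · refine Eventually.of_forall fun r => ?_
      have : Continuous fun s => ‖g (s + r) - g s‖ₑ := by fun_prop
      exact this.measurable
    · filter_upwards [Metric.ball_mem_nhds (0 : ℝ) one_pos] with r hr
      refine ae_of_all _ fun s => ?_
      by_cases hs : s ∈ Metric.closedBall (0 : ℝ) (R + 1)
      · rw [indicator_of_mem hs, ← ofReal_norm]
        exact ENNReal.ofReal_le_ofReal ((norm_sub_le _ _).trans (add_le_add (hB _) (hB _)))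
      · rw [indicator_of_notMem hs]
        have h0 : ∀ u : ℝ, R < |u| → g u = 0 := by
          intro u hu
          by_contra hgu
          have := hR (subset_tsupport g hgu)
          rw [Metric.mem_closedBall, dist_zero_right, Real.norm_eq_abs] at this
          linarith
        rw [Metric.mem_closedBall, dist_zero_right, Real.norm_eq_abs, not_le] at hs
        rw [Metric.mem_ball, dist_zero_right, Real.norm_eq_abs] at hr
        have h2 : R < |s + r| := by
          have := abs_sub_abs_le_abs_sub s (-r)
          rw [abs_neg, sub_neg_eq_add] at this
          linarith
        rw [h0 _ h2, h0 s (by linarith)]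
        simp
    · rw [lintegral_indicator_const Metric.isClosed_closedBall.measurableSet]
      exact ENNReal.mul_ne_top ofReal_ne_top measure_closedBall_lt_top.ne
    · refine ae_of_all _ fun s => ?_
      have : Continuous fun r => ‖g (s + r) - g s‖ₑ := by fun_prop
      simpa using this.tendsto 0
  filter_upwards [(ENNReal.tendsto_nhds_zero.1 hglim) (ε / 2) (ENNReal.half_pos hε.ne')] with r hr
  have hm1 : AEMeasurable (fun s => ‖f s - g s‖ₑ) volume := (hf.sub hgint).1.enorm
  have hm2 : AEMeasurable (fun s => ‖f (s + r) - g (s + r)‖ₑ) volume :=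
    ((hf.sub hgint).comp_add_right r).1.enorm
  have htr : ∫⁻ s, ‖f (s + r) - g (s + r)‖ₑ = ∫⁻ s, ‖f s - g s‖ₑ :=
    lintegral_add_right_eq_self (fun s => ‖f s - g s‖ₑ) r
  calc ∫⁻ s, ‖f (s + r) - f s‖ₑ
      ≤ ∫⁻ s, ((‖f (s + r) - g (s + r)‖ₑ + ‖f s - g s‖ₑ) + ‖g (s + r) - g s‖ₑ) := by
        refine lintegral_mono fun s => ?_
        have e : f (s + r) - f s =
          (f (s + r) - g (s + r)) - (f s - g s) + (g (s + r) - g s) := by abel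
        rw [e]
        exact (enorm_add_le _ _).trans (by gcongr; exact enorm_sub_le)
    _ = (∫⁻ s, ‖f s - g s‖ₑ) + (∫⁻ s, ‖f s - g s‖ₑ) + ∫⁻ s, ‖g (s + r) - g s‖ₑ := by
        rw [lintegral_add_left' (by exact hm2.add hm1), lintegral_add_left' hm2, htr]
    _ ≤ ε / 4 + ε / 4 + ε / 2 := by gcongr
    _ = ε := by
        have : ε / 4 + ε / 4 = ε / 2 := by
          rw [← ENNReal.add_div, ← two_mul, ENNReal.mul_div_right_comm,
            show (4 : ℝ≥0∞) = 2 * 2 by norm_num, div_eq_mul_inv, div_eq_mul_inv,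
            ENNReal.mul_inv (by simp) (by simp), ← mul_assoc,
            ENNReal.mul_inv_cancel (by simp) (by simp), one_mul, mul_comm]
        rw [this, ENNReal.add_halves]

/-- Continuity of translations in `L¹(ℝ × Ω)`. -/
lemma tendsto_lintegral_lintegral_translate_sub {Ω E : Type*} [MeasurableSpace Ω] {P : Measure Ω}
    [IsFiniteMeasure P] [NormedAddCommGroup E] [NormedSpace ℝ E]
    (V : ℝ → Ω → E) (hVm : StronglyMeasurable (Function.uncurry V))
    (hV : Integrable (Function.uncurry V) (volume.prod P)) :
    Tendsto (fun r : ℝ => ∫⁻ s, ∫⁻ ω, ‖V (s + r) ω - V s ω‖ₑ ∂P) (𝓝 0) (𝓝 0) := by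
  have hm : ∀ r : ℝ, StronglyMeasurable (fun p : ℝ × Ω => V (p.1 + r) p.2 - V p.1 p.2) := by
    intro r
    refine StronglyMeasurable.sub (hVm.comp_measurable (g := fun p : ℝ × Ω => (p.1 + r, p.2)) ?_) hVm
    fun_prop
  have hswap : ∀ r : ℝ, ∫⁻ s, ∫⁻ ω, ‖V (s + r) ω - V s ω‖ₑ ∂P =
      ∫⁻ ω, (∫⁻ s, ‖V (s + r) ω - V s ω‖ₑ) ∂P := by
    intro r
    exact lintegral_lintegral_swap (f := fun s ω => ‖V (s + r) ω - V s ω‖ₑ) (hm r).enorm.aemeasurable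
  simp_rw [hswap]
  have hae : ∀ᵐ ω ∂P, Integrable (fun s => V s ω) := hV.prod_left_ae
  have hz : (0 : ℝ≥0∞) = ∫⁻ _, 0 ∂P := by simp
  rw [hz]
  -- The one-dimensional statement holds for almost every `ω`; translation invariance gives a
  -- majorant that does not depend on `r`.
  refine tendsto_lintegral_filter_of_dominated_convergence (fun ω => 2 * ∫⁻ s, ‖V s ω‖ₑ) ?_ ?_ ?_ ?_
  · exact Eventually.of_forall fun r => (hm r).enorm.lintegral_prod_left'
  · refine Eventually.of_forall fun r => ae_of_all _ fun ω => ?_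
    have h1 : Measurable fun s => ‖V s ω‖ₑ :=
      (hVm.enorm).comp (measurable_id.prodMk measurable_const)
    calc ∫⁻ s, ‖V (s + r) ω - V s ω‖ₑ ≤ ∫⁻ s, (‖V (s + r) ω‖ₑ + ‖V s ω‖ₑ) :=
          lintegral_mono fun s => enorm_sub_le
      _ = 2 * ∫⁻ s, ‖V s ω‖ₑ := by
          rw [lintegral_add_right _ h1, lintegral_add_right_eq_self (fun s => ‖V s ω‖ₑ) r, two_mul]
  · have h2 : ∫⁻ ω, (∫⁻ s, ‖V s ω‖ₑ) ∂P = ∫⁻ p, ‖Function.uncurry V p‖ₑ ∂(volume.prod P) := by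
      rw [lintegral_prod_symm' _ hVm.enorm]; rfl
    rw [lintegral_const_mul' _ _ (by simp), h2]
    exact ENNReal.mul_ne_top (by simp) hV.2.ne
  · filter_upwards [hae] with ω hω
    exact tendsto_lintegral_translate_sub _ hω

/-! ### Independent uniform noise -/

/-- The law of a sequence of independent uniform variables. -/
noncomputable def uniformNoise : Measure (ℕ → unitInterval) := Measure.infinitePi fun _ => volume

instance : IsProbabilityMeasure uniformNoise := by unfold uniformNoise; infer_instance

/-- A product measure is determined by finite cylinders, and on a cylinder the constraint at
coordinate `0` splits off as one factor. This lets one noise variable be peeled off at a time. -/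
lemma map_cons_uniformNoise :
    (((volume : Measure unitInterval).prod uniformNoise).map
      (fun q : unitInterval × (ℕ → unitInterval) => fun n : ℕ => Nat.casesOn n q.1 q.2)) =
      uniformNoise := by
  have hmeas : Measurable (fun q : unitInterval × (ℕ → unitInterval) =>
      (fun n : ℕ => (Nat.casesOn n q.1 q.2 : unitInterval))) := by
    refine measurable_pi_iff.2 fun n => ?_
    cases n with
    | zero => exact measurable_fst
    | succ n => exact (measurable_pi_apply n).comp measurable_snd
  refine Measure.eq_infinitePi _ fun s t ht => ?_
  rw [Measure.map_apply hmeas (MeasurableSet.pi s.countable_toSet fun i _ => ht i)]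
  have hpre : (fun q : unitInterval × (ℕ → unitInterval) =>
      (fun n : ℕ => (Nat.casesOn n q.1 q.2 : unitInterval))) ⁻¹' ((s : Set ℕ).pi t) =
      (if 0 ∈ s then t 0 else univ) ×ˢ
        (((s.preimage Nat.succ Nat.succ_injective.injOn : Finset ℕ) : Set ℕ).pi
          fun n => t (n + 1)) := by
    ext ⟨u, r⟩
    simp only [mem_preimage, Set.mem_pi, Finset.mem_coe, mem_prod, Finset.mem_preimage]
    constructor
    · intro h
      refine ⟨?_, fun i hi => h (i + 1) hi⟩
      split_ifs with h0
      · exact h 0 h0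
      · trivial
    · rintro ⟨h0, h1⟩ i hi
      cases i with
      | zero => rw [if_pos hi] at h0; exact h0
      | succ i => exact h1 i hi
  rw [hpre, Measure.prod_prod, uniformNoise, Measure.infinitePi_pi _ (fun i _ => ht _)]
  have hsucc : ∏ i ∈ s.preimage Nat.succ Nat.succ_injective.injOn,
      (volume : Measure unitInterval) (t (i + 1)) =
      ∏ i ∈ s.erase 0, (volume : Measure unitInterval) (t i) := by
    refine Finset.prod_bij (fun i _ => i + 1) ?_ ?_ ?_ ?_
    · intro i hi
      simpa using hi
    · intro i _ j _ h
      simpa using h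
    · intro j hj
      rw [Finset.mem_erase] at hj
      obtain ⟨i, rfl⟩ := Nat.exists_eq_succ_of_ne_zero hj.1
      exact ⟨i, by simpa using hj.2, rfl⟩
    · intro i _; rfl
  rw [hsucc]
  split_ifs with h0
  · exact Finset.mul_prod_erase s (fun i => (volume : Measure unitInterval) (t i)) h0
  · rw [Finset.erase_eq_of_notMem h0, measure_univ, one_mul]

/-! ### Random dynamical systems driven by independent noise -/

section Stream

variable {S : Type*} [MeasurableSpace S]

/-- The states of the system `s_{n + 1} = H n s_n r_n`, driven by the sequence `r`. -/
def streamState (H : ℕ → S → unitInterval → S) (s : S) (r : ℕ → unitInterval) : ℕ → S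
  | 0 => s
  | n + 1 => H n (streamState H s r n) (r n)

lemma measurable_streamState (H : ℕ → S → unitInterval → S)
    (hH : ∀ n, Measurable (Function.uncurry (H n))) (n : ℕ) :
    Measurable (fun p : S × (ℕ → unitInterval) => streamState H p.1 p.2 n) := by
  induction n with
  | zero => exact measurable_fst
  | succ n ih => exact (hH n).comp (ih.prodMk ((measurable_pi_apply n).comp measurable_snd))

/-- Independence from the whole remaining noise, and not only from the next variable, is what
propagates by induction: one step consumes the first coordinate and leaves an independent sequence
of the same law. -/
lemma map_streamState_shift (H : ℕ → S → unitInterval → S)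
    (hH : ∀ n, Measurable (Function.uncurry (H n))) (μ : Measure S) [IsFiniteMeasure μ] (n : ℕ) :
    (μ.prod uniformNoise).map (fun p => (streamState H p.1 p.2 n, fun k => p.2 (n + k))) =
      ((μ.prod uniformNoise).map (fun p => streamState H p.1 p.2 n)).prod uniformNoise := by
  have hshift : ∀ m : ℕ, Measurable (fun r : ℕ → unitInterval => fun k => r (m + k)) := fun m =>
    measurable_pi_iff.2 fun k => measurable_pi_apply _
  induction n with
  | zero =>
    simp only [streamState, zero_add]
    have h1 : (μ.prod uniformNoise).map (fun p => p.1) = μ := by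
      rw [← Measure.fst, Measure.fst_prod]
    rw [h1]
    exact Measure.map_id
  | succ n ih =>
    set M := (μ.prod uniformNoise).map (fun p => streamState H p.1 p.2 n) with hM
    have hfin : IsFiniteMeasure M := by rw [hM]; infer_instance
    set cons : unitInterval × (ℕ → unitInterval) → (ℕ → unitInterval) :=
      fun q => fun n : ℕ => Nat.casesOn n q.1 q.2 with hcons
    have hconsm : Measurable cons := by
      refine measurable_pi_iff.2 fun n => ?_
      cases n with
      | zero => exact measurable_fst
      | succ n => exact (measurable_pi_apply n).comp measurable_snd
    have hst := measurable_streamState H hH n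
    have hΨ : Measurable (fun q : S × (ℕ → unitInterval) => (H n q.1 (q.2 0), fun k => q.2 (1 + k))) :=
      ((hH n).comp (measurable_fst.prodMk ((measurable_pi_apply 0).comp measurable_snd))).prodMk
        ((hshift 1).comp measurable_snd)
    have hL : (μ.prod uniformNoise).map
        (fun p => (streamState H p.1 p.2 (n + 1), fun k => p.2 (n + 1 + k))) =
        (M.prod uniformNoise).map
          (fun q : S × (ℕ → unitInterval) => (H n q.1 (q.2 0), fun k => q.2 (1 + k))) := by
      have hst2 : Measurable (fun p : S × (ℕ → unitInterval) =>
          (streamState H p.1 p.2 n, fun k => p.2 (n + k))) :=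
        hst.prodMk ((hshift n).comp measurable_snd)
      rw [← ih, Measure.map_map hΨ hst2]
      congr 1
      ext p : 1
      simp [streamState, add_assoc]
    have hH' : Measurable (fun q : S × unitInterval => H n q.1 q.2) := hH n
    have hR : (M.prod uniformNoise).map
          (fun q : S × (ℕ → unitInterval) => (H n q.1 (q.2 0), fun k => q.2 (1 + k))) =
        ((M.prod volume).map (fun q : S × unitInterval => H n q.1 q.2)).prod uniformNoise := by
      have h1 : M.prod uniformNoise = (M.prod ((volume : Measure unitInterval).prod uniformNoise)).map
          (Prod.map id cons) := by
        rw [← Measure.map_prod_map _ _ measurable_id hconsm, Measure.map_id, map_cons_uniformNoise]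
      rw [h1, Measure.map_map hΨ (measurable_id.prodMap hconsm)]
      have h2 : M.prod ((volume : Measure unitInterval).prod uniformNoise) =
          ((M.prod (volume : Measure unitInterval)).prod uniformNoise).map
            MeasurableEquiv.prodAssoc := (Measure.prodAssoc_prod (μ := M)).symm
      rw [h2, Measure.map_map (hΨ.comp (measurable_id.prodMap hconsm))
        MeasurableEquiv.prodAssoc.measurable]
      have h3 := Measure.map_prod_map (M.prod (volume : Measure unitInterval)) uniformNoise
        hH' measurable_id
      rw [Measure.map_id] at h3
      rw [h3]
      congr 1
      ext q : 1
      refine Prod.ext rfl ?_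
      funext k
      simp [hcons, MeasurableEquiv.prodAssoc, Nat.add_comm 1 k]
    rw [hL, hR]
    congr 1
    have h4 := congrArg (fun ν => Measure.map Prod.fst ν) (hL.trans hR)
    have hst3 : Measurable (fun p : S × (ℕ → unitInterval) =>
        (streamState H p.1 p.2 (n + 1), fun k => p.2 (n + 1 + k))) :=
      (measurable_streamState H hH (n + 1)).prodMk ((hshift (n + 1)).comp measurable_snd)
    change ((μ.prod uniformNoise).map _).map Prod.fst = Measure.fst _ at h4
    rw [Measure.map_map measurable_fst hst3, Measure.fst_prod] at h4
    exact h4.symm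

/-- The state `s_n` is independent of the noise `r_n`. -/
lemma map_streamState_noise (H : ℕ → S → unitInterval → S)
    (hH : ∀ n, Measurable (Function.uncurry (H n))) (μ : Measure S) [IsFiniteMeasure μ] (n : ℕ) :
    (μ.prod uniformNoise).map (fun p => (streamState H p.1 p.2 n, p.2 n)) =
      ((μ.prod uniformNoise).map (fun p => streamState H p.1 p.2 n)).prod volume := by
  have hshift : Measurable (fun r : ℕ → unitInterval => fun k => r (n + k)) :=
    measurable_pi_iff.2 fun k => measurable_pi_apply _
  have h := congrArg (fun ν => Measure.map (Prod.map id (fun r : ℕ → unitInterval => r 0)) ν)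
    (map_streamState_shift H hH μ n)
  have hst2 : Measurable (fun p : S × (ℕ → unitInterval) =>
      (streamState H p.1 p.2 n, fun k => p.2 (n + k))) :=
    (measurable_streamState H hH n).prodMk (hshift.comp measurable_snd)
  change ((μ.prod uniformNoise).map _).map _ = Measure.map _ _ at h
  rw [Measure.map_map (measurable_id.prodMap (measurable_pi_apply 0)) hst2,
    ← Measure.map_prod_map _ _ measurable_id (measurable_pi_apply 0), Measure.map_id] at h
  have h0 : uniformNoise.map (fun r : ℕ → unitInterval => r 0) = volume :=
    Measure.infinitePi_map_eval _ 0
  rw [h0] at h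
  exact h

variable {E : Type*} [NormedAddCommGroup E] [InnerProductSpace ℝ E] [FiniteDimensional ℝ E]
  [MeasurableSpace E] [BorelSpace E]

/-- Sums of bounded increments with conditional mean zero are of the order of the square root of
the number of increments. -/
lemma integral_norm_sq_sum_streamState_le (H : ℕ → S → unitInterval → S)
    (hH : ∀ n, Measurable (Function.uncurry (H n))) (μ : Measure S) [IsFiniteMeasure μ]
    (m : ℕ → S → unitInterval → E) (hm : ∀ n, Measurable (Function.uncurry (m n)))
    (B : ℝ) (hB : ∀ n s u, ‖m n s u‖ ≤ B) (hmean : ∀ n s, ∫ u, m n s u = 0) (n : ℕ) :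
    ∫ p, ‖∑ l ∈ Finset.range n, m l (streamState H p.1 p.2 l) (p.2 l)‖ ^ 2
      ∂(μ.prod uniformNoise) ≤ n * (B ^ 2 * μ.real univ) := by
  set Q := μ.prod uniformNoise with hQ
  -- the system which records the partial sums
  let H' : ℕ → S × E → unitInterval → S × E := fun n a u => (H n a.1 u, a.2 + m n a.1 u)
  have hH' : ∀ n, Measurable (Function.uncurry (H' n)) := by
    intro n
    have h1 : Measurable (fun q : (S × E) × unitInterval => (q.1.1, q.2)) := by fun_prop
    exact ((hH n).comp h1).prodMk ((by fun_prop : Measurable fun q : (S × E) × unitInterval =>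
      q.1.2).add ((hm n).comp h1))
  set T : ℕ → S × (ℕ → unitInterval) → E := fun n p =>
    ∑ l ∈ Finset.range n, m l (streamState H p.1 p.2 l) (p.2 l) with hT
  have hst' : ∀ n (p : S × (ℕ → unitInterval)), streamState H' (p.1, 0) p.2 n =
      (streamState H p.1 p.2 n, T n p) := by
    intro n p
    induction n with
    | zero => simp [streamState, hT]
    | succ n ih => simp only [streamState, ih, H', hT, Finset.sum_range_succ]
  have hinc : ∀ n, Measurable (fun p : S × (ℕ → unitInterval) =>
      m n (streamState H p.1 p.2 n) (p.2 n)) := fun n =>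
    (hm n).comp ((measurable_streamState H hH n).prodMk
      ((measurable_pi_apply n).comp measurable_snd))
  have hTm : ∀ n, Measurable (T n) := fun n =>
    Finset.measurable_sum _ fun l _ => hinc l
  have hTB : ∀ n p, ‖T n p‖ ≤ n * B := by
    intro n p
    refine (norm_sum_le _ _).trans ((Finset.sum_le_sum fun l _ => hB _ _ _).trans ?_)
    simp
  have hbdd : ∀ {f : S × (ℕ → unitInterval) → ℝ} (c : ℝ), Measurable f → (∀ p, ‖f p‖ ≤ c) →
      Integrable f Q := fun c hf hc =>
    Integrable.of_bound hf.aestronglyMeasurable c (ae_of_all _ hc)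
  -- the joint law of the state, the partial sum and the noise
  have hlaw : ∀ n, Q.map (fun p => ((streamState H p.1 p.2 n, T n p), p.2 n)) =
      (Q.map (fun p => (streamState H p.1 p.2 n, T n p))).prod volume := by
    intro n
    have h := map_streamState_noise H' hH' (μ.map fun s => (s, (0 : E))) n
    have hemb : Measurable fun s : S => (s, (0 : E)) := measurable_id.prodMk measurable_const
    have h1 : (μ.map fun s => (s, (0 : E))).prod uniformNoise =
        Q.map (Prod.map (fun s => (s, (0 : E))) id) := by
      rw [hQ, ← Measure.map_prod_map _ _ hemb measurable_id, Measure.map_id]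
    have h2 : Measurable (fun p : (S × E) × (ℕ → unitInterval) =>
        (streamState H' p.1 p.2 n, p.2 n)) :=
      (measurable_streamState H' hH' n).prodMk ((measurable_pi_apply n).comp measurable_snd)
    rw [h1, Measure.map_map h2 (hemb.prodMap measurable_id),
      Measure.map_map (measurable_streamState H' hH' n) (hemb.prodMap measurable_id)] at h
    simpa [Function.comp_def, hst'] using h
  -- Orthogonality of martingale increments: state and partial sum are independent of `p.2 n`, so
  -- integrating over the noise first leaves the inner product with `hmean`.
  have hcross : ∀ n, ∫ p, inner ℝ (T n p) (m n (streamState H p.1 p.2 n) (p.2 n)) ∂Q = 0 := by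
    intro n
    have hF : Measurable (fun q : (S × E) × unitInterval => inner ℝ q.1.2 (m n q.1.1 q.2)) := by
      refine Measurable.inner (by fun_prop) ?_
      exact (hm n).comp (by fun_prop : Measurable fun q : (S × E) × unitInterval => (q.1.1, q.2))
    have hX : Measurable (fun p : S × (ℕ → unitInterval) =>
        ((streamState H p.1 p.2 n, T n p), p.2 n)) :=
      ((measurable_streamState H hH n).prodMk (hTm n)).prodMk
        ((measurable_pi_apply n).comp measurable_snd)
    have h1 := integral_map (μ := Q) hX.aemeasurable hF.aestronglyMeasurable
    rw [hlaw n] at h1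
    rw [← h1, integral_prod]
    · refine integral_eq_zero_of_ae (ae_of_all _ fun a => ?_)
      have hint : Integrable (fun u => m n a.1 u) :=
        Integrable.of_bound ((hm n).comp (measurable_const.prodMk measurable_id)).aestronglyMeasurable
          B (ae_of_all _ fun u => hB _ _ _)
      simp only [Pi.zero_apply]
      rw [integral_inner hint, hmean, inner_zero_right]
    · rw [← hlaw n, integrable_map_measure hF.aestronglyMeasurable hX.aemeasurable]
      refine hbdd (n * B * B) (hF.comp hX) fun p => ?_
      exact (norm_inner_le_norm _ _).trans (mul_le_mul (hTB n p) (hB _ _ _) (norm_nonneg _)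
        ((norm_nonneg _).trans (hTB n p)))
  change ∫ p, ‖T n p‖ ^ 2 ∂Q ≤ _
  have hQu : Q.real univ = μ.real univ := by
    rw [hQ, Measure.real, Measure.real, ← univ_prod_univ, Measure.prod_prod,
      measure_univ (μ := uniformNoise), mul_one]
  induction n with
  | zero => simp [hT]
  | succ n ih =>
    have hexp : ∀ p, ‖T (n + 1) p‖ ^ 2 = ‖T n p‖ ^ 2 +
        2 * inner ℝ (T n p) (m n (streamState H p.1 p.2 n) (p.2 n)) +
        ‖m n (streamState H p.1 p.2 n) (p.2 n)‖ ^ 2 := by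
      intro p
      simp only [hT, Finset.sum_range_succ]
      exact norm_add_sq_real _ _
    have i1 : Integrable (fun p => ‖T n p‖ ^ 2) Q := by
      refine hbdd ((n * B) ^ 2) ((hTm n).norm.pow_const 2) fun p => ?_
      rw [norm_pow, norm_norm]
      exact pow_le_pow_left₀ (norm_nonneg _) (hTB n p) 2
    have i2 : Integrable (fun p => 2 * inner ℝ (T n p)
        (m n (streamState H p.1 p.2 n) (p.2 n))) Q := by
      refine (hbdd (n * B * B) ((hTm n).inner (hinc n)) fun p => ?_).const_mul 2
      exact (norm_inner_le_norm _ _).trans (mul_le_mul (hTB n p) (hB _ _ _) (norm_nonneg _)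
        ((norm_nonneg _).trans (hTB n p)))
    have i3b : ∀ p : S × (ℕ → unitInterval),
        ‖m n (streamState H p.1 p.2 n) (p.2 n)‖ ^ 2 ≤ B ^ 2 := fun p =>
      pow_le_pow_left₀ (norm_nonneg _) (hB _ _ _) 2
    have i3 : Integrable (fun p : S × (ℕ → unitInterval) =>
        ‖m n (streamState H p.1 p.2 n) (p.2 n)‖ ^ 2) Q := by
      refine hbdd (B ^ 2) ((hinc n).norm.pow_const 2) fun p => ?_
      rw [norm_pow, norm_norm]
      exact i3b p
    simp_rw [hexp]
    rw [integral_add (by exact i1.add i2) i3, integral_add i1 i2, integral_const_mul, hcross n, mul_zero,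
      add_zero]
    have h3 : ∫ p, ‖m n (streamState H p.1 p.2 n) (p.2 n)‖ ^ 2 ∂Q ≤ B ^ 2 * μ.real univ := by
      refine (integral_mono i3 (integrable_const (B ^ 2)) i3b).trans ?_
      rw [integral_const, hQu, smul_eq_mul, mul_comm]
    push_cast
    linarith

end Stream

/-! ### Truncation and contraction of conditional expectations -/

/-- Truncation of the vectors of norm larger than `R`. -/
noncomputable def normTrunc {E : Type*} [NormedAddCommGroup E] (R : ℝ) (v : E) : E :=
  (Metric.closedBall (0 : E) R).indicator id v

lemma norm_normTrunc_le {E : Type*} [NormedAddCommGroup E] {R : ℝ} (hR : 0 ≤ R) (v : E) :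
    ‖normTrunc R v‖ ≤ R := by
  unfold normTrunc
  by_cases h : v ∈ Metric.closedBall (0 : E) R
  · rw [indicator_of_mem h]; simpa using h
  · rw [indicator_of_notMem h]; simpa using hR

lemma measurable_normTrunc {E : Type*} [NormedAddCommGroup E] [MeasurableSpace E] [BorelSpace E]
    (R : ℝ) : Measurable (normTrunc R : E → E) :=
  measurable_id.indicator Metric.isClosed_closedBall.measurableSet

/-- Cutting at `2 * R` ensures that a discarded vector has norm at most twice its excess over `R`.
The excess, unlike an indicator of large norm, behaves well under integration over a time step. -/
lemma enorm_sub_normTrunc_le {E : Type*} [NormedAddCommGroup E] {R : ℝ} (hR : 0 ≤ R) (v : E) :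
    ‖v - normTrunc (2 * R) v‖ₑ ≤ 2 * (‖v‖ₑ - ENNReal.ofReal R) := by
  unfold normTrunc
  by_cases h : v ∈ Metric.closedBall (0 : E) (2 * R)
  · rw [indicator_of_mem h]; simp
  · rw [indicator_of_notMem h, sub_zero, ← ofReal_norm, ← ENNReal.ofReal_sub _ hR,
      show (2 : ℝ≥0∞) = ENNReal.ofReal 2 by simp, ← ENNReal.ofReal_mul (by norm_num)]
    apply ENNReal.ofReal_le_ofReal
    simp only [Metric.mem_closedBall, dist_zero_right, not_le] at h
    linarith

lemma lintegral_enorm_condExp_sub_condExp_le {Ω E : Type*} [NormedAddCommGroup E]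
    [NormedSpace ℝ E] [CompleteSpace E] {m m0 : MeasurableSpace Ω} {P : Measure Ω}
    {f g : Ω → E} (hf : Integrable f P) (hg : Integrable g P) :
    ∫⁻ ω, ‖P[f | m] ω - P[g | m] ω‖ₑ ∂P ≤ ∫⁻ ω, ‖f ω - g ω‖ₑ ∂P := by
  have h := eLpNorm_condExp_le_eLpNorm (m := m) (μ := P) (f - g) (p := 1) le_rfl
  rw [eLpNorm_one_eq_lintegral_enorm, eLpNorm_one_eq_lintegral_enorm] at h
  refine le_trans (le_of_eq (lintegral_congr_ae ?_)) h
  filter_upwards [condExp_sub hf hg m] with ω hω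
  rw [hω]; rfl

/-! ### The Markov chain with the marginals of a given process -/

section Chain

variable {X Ω E : Type*} [MeasurableSpace X] [MeasurableSpace Ω]
  [NormedAddCommGroup E] [InnerProductSpace ℝ E] [FiniteDimensional ℝ E]
  [MeasurableSpace E] [BorelSpace E]

/-- Fubini in the uniform variable; this identifies one randomized step of the chain with a
transition by `K`. -/
lemma map_prod_volume_eq_compProd {S E : Type*} [MeasurableSpace S] [MeasurableSpace E] (M : Measure S)
    [IsFiniteMeasure M] (K : Kernel S E) [IsMarkovKernel K] (G : S → unitInterval → E)
    (hG : Measurable (Function.uncurry G)) (hGK : ∀ a, volume.map (G a) = K a) :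
    (M.prod volume).map (fun q : S × unitInterval => (q.1, G q.1 q.2)) = M ⊗ₘ K := by
  have hG' : Measurable (fun q : S × unitInterval => (q.1, G q.1 q.2)) := measurable_fst.prodMk hG
  ext s hs
  rw [Measure.map_apply hG' hs, Measure.prod_apply (hG' hs), Measure.compProd_apply hs]
  refine lintegral_congr fun a => ?_
  have hGa : Measurable (G a) := hG.comp (measurable_const.prodMk measurable_id)
  rw [← hGK a, Measure.map_apply hGa (measurable_prodMk_left hs)]
  rfl

/-- The Markov chain whose transition from `l` to `l + 1` is the conditional law of `Y (l + 1)`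
given `(ζ, Y l)`, realized on a space which carries the initial point and a sequence of
independent uniform variables. Its increments are, up to a martingale and the large increments,
given by the conditional expectations of approximate increments `g l` of `Y`. -/
lemma exists_chain (P : Measure Ω) [IsFiniteMeasure P] (ζ : Ω → X) (hζ : Measurable ζ)
    (Y : ℕ → Ω → E) (hY : ∀ l, Measurable (Y l)) :
    ∃ y : ℕ → (X × E) × (ℕ → unitInterval) → E,
      (∀ l, Measurable (y l)) ∧ (∀ p, y 0 p = p.1.2) ∧
      (∀ l, ((P.map fun ω => (ζ ω, Y 0 ω)).prod uniformNoise).map (fun p => (p.1.1, y l p)) =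
        P.map fun ω => (ζ ω, Y l ω)) ∧
      ∀ (β : ℕ → X × E → E) (g : ℕ → Ω → E) (j : ℕ) (R : ℝ), (∀ l, Measurable (β l)) → 0 ≤ R →
        (∀ l < j, Integrable (g l) P ∧ (fun ω => β l (ζ ω, Y l ω)) =ᵐ[P]
          P[g l | MeasurableSpace.comap (fun ω => (ζ ω, Y l ω)) inferInstance]) →
        ∫⁻ p, ‖y j p - p.1.2 - ∑ l ∈ Finset.range j, β l (p.1.1, y l p)‖ₑ
          ∂((P.map fun ω => (ζ ω, Y 0 ω)).prod uniformNoise) ≤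
        ENNReal.ofReal (√j * (4 * R) * P.real univ) + ∑ l ∈ Finset.range j,
          (4 * (∫⁻ ω, (‖Y (l + 1) ω - Y l ω‖ₑ - ENNReal.ofReal R) ∂P) +
            ∫⁻ ω, ‖Y (l + 1) ω - Y l ω - g l ω‖ₑ ∂P) := by
  have hζY : ∀ l, Measurable (fun ω => (ζ ω, Y l ω)) := fun l => hζ.prodMk (hY l)
  set Q := (P.map fun ω => (ζ ω, Y 0 ω)).prod uniformNoise with hQ
  let K : ∀ l : ℕ, Kernel (X × E) E := fun l =>
    condDistrib (Y (l + 1)) (fun ω => (ζ ω, Y l ω)) P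
  have hK : ∀ l, IsMarkovKernel (K l) := fun l => by
    simp only [K]; infer_instance
  -- Every kernel into a standard Borel space is the image of a uniform variable under a jointly
  -- measurable map; this turns the conditional laws into a noise-driven recursion.
  choose G hG hGK using fun l => Kernel.exists_measurable_map_eq_unitInterval (K l)
  let H : ℕ → X × E → unitInterval → X × E := fun l a u => (a.1, G l a u)
  have hH : ∀ l, Measurable (Function.uncurry (H l)) := fun l =>
    (measurable_fst.comp measurable_fst).prodMk (hG l)
  set st : ℕ → (X × E) × (ℕ → unitInterval) → X × E := fun l p => streamState H p.1 p.2 l with hst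
  have hstm : ∀ l, Measurable (st l) := fun l => measurable_streamState H hH l
  have hst1 : ∀ l p, (st l p).1 = p.1.1 := by
    intro l p
    induction l with
    | zero => rfl
    | succ l ih => exact ih
  have hstE : ∀ l p, st l p = (p.1.1, (st l p).2) := fun l p => Prod.ext (hst1 l p) rfl
  -- joint law of two consecutive states
  have hpair : ∀ l, Q.map (st l) = P.map (fun ω => (ζ ω, Y l ω)) →
      Q.map (fun p => (st l p, (st (l + 1) p).2)) =
        P.map (fun ω => ((ζ ω, Y l ω), Y (l + 1) ω)) := by
    intro l hl
    have h1 := map_streamState_noise H hH (P.map fun ω => (ζ ω, Y 0 ω)) l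
    rw [← hQ] at h1
    change Q.map (fun p => (st l p, p.2 l)) = (Q.map (st l)).prod volume at h1
    have h2 := map_prod_volume_eq_compProd (Q.map (st l)) (K l) (G l) (hG l) (hGK l)
    have hGm : Measurable (fun q : (X × E) × unitInterval => (q.1, G l q.1 q.2)) :=
      measurable_fst.prodMk (hG l)
    have hsn : Measurable (fun p : (X × E) × (ℕ → unitInterval) => (st l p, p.2 l)) :=
      (hstm l).prodMk ((measurable_pi_apply l).comp measurable_snd)
    rw [← h1, Measure.map_map hGm hsn, hl] at h2
    refine h2.trans ?_
    exact compProd_map_condDistrib (hY (l + 1)).aemeasurable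
  -- The chain forgets the past of `Y`, so only laws of consecutive pairs are reproduced; the
  -- marginals propagate by discarding the earlier location.
  have hlaw : ∀ l, Q.map (st l) = P.map (fun ω => (ζ ω, Y l ω)) := by
    intro l
    induction l with
    | zero =>
      change Q.map Prod.fst = _
      rw [hQ, ← Measure.fst, Measure.fst_prod]
    | succ l ih =>
      have h := congrArg (fun ν => Measure.map (fun q : (X × E) × E => (q.1.1, q.2)) ν) (hpair l ih)
      have hm : Measurable (fun q : (X × E) × E => (q.1.1, q.2)) := by fun_prop
      have hm1 : Measurable (fun p => (st l p, (st (l + 1) p).2)) :=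
        (hstm l).prodMk (measurable_snd.comp (hstm (l + 1)))
      have hm2 : Measurable (fun ω => ((ζ ω, Y l ω), Y (l + 1) ω)) := (hζY l).prodMk (hY _)
      change Measure.map _ (Measure.map _ _) = Measure.map _ (Measure.map _ _) at h
      rw [Measure.map_map hm hm1, Measure.map_map hm hm2] at h
      exact h
  refine ⟨fun l p => (st l p).2, fun l => measurable_snd.comp (hstm l), fun p => rfl, ?_, ?_⟩
  · intro l
    have : (fun p => (p.1.1, (st l p).2)) = st l := by
      funext p; exact (hstE l p).symm
    rw [this, hlaw]
  intro β g j R hβ hR hg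
  set T : E → E := normTrunc (2 * R) with hT
  have hTm : Measurable T := measurable_normTrunc _
  have hTB : ∀ v, ‖T v‖ ≤ 2 * R := norm_normTrunc_le (by positivity)
  let D : ℕ → Ω → E := fun l ω => Y (l + 1) ω - Y l ω
  have hDm : ∀ l, Measurable (D l) := fun l => (hY _).sub (hY l)
  let τ : ℕ → X × E → E := fun l a => ∫ z, T (z - a.2) ∂(K l a)
  have hτm : ∀ l, Measurable (τ l) := by
    intro l
    have : StronglyMeasurable (fun q : (X × E) × E => T (q.2 - q.1.2)) :=
      (hTm.comp (by fun_prop)).stronglyMeasurable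
    exact (StronglyMeasurable.integral_kernel_prod_right' (κ := K l) this).measurable
  have hτB : ∀ l a, ‖τ l a‖ ≤ 2 * R := by
    intro l a
    refine (norm_integral_le_of_norm_le_const (ae_of_all _ fun z => hTB _)).trans ?_
    simp
  -- The truncated increment minus its conditional mean `τ`. Truncation at `2 * R` bounds it by `4 *
  -- R`, without any second moment of `Y`.
  let m : ℕ → X × E → unitInterval → E := fun l a u => T (G l a u - a.2) - τ l a
  have hmm : ∀ l, Measurable (Function.uncurry (m l)) := fun l =>
    (hTm.comp ((hG l).sub (by fun_prop))).sub ((hτm l).comp measurable_fst)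
  have hmB : ∀ l a u, ‖m l a u‖ ≤ 4 * R := by
    intro l a u
    refine (norm_sub_le _ _).trans ?_
    linarith [hTB (G l a u - a.2), hτB l a]
  have hmean : ∀ l a, ∫ u, m l a u = 0 := by
    intro l a
    have hGa : Measurable (G l a) := (hG l).comp (measurable_const.prodMk measurable_id)
    have hTa : Measurable fun z => T (z - a.2) := hTm.comp (by fun_prop)
    have hint : Integrable (fun u => T (G l a u - a.2)) :=
      Integrable.of_bound (hTa.comp hGa).aestronglyMeasurable (2 * R) (ae_of_all _ fun u => hTB _)
    simp only [m]
    rw [integral_sub hint (integrable_const _)]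
    have : τ l a = ∫ u, T (G l a u - a.2) := by
      simp only [τ]
      rw [← hGK l a, integral_map hGa.aemeasurable hTa.aestronglyMeasurable]
    rw [this]; simp
  have hmart := integral_norm_sq_sum_streamState_le H hH (P.map fun ω => (ζ ω, Y 0 ω)) m hmm
    (4 * R) hmB hmean j
  rw [← hQ] at hmart
  set W : (X × E) × (ℕ → unitInterval) → E := fun p =>
    ∑ l ∈ Finset.range j, m l (st l p) (p.2 l) with hW
  change ∫ p, ‖W p‖ ^ 2 ∂Q ≤ _ at hmart
  have hWm : Measurable W := Finset.measurable_sum _ fun l _ =>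
    (hmm l).comp ((hstm l).prodMk ((measurable_pi_apply l).comp measurable_snd))
  have hPu : (P.map fun ω => (ζ ω, Y 0 ω)).real univ = P.real univ := by
    simp [Measure.real, Measure.map_apply (hζY 0) MeasurableSet.univ]
  have hQu : Q univ = P univ := by
    rw [hQ, ← univ_prod_univ, Measure.prod_prod, measure_univ (μ := uniformNoise), mul_one,
      Measure.map_apply (hζY 0) MeasurableSet.univ, preimage_univ]
  rw [hPu] at hmart
  have hWbd : ∀ p, ‖W p‖ ≤ j * (4 * R) := fun p => by
    refine (norm_sum_le _ _).trans ((Finset.sum_le_sum fun l _ => hmB _ _ _).trans ?_)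
    simp
  -- Cauchy–Schwarz on a space of mass `P univ`: the root of the second moment carries one factor
  -- `√(P univ)`, the passage to `L¹` the other.
  have hWL1 : ∫⁻ p, ‖W p‖ₑ ∂Q ≤ ENNReal.ofReal (√j * (4 * R) * P.real univ) := by
    have h2 : eLpNorm W 1 Q ≤ eLpNorm W 2 Q * Q univ ^ (1 / (1 : ℝ≥0∞).toReal - 1 / (2 : ℝ≥0∞).toReal) :=
      eLpNorm_le_eLpNorm_mul_rpow_measure_univ (by norm_num) hWm.aestronglyMeasurable
    rw [eLpNorm_one_eq_lintegral_enorm] at h2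
    refine h2.trans ?_
    have hmem : MemLp W 2 Q := MemLp.of_bound hWm.aestronglyMeasurable _ (ae_of_all _ hWbd)
    have h3 : eLpNorm W 2 Q ≤ ENNReal.ofReal (√(j * ((4 * R) ^ 2 * P.real univ))) := by
      rw [hmem.eLpNorm_eq_integral_rpow_norm (by norm_num) (by norm_num)]
      apply ENNReal.ofReal_le_ofReal
      rw [Real.sqrt_eq_rpow]
      simp only [ENNReal.toReal_ofNat, Real.rpow_two]
      rw [show (2 : ℝ)⁻¹ = 1 / 2 by norm_num]
      refine Real.rpow_le_rpow (by positivity) hmart (by norm_num)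
    have h4 : Q univ ^ (1 / (1 : ℝ≥0∞).toReal - 1 / (2 : ℝ≥0∞).toReal) =
        ENNReal.ofReal (√(P.real univ)) := by
      rw [hQu, ← ofReal_measureReal (measure_ne_top P univ),
        ENNReal.ofReal_rpow_of_nonneg measureReal_nonneg (by norm_num), Real.sqrt_eq_rpow]
      norm_num
    rw [h4]
    refine (mul_le_mul_left h3 _).trans ?_
    rw [← ENNReal.ofReal_mul (by positivity)]
    apply ENNReal.ofReal_le_ofReal
    rw [Real.sqrt_mul (by positivity), Real.sqrt_mul (by positivity), Real.sqrt_sq (by positivity)]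
    have := Real.mul_self_sqrt (measureReal_nonneg (μ := P) (s := univ))
    calc _ = √j * (4 * R) * (√(P.real univ) * √(P.real univ)) := by ring
      _ ≤ _ := by rw [this]
  -- decomposition of the residual
  let e₁ : ℕ → (X × E) × (ℕ → unitInterval) → E := fun l p =>
    ((st (l + 1) p).2 - (st l p).2) - T ((st (l + 1) p).2 - (st l p).2)
  let e₂ : ℕ → (X × E) × (ℕ → unitInterval) → E := fun l p => τ l (st l p) - β l (st l p)
  have he₁m : ∀ l, Measurable (e₁ l) := fun l => by
    have h1 : Measurable fun p => (st (l + 1) p).2 - (st l p).2 :=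
      (measurable_snd.comp (hstm (l + 1))).sub (measurable_snd.comp (hstm l))
    exact h1.sub (hTm.comp h1)
  have he₂m : ∀ l, Measurable (e₂ l) := fun l =>
    ((hτm l).comp (hstm l)).sub ((hβ l).comp (hstm l))
  have hdecomp : ∀ p, (st j p).2 - p.1.2 - ∑ l ∈ Finset.range j, β l (p.1.1, (st l p).2) =
      W p + ∑ l ∈ Finset.range j, (e₁ l p + e₂ l p) := by
    intro p
    have h0 : (st j p).2 - p.1.2 = ∑ l ∈ Finset.range j, ((st (l + 1) p).2 - (st l p).2) := by
      rw [Finset.sum_range_sub (fun l => (st l p).2)]; rfl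
    rw [h0, hW, ← Finset.sum_sub_distrib]
    simp only
    rw [← Finset.sum_add_distrib]
    refine Finset.sum_congr rfl fun l _ => ?_
    rw [← hstE l p]
    have h1 : m l (st l p) (p.2 l) =
      T ((st (l + 1) p).2 - (st l p).2) - τ l (st l p) := rfl
    rw [h1]
    simp only [e₁, e₂]
    abel
  have hE₁ : ∀ l, ∫⁻ p, ‖e₁ l p‖ₑ ∂Q = ∫⁻ ω, ‖D l ω - T (D l ω)‖ₑ ∂P := by
    intro l
    have hF : Measurable (fun q : (X × E) × E => ‖(q.2 - q.1.2) - T (q.2 - q.1.2)‖ₑ) := by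
      have h1 : Measurable fun q : (X × E) × E => q.2 - q.1.2 := by fun_prop
      exact (h1.sub (hTm.comp h1)).enorm
    have h := congrArg (fun ν => ∫⁻ q, ‖(q.2 - q.1.2) - T (q.2 - q.1.2)‖ₑ ∂ν) (hpair l (hlaw l))
    change lintegral (Measure.map _ _) _ = lintegral (Measure.map _ _) _ at h
    have hm1 : Measurable (fun p => (st l p, (st (l + 1) p).2)) :=
      (hstm l).prodMk (measurable_snd.comp (hstm (l + 1)))
    rw [lintegral_map hF hm1, lintegral_map hF ((hζY l).prodMk (hY _))] at h
    exact h
  have htail : ∀ l, ∫⁻ ω, ‖D l ω - T (D l ω)‖ₑ ∂P ≤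
      2 * ∫⁻ ω, (‖D l ω‖ₑ - ENNReal.ofReal R) ∂P := by
    intro l
    rw [← lintegral_const_mul' _ _ (by simp)]
    exact lintegral_mono fun ω => enorm_sub_normTrunc_le hR _
  -- Transported to `Ω`, `τ l` and `β l` are the conditional means of `T (D l)` and `g l` given the
  -- same variables, and conditional expectation is an `L¹` contraction.
  have hE₂ : ∀ l < j, ∫⁻ p, ‖e₂ l p‖ₑ ∂Q ≤ (∫⁻ ω, ‖D l ω - T (D l ω)‖ₑ ∂P) +
      ∫⁻ ω, ‖D l ω - g l ω‖ₑ ∂P := by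
    intro l hl
    have hF : Measurable (fun a => ‖τ l a - β l a‖ₑ) := ((hτm l).sub (hβ l)).enorm
    have h := congrArg (fun ν => ∫⁻ a, ‖τ l a - β l a‖ₑ ∂ν) (hlaw l)
    change lintegral (Measure.map _ _) _ = lintegral (Measure.map _ _) _ at h
    rw [lintegral_map hF (hstm l), lintegral_map hF (hζY l)] at h
    have hTint : Integrable (fun ω => T (D l ω)) P :=
      Integrable.of_bound (hTm.comp (hDm l)).aestronglyMeasurable (2 * R) (ae_of_all _ fun ω => hTB _)
    have hcond := condExp_prod_ae_eq_integral_condDistrib (μ := P) (hζY l) (hY (l + 1)).aemeasurable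
      (f := fun q : (X × E) × E => T (q.2 - q.1.2))
      (hTm.comp (by fun_prop)).stronglyMeasurable hTint
    calc ∫⁻ p, ‖e₂ l p‖ₑ ∂Q = ∫⁻ ω, ‖τ l (ζ ω, Y l ω) - β l (ζ ω, Y l ω)‖ₑ ∂P := h
      _ = ∫⁻ ω, ‖P[fun ω => T (D l ω) |
              MeasurableSpace.comap (fun ω => (ζ ω, Y l ω)) inferInstance] ω -
            P[g l | MeasurableSpace.comap (fun ω => (ζ ω, Y l ω)) inferInstance] ω‖ₑ ∂P := by
          refine lintegral_congr_ae ?_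
          filter_upwards [hcond, (hg l hl).2] with ω h1 h2
          rw [h2]
          exact congrArg (fun v => ‖v - _‖ₑ) h1.symm
      _ ≤ ∫⁻ ω, ‖T (D l ω) - g l ω‖ₑ ∂P :=
          lintegral_enorm_condExp_sub_condExp_le hTint (hg l hl).1
      _ ≤ ∫⁻ ω, (‖D l ω - T (D l ω)‖ₑ + ‖D l ω - g l ω‖ₑ) ∂P := by
          refine lintegral_mono fun ω => ?_
          have : T (D l ω) - g l ω = (D l ω - g l ω) - (D l ω - T (D l ω)) := by abel
          rw [this, add_comm]
          exact enorm_sub_le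
      _ = _ := lintegral_add_left ((hDm l).sub (hTm.comp (hDm l))).enorm _
  simp_rw [hdecomp]
  calc ∫⁻ p, ‖W p + ∑ l ∈ Finset.range j, (e₁ l p + e₂ l p)‖ₑ ∂Q
      ≤ ∫⁻ p, (‖W p‖ₑ + ∑ l ∈ Finset.range j, (‖e₁ l p‖ₑ + ‖e₂ l p‖ₑ)) ∂Q := by
        refine lintegral_mono fun p => (enorm_add_le _ _).trans ?_
        gcongr
        refine (enorm_sum_le _ _).trans (Finset.sum_le_sum fun l _ => enorm_add_le _ _)
    _ = (∫⁻ p, ‖W p‖ₑ ∂Q) + ∑ l ∈ Finset.range j, ((∫⁻ p, ‖e₁ l p‖ₑ ∂Q) + ∫⁻ p, ‖e₂ l p‖ₑ ∂Q) := by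
        rw [lintegral_add_left hWm.enorm, lintegral_finsetSum _ fun l _ => by
          exact (he₁m l).enorm.add (he₂m l).enorm]
        congr 1
        refine Finset.sum_congr rfl fun l _ => ?_
        rw [lintegral_add_left (he₁m l).enorm]
    _ ≤ _ := by
        refine add_le_add hWL1 (Finset.sum_le_sum fun l hl => ?_)
        rw [hE₁]
        -- Truncation is paid for twice, in `e₁` and in `e₂`, each time with the factor `2` of
        -- `enorm_sub_normTrunc_le`; hence the constant `4`.
        calc _ ≤ (∫⁻ ω, ‖D l ω - T (D l ω)‖ₑ ∂P) + ((∫⁻ ω, ‖D l ω - T (D l ω)‖ₑ ∂P) +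
              ∫⁻ ω, ‖D l ω - g l ω‖ₑ ∂P) := by
              gcongr
              exact hE₂ l (Finset.mem_range.1 hl)
          _ ≤ (2 * ∫⁻ ω, (‖D l ω‖ₑ - ENNReal.ofReal R) ∂P) +
              ((2 * ∫⁻ ω, (‖D l ω‖ₑ - ENNReal.ofReal R) ∂P) + ∫⁻ ω, ‖D l ω - g l ω‖ₑ ∂P) := by
              gcongr <;> exact htail l
          _ = 4 * (∫⁻ ω, (‖D l ω‖ₑ - ENNReal.ofReal R) ∂P) + ∫⁻ ω, ‖D l ω - g l ω‖ₑ ∂P := by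
              rw [← add_assoc, ← two_mul, ← mul_assoc]
              norm_num

end Chain

/-! ### Processes that follow a field on average, and time grids -/

section Driven

variable {X Ω E : Type*} [MeasurableSpace X] [MeasurableSpace Ω]
  [NormedAddCommGroup E] [InnerProductSpace ℝ E] [FiniteDimensional ℝ E]
  [MeasurableSpace E] [BorelSpace E]

/-- The path which starts at `Z₀` and has velocity `V`. -/
noncomputable def drivenPath {Ω E : Type*} [NormedAddCommGroup E] [NormedSpace ℝ E]
    (Z₀ : Ω → E) (V : ℝ → Ω → E) (t : ℝ) (ω : Ω) : E :=
  Z₀ ω + ∫ r in Iic t, V r ω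

/-- The process started at `Z₀` with velocity `V`, together with a random parameter `ζ`, follows
the field `b` on average: given the parameter and the location, the mean velocity is `b`. -/
structure IsDriven (P : Measure Ω) (ζ : Ω → X) (Z₀ : Ω → E) (V : ℝ → Ω → E)
    (b : X → ℝ → E → E) : Prop where
  measurable_param : Measurable ζ
  measurable_start : Measurable Z₀
  stronglyMeasurable : StronglyMeasurable (Function.uncurry V)
  integrable : Integrable (Function.uncurry V) (volume.prod P)
  eq_zero : ∀ s < 0, ∀ ω, V s ω = 0
  drift : ∀ᵐ s, (fun ω => b (ζ ω) s (drivenPath Z₀ V s ω)) =ᵐ[P]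
    P[V s | MeasurableSpace.comap (fun ω => (ζ ω, drivenPath Z₀ V s ω)) inferInstance]

lemma measurable_drivenPath {Z₀ : Ω → E} {V : ℝ → Ω → E} (hZ₀ : Measurable Z₀)
    (hV : StronglyMeasurable (Function.uncurry V)) :
    Measurable (Function.uncurry (drivenPath Z₀ V)) := by
  have h1 : StronglyMeasurable (fun q : (ℝ × Ω) × ℝ =>
      {q : (ℝ × Ω) × ℝ | q.2 ≤ q.1.1}.indicator (fun q => V q.2 q.1.2) q) := by
    refine StronglyMeasurable.indicator ?_ (measurableSet_le (by fun_prop) (by fun_prop))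
    exact hV.comp_measurable (g := fun q : (ℝ × Ω) × ℝ => (q.2, q.1.2)) (by fun_prop)
  have h2 : Function.uncurry (drivenPath Z₀ V) = fun p : ℝ × Ω => Z₀ p.2 +
      ∫ r, {q : (ℝ × Ω) × ℝ | q.2 ≤ q.1.1}.indicator (fun q => V q.2 q.1.2) (p, r) := by
    funext p
    simp only [Function.uncurry, drivenPath]
    rw [← integral_indicator measurableSet_Iic]
    rfl
  rw [h2]
  exact (hZ₀.comp measurable_snd).add (h1.integral_prod_right (ν := volume)).measurable

lemma drivenPath_sub {Z₀ : Ω → E} {V : ℝ → Ω → E} {ω : Ω} (h : Integrable fun s => V s ω)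
    (s t : ℝ) : drivenPath Z₀ V t ω - drivenPath Z₀ V s ω = ∫ r in s..t, V r ω := by
  unfold drivenPath
  rw [add_sub_add_left_eq_sub, intervalIntegral.integral_Iic_sub_Iic h.integrableOn h.integrableOn]

/-- Allows the grid to begin at a slightly negative time while the chain still starts at `Z₀`. -/
lemma drivenPath_of_nonpos {Z₀ : Ω → E} {V : ℝ → Ω → E} (h0 : ∀ s < 0, ∀ ω, V s ω = 0) {s : ℝ}
    (hs : s ≤ 0) : drivenPath Z₀ V s = Z₀ := by
  funext ω
  unfold drivenPath
  rw [add_eq_left]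
  rw [setIntegral_congr_set Iio_ae_eq_Iic.symm]
  exact setIntegral_eq_zero_of_forall_eq_zero fun r hr => h0 r (lt_of_lt_of_le hr hs) ω

lemma continuous_drivenPath {Z₀ : Ω → E} {V : ℝ → Ω → E} {ω : Ω}
    (h : Integrable fun s => V s ω) : Continuous fun t => drivenPath Z₀ V t ω := by
  have h1 : (fun t => drivenPath Z₀ V t ω) =
      fun t => drivenPath Z₀ V 0 ω + ∫ r in (0 : ℝ)..t, V r ω := by
    funext t
    rw [← drivenPath_sub h]; abel
  rw [h1]
  exact continuous_const.add (intervalIntegral.continuous_primitive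
    (fun a b => h.intervalIntegrable) 0)

/-- The index of the cell of the grid `s₀ + ℤ / n` which contains `t`. -/
noncomputable def cellIndex (s₀ : ℝ) (n : ℕ) (t : ℝ) : ℕ := ⌊(t - s₀) * n⌋₊

lemma measurable_cellIndex (s₀ : ℝ) (n : ℕ) : Measurable (cellIndex s₀ n) :=
  Nat.measurable_floor.comp (by fun_prop)

lemma cellIndex_eq {s₀ : ℝ} {n : ℕ} (hn : 0 < n) {l : ℕ} {t : ℝ}
    (ht : t ∈ Ico (s₀ + l / n) (s₀ + (l + 1) / n)) : cellIndex s₀ n t = l := by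
  have hn' : (0 : ℝ) < n := by exact_mod_cast hn
  unfold cellIndex
  rw [Nat.floor_eq_iff]
  · constructor
    · have := ht.1
      rw [← sub_nonneg] at this
      have h2 : 0 ≤ (t - (s₀ + l / n)) * n := mul_nonneg this hn'.le
      have h3 : (t - (s₀ + l / n)) * n = (t - s₀) * n - l := by field_simp; ring
      linarith
    · have := ht.2
      rw [← sub_pos] at this
      have h2 : 0 < (s₀ + (l + 1) / n - t) * n := mul_pos this hn'
      have h3 : (s₀ + (l + 1) / n - t) * n = l + 1 - (t - s₀) * n := by field_simp; ring
      linarith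
  · refine mul_nonneg ?_ hn'.le
    have := ht.1
    have : (0 : ℝ) ≤ l / n := by positivity
    linarith

lemma mem_cell {s₀ : ℝ} {n : ℕ} (hn : 0 < n) {t : ℝ} (ht : s₀ ≤ t) :
    t ∈ Ico (s₀ + cellIndex s₀ n t / n) (s₀ + (cellIndex s₀ n t + 1) / n) := by
  have hn' : (0 : ℝ) < n := by exact_mod_cast hn
  have h0 : 0 ≤ (t - s₀) * n := mul_nonneg (by linarith) hn'.le
  have h1 := Nat.floor_le h0
  have h2 := Nat.lt_floor_add_one ((t - s₀) * n)
  change (cellIndex s₀ n t : ℝ) ≤ _ at h1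
  change _ < (cellIndex s₀ n t : ℝ) + 1 at h2
  constructor
  · have := div_le_of_le_mul₀ hn'.le (by linarith) h1
    linarith
  · have := (lt_div_iff₀ hn').2 h2
    linarith

/-- Complete cells contribute a Riemann sum; the cell containing `t` contributes only the elapsed
fraction, which is estimated separately later. -/
lemma integral_cellIndex {F : ℕ → E} {s₀ : ℝ} {n : ℕ} (hn : 0 < n) {t : ℝ} (ht : s₀ ≤ t) :
    IntervalIntegrable (fun r => F (cellIndex s₀ n r)) volume s₀ t ∧
    ∫ r in s₀..t, F (cellIndex s₀ n r) =
      (∑ l ∈ Finset.range (cellIndex s₀ n t), (1 / n : ℝ) • F l) +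
        (t - (s₀ + cellIndex s₀ n t / n)) • F (cellIndex s₀ n t) := by
  have hcell : ∀ (l : ℕ) (u : ℝ), u ∈ Icc (s₀ + l / n) (s₀ + (l + 1) / n) →
      IntervalIntegrable (fun r => F (cellIndex s₀ n r)) volume (s₀ + l / n) u ∧
      ∫ r in (s₀ + l / n)..u, F (cellIndex s₀ n r) = (u - (s₀ + l / n)) • F l := by
    intro l u hu
    have hae : ∀ᵐ r, r ∈ uIoc (s₀ + l / n) u → F l = F (cellIndex s₀ n r) := by
      -- If `u` is the right end of the cell, the point `u` already belongs to the next one.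
      have : ∀ᵐ r : ℝ, r ≠ u := by simp [ae_iff]
      filter_upwards [this] with r hr hr2
      rw [uIoc_of_le hu.1] at hr2
      rw [cellIndex_eq hn ⟨hr2.1.le, lt_of_lt_of_le (lt_of_le_of_ne hr2.2 hr) hu.2⟩]
    constructor
    · refine (intervalIntegrable_const (c := F l)).congr_ae ?_
      rw [EventuallyEq, ae_restrict_iff' measurableSet_uIoc]
      exact hae
    · rw [← intervalIntegral.integral_congr_ae hae]
      simp
  have hstep : ∀ j : ℕ, IntervalIntegrable (fun r => F (cellIndex s₀ n r)) volume s₀ (s₀ + j / n) ∧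
      ∫ r in s₀..(s₀ + j / n), F (cellIndex s₀ n r) = ∑ l ∈ Finset.range j, (1 / n : ℝ) • F l := by
    intro j
    induction j with
    | zero => simp
    | succ j ih =>
      have hle : s₀ + (j : ℝ) / n ≤ s₀ + (j + 1) / n := by gcongr; linarith
      obtain ⟨h1, h2⟩ := hcell j (s₀ + (j + 1) / n) ⟨hle, le_rfl⟩
      push_cast
      refine ⟨ih.1.trans h1, ?_⟩
      rw [← intervalIntegral.integral_add_adjacent_intervals ih.1 h1, ih.2, h2,
        Finset.sum_range_succ]
      congr 2
      ring
  have hm := mem_cell hn ht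
  obtain ⟨h1, h2⟩ := hcell (cellIndex s₀ n t) t ⟨hm.1, hm.2.le⟩
  obtain ⟨h3, h4⟩ := hstep (cellIndex s₀ n t)
  refine ⟨h3.trans h1, ?_⟩
  rw [← intervalIntegral.integral_add_adjacent_intervals h3 h1, h4, h2]

lemma lintegral_cellIndex (F : ℕ → ℝ≥0∞) (s₀ : ℝ) {n : ℕ} (hn : 0 < n) (j : ℕ) :
    ∫⁻ t in Ico s₀ (s₀ + j / n), F (cellIndex s₀ n t) =
      ∑ l ∈ Finset.range j, ENNReal.ofReal (1 / n) * F l := by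
  induction j with
  | zero => simp
  | succ j ih =>
    have hle : s₀ + (j : ℝ) / n ≤ s₀ + (j + 1 : ℕ) / n := by push_cast; gcongr; linarith
    have h0 : s₀ ≤ s₀ + (j : ℝ) / n := by
      have : (0 : ℝ) ≤ j / n := by positivity
      linarith
    rw [← Ico_union_Ico_eq_Ico h0 hle, lintegral_union measurableSet_Ico
      (Ico_disjoint_Ico_same), ih, Finset.sum_range_succ]
    congr 1
    rw [setLIntegral_congr_fun (g := fun _ => F j) measurableSet_Ico]
    · rw [setLIntegral_const, Real.volume_Ico, mul_comm]
      congr 2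
      push_cast; ring
    · intro t ht
      push_cast at ht
      simp only [cellIndex_eq hn ht]

lemma sum_setLIntegral_grid (f : ℝ → ℝ≥0∞) (s₀ : ℝ) (n j : ℕ) :
    ∑ l ∈ Finset.range j, ∫⁻ t in Ioc (s₀ + l / n) (s₀ + (l + 1) / n), f t =
      ∫⁻ t in Ioc s₀ (s₀ + j / n), f t := by
  induction j with
  | zero => simp
  | succ j ih =>
    have hle : s₀ + (j : ℝ) / n ≤ s₀ + (j + 1 : ℕ) / n := by push_cast; gcongr; linarith
    have h0 : s₀ ≤ s₀ + (j : ℝ) / n := by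
      have : (0 : ℝ) ≤ j / n := by positivity
      linarith
    rw [← Ioc_union_Ioc_eq_Ioc h0 hle, lintegral_union measurableSet_Ioc
      (Ioc_disjoint_Ioc_of_le le_rfl), ih.symm, Finset.sum_range_succ]
    push_cast
    rfl

lemma setLIntegral_Ioc_translate (f : ℝ → ℝ≥0∞) (a b c : ℝ) :
    ∫⁻ s in Ioc a b, f (s + c) = ∫⁻ s in Ioc (a + c) (b + c), f s := by
  rw [← lintegral_indicator measurableSet_Ioc, ← lintegral_indicator measurableSet_Ioc,
    ← lintegral_add_right_eq_self ((Ioc (a + c) (b + c)).indicator f) c]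
  refine lintegral_congr fun s => ?_
  by_cases hs : s ∈ Ioc a b
  · rw [indicator_of_mem hs, indicator_of_mem]
    exact ⟨by linarith [hs.1], by linarith [hs.2]⟩
  · rw [indicator_of_notMem hs, indicator_of_notMem]
    intro h
    exact hs ⟨by linarith [h.1], by linarith [h.2]⟩

end Driven

/-! ### Choice of the grid and errors of a single step -/

section Approx

variable {X Ω E : Type*} [MeasurableSpace X] [MeasurableSpace Ω]
  [NormedAddCommGroup E] [InnerProductSpace ℝ E] [FiniteDimensional ℝ E]
  [MeasurableSpace E] [BorelSpace E]

/-- The expectations of the large velocities are negligible. -/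
lemma tendsto_lintegral_tail {P : Measure Ω} [IsFiniteMeasure P] {V : ℝ → Ω → E}
    (hVm : StronglyMeasurable (Function.uncurry V))
    (hV : Integrable (Function.uncurry V) (volume.prod P)) :
    Tendsto (fun M : ℕ => ∫⁻ s, ∫⁻ ω, (‖V s ω‖ₑ - (M : ℝ≥0∞)) ∂P) atTop (𝓝 0) := by
  have h1 : ∀ M : ℕ, ∫⁻ s, ∫⁻ ω, (‖V s ω‖ₑ - (M : ℝ≥0∞)) ∂P =
      ∫⁻ p, (‖Function.uncurry V p‖ₑ - (M : ℝ≥0∞)) ∂(volume.prod P) := by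
    intro M
    rw [lintegral_prod _ (hVm.enorm.sub_const _).aemeasurable]
    rfl
  simp_rw [h1]
  have hz : (0 : ℝ≥0∞) = ∫⁻ _, 0 ∂((volume : Measure ℝ).prod P) := by simp
  rw [hz]
  refine tendsto_lintegral_of_dominated_convergence (fun p => ‖Function.uncurry V p‖ₑ)
    (fun M => hVm.enorm.sub_const _) (fun M => ae_of_all _ fun p => tsub_le_self) hV.2.ne ?_
  refine ae_of_all _ fun p => ?_
  obtain ⟨N, hN⟩ := ENNReal.exists_nat_gt (r := ‖Function.uncurry V p‖ₑ) enorm_ne_top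
  refine tendsto_const_nhds.congr' ?_
  filter_upwards [eventually_ge_atTop N] with M hM
  exact (tsub_eq_zero_of_le (hN.le.trans (by exact_mod_cast hM))).symm

/-- Among the translates of a grid of mesh `1 / n` there is one along which two nonnegative
functions have sums not much larger than their integrals. -/
lemma exists_grid_sum_le {n : ℕ} (hn : 0 < n) (φ A : ℝ → ℝ≥0∞) (hφ : Measurable φ)
    (hA : Measurable A) (C δ : ℝ≥0∞) (hδ0 : δ ≠ 0) (hδ : δ ≠ ∞)
    (hφC : ∫⁻ s in Ioc (-1 : ℝ) 1, φ s ≤ C) (hAδ : ∫⁻ s, A s ≤ δ * ENNReal.ofReal (1 / n))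
    (p : ℝ → Prop) (hp : ∀ᵐ s, p s) :
    ∃ s₀ ∈ Ioc (-(1 / n : ℝ)) 0, (∀ l : ℕ, p (s₀ + l / n)) ∧
      ∑ l ∈ Finset.range (n + 1), ENNReal.ofReal (1 / n) * φ (s₀ + l / n) ≤ C + 1 ∧
      ∑ l ∈ Finset.range (n + 1), A (s₀ + l / n) ≤ δ * (C + 1) := by
  have hn' : (0 : ℝ) < n := by exact_mod_cast hn
  set h : ℝ≥0∞ := ENNReal.ofReal (1 / n) with hh
  have hh0 : h ≠ 0 := by simp [hh, hn']
  have hht : h ≠ ∞ := ofReal_ne_top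
  set I : Set ℝ := Ioc (-(1 / n : ℝ)) 0 with hI
  have hvolI : volume I = h := by rw [hI, Real.volume_Ioc]; simp [hh]
  -- The `n + 1` translates of `I` by multiples of the mesh tile `(-1 / n, 1]`.
  have hsum : ∀ f : ℝ → ℝ≥0∞, Measurable f →
      ∫⁻ s in I, ∑ l ∈ Finset.range (n + 1), f (s + l / n) = ∫⁻ s in Ioc (-(1 / n : ℝ)) 1, f s := by
    intro f hf
    rw [lintegral_finsetSum _ fun l _ => (by fun_prop : Measurable fun s : ℝ => f (s + (l : ℕ) / n))]
    have h1 : ∀ l ∈ Finset.range (n + 1), ∫⁻ s in I, f (s + l / n) =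
        ∫⁻ s in Ioc (-(1 / n : ℝ) + l / n) (-(1 / n : ℝ) + (l + 1) / n), f s := by
      intro l _
      rw [hI, setLIntegral_Ioc_translate,
        show (0 : ℝ) + l / n = -(1 / n : ℝ) + (l + 1) / n by ring]
    rw [Finset.sum_congr rfl h1, sum_setLIntegral_grid]
    congr 3
    push_cast
    field_simp
    ring
  -- Adding both sums, the second weighted by `δ⁻¹`, lets one `s₀` serve both. The integral of `F`
  -- over `I` is at most `h * (C + 1)`, so its average there is at most `C + 1`.
  set F : ℝ → ℝ≥0∞ := fun s =>
    (∑ l ∈ Finset.range (n + 1), h * φ (s + l / n)) +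
      δ⁻¹ * ∑ l ∈ Finset.range (n + 1), A (s + l / n) with hF
  have hm : ∀ f : ℝ → ℝ≥0∞, Measurable f →
      Measurable fun s => ∑ l ∈ Finset.range (n + 1), f (s + l / n) := fun f hf =>
    Finset.measurable_sum _ fun l _ => hf.comp (by fun_prop)
  have hFm : Measurable F := by
    refine Measurable.add ?_ ((hm A hA).const_mul _)
    exact hm (fun s => h * φ s) (hφ.const_mul _)
  have hFint : ∫⁻ s in I, F s ≤ h * (C + 1) := by
    rw [hF, lintegral_add_right _ ((hm A hA).const_mul _), lintegral_const_mul _ (hm A hA)]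
    rw [hsum (fun s => h * φ s) (hφ.const_mul _), hsum A hA, lintegral_const_mul _ hφ, mul_add]
    have hsub : Ioc (-(1 / n : ℝ)) 1 ⊆ Ioc (-1 : ℝ) 1 := by
      refine Ioc_subset_Ioc_left ?_
      rw [neg_le_neg_iff, div_le_one hn']
      exact_mod_cast hn
    refine add_le_add ?_ ?_
    · gcongr
      exact (lintegral_mono_set hsub).trans hφC
    · calc δ⁻¹ * ∫⁻ s in Ioc (-(1 / n : ℝ)) 1, A s ≤ δ⁻¹ * (δ * h) := by
            gcongr
            exact (setLIntegral_le_lintegral _ _).trans hAδ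
        _ = h * 1 := by rw [← mul_assoc, ENNReal.inv_mul_cancel hδ0 hδ, one_mul, mul_one]
  have hpall : ∀ᵐ s, ∀ l : ℕ, p (s + l / n) := by
    rw [ae_all_iff]
    intro l
    exact (measurePreserving_add_right volume ((l : ℝ) / n)).quasiMeasurePreserving.ae hp
  have hmu : volume.restrict I ≠ 0 := by
    rw [Ne, Measure.restrict_eq_zero, hvolI]; exact hh0
  -- The complement of `I` is added to the exceptional set so that the point found lies in `I`.
  have hnull : (volume.restrict I) ({s | ¬ ∀ l : ℕ, p (s + l / n)} ∪ Iᶜ) = 0 := by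
    rw [measure_union_null_iff]
    refine ⟨ae_iff.1 (ae_restrict_of_ae hpall), ?_⟩
    have := ae_restrict_mem (μ := volume) (s := I) measurableSet_Ioc
    exact this
  obtain ⟨s₀, hs₀, hle⟩ := exists_notMem_null_le_laverage hmu hFm.aemeasurable hnull
  have hle' : F s₀ ≤ C + 1 := by
    refine hle.trans ?_
    rw [setLAverage_eq, hvolI]
    refine ENNReal.div_le_of_le_mul ?_
    rw [mul_comm]
    exact hFint
  simp only [mem_union, not_or, mem_compl_iff, not_not, mem_ofPred_eq] at hs₀
  refine ⟨s₀, hs₀.2, hs₀.1, le_self_add.trans hle', ?_⟩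
  have h2 : δ⁻¹ * ∑ l ∈ Finset.range (n + 1), A (s₀ + l / n) ≤ C + 1 := le_add_self.trans hle'
  calc _ = δ * (δ⁻¹ * ∑ l ∈ Finset.range (n + 1), A (s₀ + l / n)) := by
        rw [← mul_assoc, ENNReal.mul_inv_cancel hδ0 hδ, one_mul]
    _ ≤ _ := by gcongr

/-- The positive part passes inside the time integral: subtracting `h * M` from an integral over a
step of length `h` is the same as subtracting `M` from the integrand. -/
lemma lintegral_enorm_drivenPath_sub_tail_le {P : Measure Ω} [IsFiniteMeasure P] {Z₀ : Ω → E}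
    {V : ℝ → Ω → E} (hVm : StronglyMeasurable (Function.uncurry V))
    (hV : Integrable (Function.uncurry V) (volume.prod P)) (s : ℝ) {h : ℝ} (hh : 0 ≤ h)
    (M : ℝ≥0∞) :
    ∫⁻ ω, (‖drivenPath Z₀ V (s + h) ω - drivenPath Z₀ V s ω‖ₑ - ENNReal.ofReal h * M) ∂P ≤
      ∫⁻ t in Ioc s (s + h), ∫⁻ ω, (‖V t ω‖ₑ - M) ∂P := by
  have hm : Measurable (Function.uncurry fun t ω => ‖V t ω‖ₑ - M) := hVm.enorm.sub_const M
  rw [lintegral_lintegral_swap hm.aemeasurable]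
  refine lintegral_mono_ae ?_
  filter_upwards [hV.prod_left_ae] with ω hω
  rw [drivenPath_sub hω, tsub_le_iff_right,
    intervalIntegral.integral_of_le (by linarith : s ≤ s + h)]
  calc _ ≤ ∫⁻ t in Ioc s (s + h), ‖V t ω‖ₑ := enorm_integral_le_lintegral_enorm _
    _ ≤ ∫⁻ t in Ioc s (s + h), ((‖V t ω‖ₑ - M) + M) := lintegral_mono fun t => le_tsub_add
    _ = _ := by
      rw [lintegral_add_right _ measurable_const, setLIntegral_const, Real.volume_Ioc,
        add_sub_cancel_left, mul_comm M]

/-- The difference is the integral of `V r - V s` over the step, so freezing the velocity costs only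
a modulus of translation. -/
lemma lintegral_enorm_drivenPath_sub_sub_le {P : Measure Ω} [IsFiniteMeasure P] {Z₀ : Ω → E}
    {V : ℝ → Ω → E} (hVm : StronglyMeasurable (Function.uncurry V))
    (hV : Integrable (Function.uncurry V) (volume.prod P)) (s : ℝ) {h : ℝ} (hh : 0 ≤ h) :
    ∫⁻ ω, ‖drivenPath Z₀ V (s + h) ω - drivenPath Z₀ V s ω - h • V s ω‖ₑ ∂P ≤
      ∫⁻ r in Ioc 0 h, ∫⁻ ω, ‖V (s + r) ω - V s ω‖ₑ ∂P := by
  have hm : Measurable (Function.uncurry fun r ω => ‖V (s + r) ω - V s ω‖ₑ) := by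
    refine (StronglyMeasurable.sub (hVm.comp_measurable (g := fun p : ℝ × Ω => (s + p.1, p.2)) ?_)
      (hVm.comp_measurable (g := fun p : ℝ × Ω => (s, p.2)) ?_)).enorm <;> fun_prop
  rw [lintegral_lintegral_swap hm.aemeasurable]
  refine lintegral_mono_ae ?_
  filter_upwards [hV.prod_left_ae] with ω hω
  replace hω : Integrable fun t => V t ω := hω
  have e : drivenPath Z₀ V (s + h) ω - drivenPath Z₀ V s ω - h • V s ω =
      ∫ r in s..(s + h), (V r ω - V s ω) := by
    rw [drivenPath_sub hω, intervalIntegral.integral_sub hω.intervalIntegrable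
      intervalIntegrable_const, intervalIntegral.integral_const, add_sub_cancel_left]
  rw [e, intervalIntegral.integral_of_le (by linarith : s ≤ s + h)]
  refine (enorm_integral_le_lintegral_enorm _).trans (le_of_eq ?_)
  have := setLIntegral_Ioc_translate (fun r => ‖V r ω - V s ω‖ₑ) 0 h s
  rw [zero_add, add_comm h s] at this
  rw [← this]
  simp_rw [add_comm s]

/-- Nothing bounds the velocity at one fixed time, so it is compared with its average over the next
`h` units; that average is split into `M` and the excess. Needed for the incomplete last step. -/
lemma mul_lintegral_enorm_le {P : Measure Ω} [IsFiniteMeasure P] {V : ℝ → Ω → E}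
    (hVm : StronglyMeasurable (Function.uncurry V)) (s : ℝ) {h : ℝ} (M : ℝ≥0∞) :
    ENNReal.ofReal h * ∫⁻ ω, ‖V s ω‖ₑ ∂P ≤
      (∫⁻ r in Ioc 0 h, ∫⁻ ω, ‖V (s + r) ω - V s ω‖ₑ ∂P) +
      ((∫⁻ t in Ioc s (s + h), ∫⁻ ω, (‖V t ω‖ₑ - M) ∂P) + ENNReal.ofReal h * (M * P univ)) := by
  have hm : Measurable (fun p : ℝ × Ω => ‖V (s + p.1) p.2 - V s p.2‖ₑ) := by
    refine (StronglyMeasurable.sub (hVm.comp_measurable (g := fun p : ℝ × Ω => (s + p.1, p.2)) ?_)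
      (hVm.comp_measurable (g := fun p : ℝ × Ω => (s, p.2)) ?_)).enorm <;> fun_prop
  have hm2 : Measurable (fun p : ℝ × Ω => ‖V p.1 p.2‖ₑ - M) := hVm.enorm.sub_const M
  have hm3 : Measurable (fun p : ℝ × Ω => ‖V (s + p.1) p.2‖ₑ - M) :=
    hm2.comp (g := fun p : ℝ × Ω => ‖V p.1 p.2‖ₑ - M) (f := fun p : ℝ × Ω => (s + p.1, p.2))
      (by fun_prop)
  have h1 : ENNReal.ofReal h * ∫⁻ ω, ‖V s ω‖ₑ ∂P = ∫⁻ _r in Ioc 0 h, ∫⁻ ω, ‖V s ω‖ₑ ∂P := by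
    rw [setLIntegral_const, Real.volume_Ioc, sub_zero, mul_comm]
  have h2 := setLIntegral_Ioc_translate (fun t => ∫⁻ ω, (‖V t ω‖ₑ - M) ∂P) 0 h s
  rw [zero_add, add_comm h s] at h2
  rw [h1, ← h2]
  have h3 : ENNReal.ofReal h * (M * P univ) = ∫⁻ _r in Ioc 0 h, M * P univ := by
    rw [setLIntegral_const, Real.volume_Ioc, sub_zero, mul_comm]
  have hm4 : Measurable fun r => ∫⁻ ω, ‖V (s + r) ω - V s ω‖ₑ ∂P := hm.lintegral_prod_right'
  rw [h3, ← lintegral_add_right _ measurable_const, ← lintegral_add_left hm4]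
  refine lintegral_mono fun r => ?_
  simp only
  have h4 : M * P univ = ∫⁻ _ω, M ∂P := by rw [lintegral_const]
  have hm5 : Measurable fun ω => ‖V (s + r) ω - V s ω‖ₑ :=
    hm.comp (measurable_const.prodMk measurable_id)
  rw [h4, add_comm r s, ← lintegral_add_right _ measurable_const, ← lintegral_add_left hm5]
  refine lintegral_mono fun ω => ?_
  calc ‖V s ω‖ₑ = ‖V (s + r) ω - (V (s + r) ω - V s ω)‖ₑ := by rw [_root_.sub_sub_cancel]
    _ ≤ ‖V (s + r) ω‖ₑ + ‖V (s + r) ω - V s ω‖ₑ := enorm_sub_le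
    _ ≤ ((‖V (s + r) ω‖ₑ - M) + M) + ‖V (s + r) ω - V s ω‖ₑ := by gcongr; exact le_tsub_add
    _ = _ := add_comm _ _

end Approx

/-! ### Random approximate solutions with the marginals of a driven process -/

section Approx

variable {X Ω E : Type*} [MeasurableSpace X] [MeasurableSpace Ω]
  [NormedAddCommGroup E] [InnerProductSpace ℝ E] [FiniteDimensional ℝ E]
  [MeasurableSpace E] [BorelSpace E]

/-- A process which follows the field `b` on average has the same one-dimensional marginals as
random curves `ξ` which follow the field `b` up to a small error. -/
lemma IsDriven.exists_approx {P : Measure Ω} [IsFiniteMeasure P] {ζ : Ω → X} {Z₀ : Ω → E}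
    {V : ℝ → Ω → E} {b : X → ℝ → E → E} (hD : IsDriven P ζ Z₀ V b)
    (hb : Measurable fun q : X × ℝ × E => b q.1 q.2.1 q.2.2)
    (hb0 : ∀ x, ∀ s < 0, ∀ y, b x s y = 0) (Φ : X × ℝ × E → ℝ≥0∞) (hΦ : Measurable Φ) (C : ℝ≥0∞)
    (hC : C ≠ ∞)
    (hΦC : ∫⁻ s in Ioc (-1 : ℝ) 1, ∫⁻ ω, Φ (ζ ω, s, drivenPath Z₀ V s ω) ∂P ≤ C)
    (ε : ℝ) (hε : 0 < ε) :
    ∃ (σ : ℝ → ℝ) (ξ : ℝ → (X × E) × (ℕ → unitInterval) → E), Measurable σ ∧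
      Measurable (Function.uncurry ξ) ∧ (∀ t ∈ Icc (0 : ℝ) 1, |σ t - t| ≤ ε) ∧
      ∫⁻ p, (∫⁻ t in Icc (0 : ℝ) 1, Φ (p.1.1, σ t, ξ t p))
        ∂((P.map fun ω => (ζ ω, Z₀ ω)).prod uniformNoise) ≤ C + 1 ∧
      (∀ t ∈ Icc (0 : ℝ) 1,
        ∫⁻ p, ‖ξ t p - (p.1.2 + ∫ r in (0 : ℝ)..t, b p.1.1 (σ r) (ξ r p))‖ₑ
          ∂((P.map fun ω => (ζ ω, Z₀ ω)).prod uniformNoise) ≤ ENNReal.ofReal ε) ∧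
      ∀ t ∈ Icc (0 : ℝ) 1,
        ((P.map fun ω => (ζ ω, Z₀ ω)).prod uniformNoise).map (fun p => (p.1.1, ξ t p)) =
          P.map fun ω => (ζ ω, drivenPath Z₀ V (σ t) ω) := by
  obtain ⟨hζ, hZ₀, hVm, hV, hV0, hdrift⟩ := hD
  have hpath := measurable_drivenPath hZ₀ hVm
  have hpaths : ∀ s, Measurable (drivenPath Z₀ V s) := fun s =>
    hpath.comp (measurable_const.prodMk measurable_id)
  set p₀ := P.real univ with hp₀
  have hp₀' : P univ = ENNReal.ofReal p₀ := (ofReal_measureReal (measure_ne_top P univ)).symm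
  have hC1 : C + 1 ≠ ∞ := by simp [hC]
  set e := ENNReal.ofReal (ε / 4) with he
  have he0 : e ≠ 0 := by simp [he, hε]
  -- the truncation level
  obtain ⟨M, hM⟩ := ((ENNReal.tendsto_nhds_zero.1 (tendsto_lintegral_tail hVm hV)) (e / 5)
    (ENNReal.div_pos he0 (by simp))).exists
  set τ := ∫⁻ s, ∫⁻ ω, (‖V s ω‖ₑ - (M : ℝ≥0∞)) ∂P with hτ
  -- Four copies of `τ` bound the truncation errors of the complete steps, the fifth the incomplete
  -- one.
  have hτe : 5 * τ ≤ e := by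
    calc 5 * τ ≤ 5 * (e / 5) := by gcongr
      _ = e := ENNReal.mul_div_cancel (by simp) (by simp)
  -- the mesh
  set δ := e / (C + 1) with hδ
  have hδ0 : δ ≠ 0 := (ENNReal.div_pos he0 hC1).ne'
  have hδt : δ ≠ ∞ := ENNReal.div_ne_top ofReal_ne_top (by simp)
  have hδe : δ * (C + 1) = e := ENNReal.div_mul_cancel (by simp) hC1
  obtain ⟨ρ, hρ, htr⟩ := Metric.eventually_nhds_iff.1 ((ENNReal.tendsto_nhds_zero.1
    (tendsto_lintegral_lintegral_translate_sub V hVm hV)) δ (pos_iff_ne_zero.2 hδ0))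
  -- The martingale sum is at most `√n * (4 * (h * M)) * p₀ = 4 * M * p₀ * √h`, and the incomplete
  -- step adds `h * M * p₀ ≤ M * p₀ * √h`; together these give the factor `5`.
  obtain ⟨n, hn, hnρ, hnε, hnM⟩ : ∃ n : ℕ, 0 < n ∧ (1 / n : ℝ) < ρ ∧ (1 / n : ℝ) < ε ∧
      5 * M * p₀ * √(1 / n) < ε / 4 := by
    have h1 : Tendsto (fun n : ℕ => (1 / n : ℝ)) atTop (𝓝 0) := tendsto_one_div_atTop_nhds_zero_nat
    have h2 : Tendsto (fun n : ℕ => 5 * M * p₀ * √(1 / n : ℝ)) atTop (𝓝 0) := by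
      have := ((Real.continuous_sqrt.tendsto 0).comp h1).const_mul (5 * M * p₀)
      simpa using this
    exact ((eventually_gt_atTop 0).and ((h1.eventually (gt_mem_nhds hρ)).and
      ((h1.eventually (gt_mem_nhds hε)).and
        (h2.eventually (gt_mem_nhds (by positivity)))))).exists
  have hn' : (0 : ℝ) < n := by exact_mod_cast hn
  set h : ℝ := 1 / n with hh
  have hhpos : 0 < h := by positivity
  set A : ℝ → ℝ≥0∞ := fun s => ∫⁻ r in Ioc 0 h, ∫⁻ ω, ‖V (s + r) ω - V s ω‖ₑ ∂P with hA
  have hAm' : Measurable (fun q : ℝ × ℝ => ∫⁻ ω, ‖V (q.1 + q.2) ω - V q.1 ω‖ₑ ∂P) := by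
    have : Measurable (fun q : (ℝ × ℝ) × Ω => ‖V (q.1.1 + q.1.2) q.2 - V q.1.1 q.2‖ₑ) := by
      refine (StronglyMeasurable.sub (hVm.comp_measurable
        (g := fun q : (ℝ × ℝ) × Ω => (q.1.1 + q.1.2, q.2)) ?_)
        (hVm.comp_measurable (g := fun q : (ℝ × ℝ) × Ω => (q.1.1, q.2)) ?_)).enorm <;> fun_prop
    exact this.lintegral_prod_right'
  have hAm : Measurable A := hAm'.lintegral_prod_right' (ν := volume.restrict (Ioc 0 h))
  have hAδ : ∫⁻ s, A s ≤ δ * ENNReal.ofReal (1 / n) := by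
    rw [hA, lintegral_lintegral_swap (f := fun s r => ∫⁻ ω, ‖V (s + r) ω - V s ω‖ₑ ∂P)
      hAm'.aemeasurable]
    calc _ ≤ ∫⁻ r in Ioc 0 h, δ := by
          refine setLIntegral_mono measurable_const fun r hr => htr ?_
          rw [dist_zero_right, Real.norm_eq_abs, abs_of_pos hr.1]
          exact hr.2.trans_lt hnρ
      _ = δ * ENNReal.ofReal (1 / n) := by
          rw [setLIntegral_const, Real.volume_Ioc, sub_zero]
  set φ : ℝ → ℝ≥0∞ := fun s => ∫⁻ ω, Φ (ζ ω, s, drivenPath Z₀ V s ω) ∂P with hφ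
  have hφm : Measurable φ := by
    have : Measurable fun q : ℝ × Ω => Φ (ζ q.2, q.1, drivenPath Z₀ V q.1 q.2) :=
      hΦ.comp ((hζ.comp measurable_snd).prodMk (measurable_fst.prodMk hpath))
    exact this.lintegral_prod_right'
  -- The drift identity and the integrability of `V s` hold only for almost every `s`, so the grid
  -- is shifted until they hold at all its points.
  obtain ⟨s₀, hs₀, hgood, hsumφ, hsumA⟩ := exists_grid_sum_le hn φ A hφm hAm C δ hδ0 hδt
    hΦC hAδ
    (fun s => ((fun ω => b (ζ ω) s (drivenPath Z₀ V s ω)) =ᵐ[P]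
      P[V s | MeasurableSpace.comap (fun ω => (ζ ω, drivenPath Z₀ V s ω)) inferInstance]) ∧
      Integrable (V s) P)
    (by filter_upwards [hdrift, hV.prod_right_ae] with s h1 h2 using ⟨h1, h2⟩)
  rw [hδe] at hsumA
  -- the chain along the grid
  obtain ⟨y, hym, hy0, hylaw, hyres⟩ := exists_chain P ζ hζ
    (fun l : ℕ => drivenPath Z₀ V (s₀ + l / n)) (fun l => hpaths _)
  have hstart : (fun ω => (ζ ω, drivenPath Z₀ V (s₀ + (0 : ℕ) / n) ω)) = fun ω => (ζ ω, Z₀ ω) := by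
    rw [drivenPath_of_nonpos hV0 (by simpa using hs₀.2)]
  rw [hstart] at hylaw hyres
  set Q := (P.map fun ω => (ζ ω, Z₀ ω)).prod uniformNoise with hQ
  let J : ℝ → ℕ := cellIndex s₀ n
  have hJm : Measurable J := measurable_cellIndex s₀ n
  have hJcell : ∀ t ∈ Icc (0 : ℝ) 1, t ∈ Ico (s₀ + J t / n) (s₀ + (J t + 1) / n) := fun t ht =>
    mem_cell hn (hs₀.2.trans ht.1)
  have hJn : ∀ t ∈ Icc (0 : ℝ) 1, J t < n + 1 := by
    intro t ht
    have h1 := (hJcell t ht).1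
    have h2 : (J t : ℝ) / n < 1 + 1 / n := by linarith [ht.2, hs₀.1]
    rw [div_lt_iff₀ hn'] at h2
    have h3 : (1 + 1 / n : ℝ) * n = n + 1 := by field_simp
    rw [h3] at h2
    exact_mod_cast h2
  have hyJ : Measurable (fun q : ℝ × ((X × E) × (ℕ → unitInterval)) => y (J q.1) q.2) := by
    have h1 : Measurable (fun q : ℕ × ((X × E) × (ℕ → unitInterval)) => y q.1 q.2) :=
      measurable_from_prod_countable_right hym
    exact h1.comp ((hJm.comp measurable_fst).prodMk measurable_snd)
  refine ⟨fun t => s₀ + J t / n, fun t p => y (J t) p, ?_, hyJ, ?_, ?_, ?_, fun t ht => hylaw (J t)⟩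
  · exact measurable_const.add ((measurable_from_nat (f := fun k : ℕ => (k : ℝ) / n)).comp hJm)
  · intro t ht
    obtain ⟨h1, h2⟩ := hJcell t ht
    rw [abs_sub_comm, abs_of_nonneg (by linarith)]
    have : (J t + 1 : ℝ) / n = J t / n + h := by rw [hh]; ring
    linarith
  · -- the gauge
    have hm1 : Measurable (fun q : ((X × E) × (ℕ → unitInterval)) × ℝ =>
        Φ (q.1.1.1, s₀ + J q.2 / n, y (J q.2) q.1)) := by
      refine hΦ.comp ((by fun_prop : Measurable fun q : ((X × E) × (ℕ → unitInterval)) × ℝ =>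
        q.1.1.1).prodMk (Measurable.prodMk ?_ (hyJ.comp measurable_swap)))
      exact measurable_const.add (((measurable_from_nat (f := fun k : ℕ => (k : ℝ) / n)).comp
        hJm).comp measurable_snd)
    have hm2 : ∀ l : ℕ, Measurable (fun a : X × E => Φ (a.1, s₀ + l / n, a.2)) := fun l =>
      hΦ.comp (by fun_prop)
    have hφl : ∀ l : ℕ, ∫⁻ p, Φ (p.1.1, s₀ + l / n, y l p) ∂Q = φ (s₀ + l / n) := by
      intro l
      have h1 := lintegral_map (μ := Q) (hm2 l) (g := fun p => (p.1.1, y l p))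
        ((by fun_prop : Measurable fun p : (X × E) × (ℕ → unitInterval) => p.1.1).prodMk (hym l))
      rw [← h1, hylaw l, lintegral_map (hm2 l) (hζ.prodMk (hpaths _))]
    rw [lintegral_lintegral_swap (f := fun (p : (X × E) × (ℕ → unitInterval)) t =>
      Φ (p.1.1, s₀ + J t / n, y (J t) p)) hm1.aemeasurable]
    simp_rw [hφl]
    have hsub : Icc (0 : ℝ) 1 ⊆ Ico s₀ (s₀ + (n + 1 : ℕ) / n) := by
      intro t ht
      refine ⟨hs₀.2.trans ht.1, ?_⟩
      have : ((n + 1 : ℕ) : ℝ) / n = 1 + 1 / n := by push_cast; field_simp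
      linarith [ht.2, hs₀.1]
    refine (lintegral_mono_set hsub).trans ?_
    exact (lintegral_cellIndex (fun l => φ (s₀ + l / n)) s₀ hn (n + 1)).le.trans hsumφ
  · -- the residual
    intro t ht
    let β : ℕ → X × E → E := fun l a => h • b a.1 (s₀ + l / n) a.2
    have hβm : ∀ l, Measurable (β l) := fun l =>
      (hb.comp (by fun_prop : Measurable fun a : X × E => (a.1, s₀ + (l : ℝ) / n, a.2))).const_smul h
    have hbl : ∀ l : ℕ, (fun ω => b (ζ ω) (s₀ + l / n) (drivenPath Z₀ V (s₀ + l / n) ω)) =ᵐ[P]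
      P[V (s₀ + l / n) | MeasurableSpace.comap
        (fun ω => (ζ ω, drivenPath Z₀ V (s₀ + l / n) ω)) inferInstance] := fun l => (hgood l).1
    have hres := hyres β (fun l ω => h • V (s₀ + l / n) ω) (J t) (h * M) hβm (by positivity) (by
      intro l _
      refine ⟨(hgood l).2.smul h, ?_⟩
      filter_upwards [hbl l, condExp_smul (μ := P) h (V (s₀ + l / n)) (MeasurableSpace.comap
        (fun ω => (ζ ω, drivenPath Z₀ V (s₀ + l / n) ω)) inferInstance)] with ω h1 h2
      exact (congrArg (h • ·) h1).trans h2.symm)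
    have hsucc : ∀ l : ℕ, s₀ + ((l + 1 : ℕ) : ℝ) / n = s₀ + l / n + h := by
      intro l; rw [hh]; push_cast; ring
    have hRM : ENNReal.ofReal (h * M) = ENNReal.ofReal h * (M : ℝ≥0∞) := by
      rw [ENNReal.ofReal_mul hhpos.le, ENNReal.ofReal_natCast]
    have hterm : ∀ l : ℕ, 4 * (∫⁻ ω, (‖drivenPath Z₀ V (s₀ + (l + 1 : ℕ) / n) ω -
          drivenPath Z₀ V (s₀ + l / n) ω‖ₑ - ENNReal.ofReal (h * M)) ∂P) +
        ∫⁻ ω, ‖drivenPath Z₀ V (s₀ + (l + 1 : ℕ) / n) ω -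
          drivenPath Z₀ V (s₀ + l / n) ω - h • V (s₀ + l / n) ω‖ₑ ∂P ≤
        4 * (∫⁻ t in Ioc (s₀ + (l : ℝ) / n) (s₀ + (l + 1) / n), ∫⁻ ω, (‖V t ω‖ₑ - (M : ℝ≥0∞)) ∂P) +
          A (s₀ + l / n) := by
      intro l
      rw [hsucc l, hRM, show s₀ + ((l : ℝ) + 1) / n = s₀ + l / n + h by rw [hh]; ring]
      exact add_le_add (mul_le_mul_right (lintegral_enorm_drivenPath_sub_tail_le hVm hV _ hhpos.le _) _)
        (lintegral_enorm_drivenPath_sub_sub_le hVm hV _ hhpos.le)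
    -- the last incomplete step
    have hlast : ∫⁻ p, ‖(t - (s₀ + J t / n)) • b p.1.1 (s₀ + J t / n) (y (J t) p)‖ₑ ∂Q ≤
        A (s₀ + J t / n) + (τ + ENNReal.ofReal h * (M * P univ)) := by
      have hm3 : Measurable (fun a : X × E => ‖b a.1 (s₀ + J t / n) a.2‖ₑ) :=
        (hb.comp (by fun_prop : Measurable fun a : X × E => (a.1, s₀ + (J t : ℝ) / n, a.2))).enorm
      have h1 := lintegral_map (μ := Q) hm3 (g := fun p => (p.1.1, y (J t) p))
        ((by fun_prop : Measurable fun p : (X × E) × (ℕ → unitInterval) => p.1.1).prodMk (hym _))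
      rw [hylaw (J t), lintegral_map hm3 (hζ.prodMk (hpaths _))] at h1
      have h2 : ∫⁻ ω, ‖b (ζ ω) (s₀ + J t / n) (drivenPath Z₀ V (s₀ + J t / n) ω)‖ₑ ∂P ≤
          ∫⁻ ω, ‖V (s₀ + J t / n) ω‖ₑ ∂P := by
        have h3 := eLpNorm_condExp_le_eLpNorm (m := MeasurableSpace.comap
          (fun ω => (ζ ω, drivenPath Z₀ V (s₀ + J t / n) ω)) inferInstance) (μ := P)
          (V (s₀ + J t / n)) (p := 1) le_rfl
        rw [eLpNorm_one_eq_lintegral_enorm, eLpNorm_one_eq_lintegral_enorm] at h3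
        refine le_trans (le_of_eq (lintegral_congr_ae ?_)) h3
        filter_upwards [hbl (J t)] with ω hω
        rw [← hω]
      have hcoef : ‖t - (s₀ + J t / n)‖ₑ ≤ ENNReal.ofReal h := by
        obtain ⟨h4, h5⟩ := hJcell t ht
        rw [Real.enorm_eq_ofReal (by linarith)]
        refine ENNReal.ofReal_le_ofReal ?_
        have : (J t + 1 : ℝ) / n = J t / n + h := by rw [hh]; ring
        linarith
      calc _ ≤ ∫⁻ p, ENNReal.ofReal h * ‖b p.1.1 (s₀ + J t / n) (y (J t) p)‖ₑ ∂Q := by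
            refine lintegral_mono fun p => ?_
            rw [enorm_smul]
            exact mul_le_mul_left hcoef _
        _ = ENNReal.ofReal h * ∫⁻ p, ‖b p.1.1 (s₀ + J t / n) (y (J t) p)‖ₑ ∂Q :=
            lintegral_const_mul' _ _ ofReal_ne_top
        _ ≤ ENNReal.ofReal h * ∫⁻ ω, ‖V (s₀ + J t / n) ω‖ₑ ∂P := by
            rw [← h1]; exact mul_le_mul_right h2 _
        _ ≤ _ := by
            refine (mul_lintegral_enorm_le hVm _ (M : ℝ≥0∞)).trans ?_
            exact add_le_add le_rfl (add_le_add (setLIntegral_le_lintegral _ _) le_rfl)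
    have hint : ∀ p : (X × E) × (ℕ → unitInterval),
        ∫ r in (0 : ℝ)..t, b p.1.1 (s₀ + J r / n) (y (J r) p) =
        (∑ l ∈ Finset.range (J t), β l (p.1.1, y l p)) +
          (t - (s₀ + J t / n)) • b p.1.1 (s₀ + J t / n) (y (J t) p) := by
      intro p
      obtain ⟨-, h2⟩ := integral_cellIndex (F := fun l => b p.1.1 (s₀ + l / n) (y l p)) hn
        (hs₀.2.trans ht.1)
      obtain ⟨h1, -⟩ := integral_cellIndex (F := fun l => b p.1.1 (s₀ + l / n) (y l p)) hn
        hs₀.2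
      obtain ⟨h3, -⟩ := integral_cellIndex (F := fun l => b p.1.1 (s₀ + l / n) (y l p)) hn
        (hs₀.2.trans ht.1)
      refine Eq.trans ?_ h2
      -- For `r < 0` the left end of the cell is negative as well, and the field vanishes there;
      -- starting the grid before time `0` does not change the integral.
      have hzero : ∫ r in s₀..(0 : ℝ), b p.1.1 (s₀ + J r / n) (y (J r) p) = 0 := by
        rw [intervalIntegral.integral_of_le hs₀.2]
        refine setIntegral_eq_zero_of_ae_eq_zero ?_
        have : ∀ᵐ r : ℝ, r ≠ 0 := by simp [ae_iff]
        filter_upwards [this] with r hr0 hr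
        refine hb0 _ _ ?_ _
        have := (mem_cell hn hr.1.le).1
        exact this.trans_lt (lt_of_le_of_ne hr.2 hr0)
      have h4 := intervalIntegral.integral_add_adjacent_intervals h1 (h1.symm.trans h3)
      rw [← h4]
      exact (by rw [hzero, zero_add] : _ = _).symm
    have hdec : ∀ p : (X × E) × (ℕ → unitInterval),
        ‖y (J t) p - (p.1.2 + ∫ r in (0 : ℝ)..t, b p.1.1 (s₀ + J r / n) (y (J r) p))‖ₑ ≤
        ‖y (J t) p - p.1.2 - ∑ l ∈ Finset.range (J t), β l (p.1.1, y l p)‖ₑ +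
        ‖(t - (s₀ + J t / n)) • b p.1.1 (s₀ + J t / n) (y (J t) p)‖ₑ := by
      intro p
      rw [hint]
      refine le_trans (le_of_eq ?_) enorm_sub_le
      congr 1
      abel
    have hm4 : Measurable fun p : (X × E) × (ℕ → unitInterval) =>
        ‖(t - (s₀ + J t / n)) • b p.1.1 (s₀ + J t / n) (y (J t) p)‖ₑ :=
      ((hb.comp ((by fun_prop : Measurable fun p : (X × E) × (ℕ → unitInterval) => p.1.1).prodMk
        (measurable_const.prodMk (hym (J t))))).const_smul (t - (s₀ + J t / n))).enorm
    have hJr : J t + 1 ≤ n + 1 := hJn t ht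
    calc _ ≤ ∫⁻ p, (‖y (J t) p - p.1.2 - ∑ l ∈ Finset.range (J t), β l (p.1.1, y l p)‖ₑ +
          ‖(t - (s₀ + J t / n)) • b p.1.1 (s₀ + J t / n) (y (J t) p)‖ₑ) ∂Q := lintegral_mono hdec
      _ = (∫⁻ p, ‖y (J t) p - p.1.2 - ∑ l ∈ Finset.range (J t), β l (p.1.1, y l p)‖ₑ ∂Q) +
          ∫⁻ p, ‖(t - (s₀ + J t / n)) • b p.1.1 (s₀ + J t / n) (y (J t) p)‖ₑ ∂Q :=
          lintegral_add_right _ hm4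
      _ ≤ (ENNReal.ofReal (√(J t) * (4 * (h * M)) * p₀) + ∑ l ∈ Finset.range (J t),
            (4 * (∫⁻ t in Ioc (s₀ + (l : ℝ) / n) (s₀ + (l + 1) / n),
              ∫⁻ ω, (‖V t ω‖ₑ - (M : ℝ≥0∞)) ∂P) + A (s₀ + l / n))) +
          (A (s₀ + J t / n) + (τ + ENNReal.ofReal h * (M * P univ))) :=
          add_le_add (hres.trans (add_le_add le_rfl (Finset.sum_le_sum fun l _ => hterm l))) hlast
      _ = (ENNReal.ofReal (√(J t) * (4 * (h * M)) * p₀) + ENNReal.ofReal h * (M * P univ)) +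
          (4 * (∫⁻ t in Ioc s₀ (s₀ + J t / n), ∫⁻ ω, (‖V t ω‖ₑ - (M : ℝ≥0∞)) ∂P) + τ) +
          ∑ l ∈ Finset.range (J t + 1), A (s₀ + l / n) := by
          rw [Finset.sum_add_distrib, ← Finset.mul_sum, sum_setLIntegral_grid,
            Finset.sum_range_succ]
          ring
      -- The three errors: martingale part with the level `M` of the last step, excess of the
      -- velocities over `M`, and translations. Since `e` is `ε / 4`, their sum stays below `ε`.
      _ ≤ e + e + e := by
          refine add_le_add (add_le_add ?_ ?_) ?_
          · rw [hp₀', ← ENNReal.ofReal_natCast M, ← ENNReal.ofReal_mul (by positivity),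
              ← ENNReal.ofReal_mul hhpos.le, ← ENNReal.ofReal_add (by positivity) (by positivity)]
            refine ENNReal.ofReal_le_ofReal ?_
            have hJle : (J t : ℝ) ≤ n := by exact_mod_cast Nat.le_of_lt_succ (hJn t ht)
            have hsq1 : √(J t : ℝ) ≤ √n := Real.sqrt_le_sqrt hJle
            have hsq2 : √(n : ℝ) * h = √h := by
              have : h = √h * √h := (Real.mul_self_sqrt hhpos.le).symm
              have h2 : √(n : ℝ) * √h = 1 := by
                rw [← Real.sqrt_mul hn'.le, hh, mul_one_div_cancel hn'.ne', Real.sqrt_one]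
              calc √(n : ℝ) * h = (√(n : ℝ) * √h) * √h := by rw [mul_assoc, ← this]
                _ = √h := by rw [h2, one_mul]
            have hsq3 : h ≤ √h := by
              have h1 : h ≤ 1 := by
                rw [hh, div_le_one hn']; exact_mod_cast hn
              exact Real.le_sqrt_of_sq_le (by nlinarith)
            have hMp : (0 : ℝ) ≤ M * p₀ := by positivity
            calc √(J t : ℝ) * (4 * (h * M)) * p₀ + h * (M * p₀)
                ≤ √(n : ℝ) * (4 * (h * M)) * p₀ + √h * (M * p₀) := by gcongr
              _ = 4 * (√(n : ℝ) * h) * (M * p₀) + √h * (M * p₀) := by ring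
              _ = 5 * M * p₀ * √h := by rw [hsq2]; ring
              _ ≤ ε / 4 := hnM.le
          · calc _ ≤ 4 * τ + τ := by
                  refine add_le_add (mul_le_mul_right (setLIntegral_le_lintegral _ _) _) le_rfl
              _ = 5 * τ := by ring
              _ ≤ e := hτe
          · exact (Finset.sum_le_sum_of_subset (Finset.range_subset_range.2 hJr)).trans hsumA
      _ ≤ ENNReal.ofReal ε := by
          rw [he, ← ENNReal.ofReal_add (by positivity) (by positivity),
            ← ENNReal.ofReal_add (by positivity) (by positivity)]
          exact ENNReal.ofReal_le_ofReal (by linarith)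

end Approx

/-! ### Lower semicontinuous gauges -/

/-- A lower semicontinuous integrable function which controls the approximation of `f` by bounded
continuous functions, and which is infinite off a given set of full measure. -/
lemma exists_gauge {S E : Type*} [TopologicalSpace S] [TopologicalSpace.PseudoMetrizableSpace S]
    [MeasurableSpace S] [BorelSpace S] [NormedAddCommGroup E] [NormedSpace ℝ E] [MeasurableSpace E]
    [BorelSpace E] [SecondCountableTopology E]
    (m : Measure S) [IsFiniteMeasure m] (f : S → E) (hfm : Measurable f) (hf : Integrable f m)
    (D : Set S) (hD : MeasurableSet D) (hmD : m Dᶜ = 0) :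
    ∃ (Φ : S → ℝ≥0∞) (w : ℕ → S → E) (M : ℕ → ℝ), LowerSemicontinuous Φ ∧
      (∀ k, Continuous (w k)) ∧ (∀ k x, ‖w k x‖ ≤ M k) ∧
      (∀ k x, 2 ^ k * ‖f x - w k x‖ₑ ≤ Φ x) ∧ ∫⁻ x, Φ x ∂m ≠ ∞ ∧ ∀ x ∉ D, Φ x = ∞ := by
  let := TopologicalSpace.pseudoMetrizableSpacePseudoMetric S
  have h1 : ∀ k : ℕ, ∃ g : BoundedContinuousFunction S E,
      ∫⁻ x, ‖f x - g x‖ₑ ∂m ≤ (4 ^ k)⁻¹ := by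
    intro k
    obtain ⟨g, hg, -⟩ := (memLp_one_iff_integrable.2 hf).exists_boundedContinuous_eLpNorm_sub_le
      one_ne_top (ε := (4 ^ k : ℝ≥0∞)⁻¹) (by simp)
    rw [eLpNorm_one_eq_lintegral_enorm] at hg
    exact ⟨g, hg⟩
  choose g hg using h1
  have hgm : ∀ k, Measurable fun x => 2 ^ k * ‖f x - g k x‖ₑ := fun k =>
    ((hfm.sub (g k).continuous.measurable).enorm).const_mul _
  -- Errors of size `4⁻ᵏ` weighted by `2ᵏ` still sum to at most `2`. The infinite value on the null
  -- set `Dᶜ` costs nothing in the integral.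
  set F : S → ℝ≥0∞ := fun x => (∑' k, 2 ^ k * ‖f x - g k x‖ₑ) + Dᶜ.indicator (fun _ => ∞) x with hF
  have hFm : Measurable F := (Measurable.tsum hgm).add
    (measurable_const.indicator hD.compl)
  have hFint : ∫⁻ x, F x ∂m ≤ 2 := by
    rw [hF, lintegral_add_right _ (measurable_const.indicator hD.compl),
      lintegral_indicator_const hD.compl, hmD, mul_zero, add_zero,
      lintegral_tsum fun k => (hgm k).aemeasurable]
    calc _ ≤ ∑' k : ℕ, (2⁻¹ : ℝ≥0∞) ^ k := by
          refine ENNReal.tsum_le_tsum fun k => ?_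
          rw [lintegral_const_mul' _ _ (by simp)]
          calc (2 : ℝ≥0∞) ^ k * ∫⁻ x, ‖f x - g k x‖ₑ ∂m ≤ 2 ^ k * (4 ^ k)⁻¹ := by
                gcongr; exact hg k
            _ = (2⁻¹) ^ k := by
                rw [show (4 : ℝ≥0∞) = 2 * 2 by norm_num, mul_pow,
                  ENNReal.mul_inv (by simp) (by simp), ← mul_assoc,
                  ENNReal.mul_inv_cancel (by simp) (by simp), one_mul, ENNReal.inv_pow]
      _ = 2 := by rw [ENNReal.tsum_geometric, ENNReal.one_sub_inv_two, inv_inv]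
  -- Vitali–Carathéodory: a measurable function has a lower semicontinuous majorant with almost the
  -- same integral.
  obtain ⟨Φ, hΦF, hΦ, hΦint⟩ := exists_le_lowerSemicontinuous_lintegral_ge m F hFm
    (ε := 1) one_ne_zero
  refine ⟨Φ, fun k => g k, fun k => ‖g k‖, hΦ, fun k => (g k).continuous,
    fun k x => (g k).norm_coe_le_norm x, fun k x => ?_, ?_, fun x hx => ?_⟩
  · refine le_trans ?_ (hΦF x)
    exact (ENNReal.le_tsum k).trans le_self_add
  · refine (hΦint.trans_lt ?_).ne
    exact ENNReal.add_lt_top.2 ⟨hFint.trans_lt (by simp), by simp⟩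
  · refine top_le_iff.1 (le_trans ?_ (hΦF x))
    simp [hF, hx]

/-! ### Almost sure convergence to solutions -/

section Limit

variable {X Ω E : Type*} [MeasurableSpace X] [MeasurableSpace Ω]
  [NormedAddCommGroup E] [InnerProductSpace ℝ E] [FiniteDimensional ℝ E]
  [MeasurableSpace E] [BorelSpace E]

/-- The curve `γ` starts at `x₀`, solves `γ' = b s γ` on `[0, 1]` and stays in `D` at almost every
time. -/
def IsSolutionFrom {E : Type*} [NormedAddCommGroup E] [NormedSpace ℝ E] (b : ℝ → E → E)
    (D : Set (ℝ × E)) (x₀ : E) (γ : ℝ → E) : Prop :=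
  IntervalIntegrable (fun s => b s (γ s)) volume 0 1 ∧
    (∀ t ∈ Icc (0 : ℝ) 1, γ t = x₀ + ∫ s in (0 : ℝ)..t, b s (γ s)) ∧
    ∀ᵐ s ∂(volume.restrict (Icc (0 : ℝ) 1)), (s, γ s) ∈ D

lemma measurable_integral_field {b : X → ℝ → E → E}
    (hb : Measurable fun q : X × ℝ × E => b q.1 q.2.1 q.2.2) {ζ : Ω → X} (hζ : Measurable ζ)
    {σ : ℝ → ℝ} (hσ : Measurable σ) {ξ : ℝ → Ω → E} (hξ : Measurable (Function.uncurry ξ)) :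
    Measurable (fun p : Ω × ℝ => ∫ r in Ioc 0 p.2, b (ζ p.1) (σ r) (ξ r p.1)) := by
  have h1 : StronglyMeasurable (fun q : (Ω × ℝ) × ℝ =>
      {q : (Ω × ℝ) × ℝ | 0 < q.2 ∧ q.2 ≤ q.1.2}.indicator
        (fun q => b (ζ q.1.1) (σ q.2) (ξ q.2 q.1.1)) q) := by
    refine (Measurable.indicator ?_ ?_).stronglyMeasurable
    · refine hb.comp ((hζ.comp (by fun_prop)).prodMk ((hσ.comp measurable_snd).prodMk ?_))
      exact hξ.comp (by fun_prop : Measurable fun q : (Ω × ℝ) × ℝ => (q.2, q.1.1))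
    · exact (measurableSet_lt measurable_const measurable_snd).inter
        (measurableSet_le measurable_snd (by fun_prop))
  have h2 : (fun p : Ω × ℝ => ∫ r in Ioc 0 p.2, b (ζ p.1) (σ r) (ξ r p.1)) = fun p : Ω × ℝ =>
      ∫ r, {q : (Ω × ℝ) × ℝ | 0 < q.2 ∧ q.2 ≤ q.1.2}.indicator
        (fun q => b (ζ q.1.1) (σ q.2) (ξ q.2 q.1.1)) (p, r) := by
    funext p
    rw [← integral_indicator measurableSet_Ioc]
    rfl
  rw [h2]
  exact (h1.integral_prod_right (ν := volume)).measurable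

/-- Almost surely, random curves which follow a field up to an error summable in mean converge to
solutions, along the subsequences on which the gauge is bounded. -/
lemma ae_exists_subseq_tendsto_solution {S : Type*} [MeasurableSpace S] [TopologicalSpace X]
    [OpensMeasurableSpace (X × ℝ × E)]
    {Q : Measure S} [IsFiniteMeasure Q] {ζ : S → X} (hζ : Measurable ζ) {x₀ : S → E}
    (hx₀ : Measurable x₀) (b : X → ℝ → E → E)
    (hb : Measurable fun q : X × ℝ × E => b q.1 q.2.1 q.2.2)
    (D : Set (X × ℝ × E)) (Φ : X × ℝ × E → ℝ≥0∞) (hΦ : LowerSemicontinuous Φ)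
    (w : ℕ → X × ℝ × E → E) (hw : ∀ k, Continuous (w k)) (M : ℕ → ℝ) (hM : ∀ k p, ‖w k p‖ ≤ M k)
    (hbw : ∀ k p, 2 ^ k * ‖b p.1 p.2.1 p.2.2 - w k p‖ₑ ≤ Φ p)
    (hΦD : ∀ x, ∀ s ∈ Icc (0 : ℝ) 1, ∀ y, (x, s, y) ∉ D → Φ (x, s, y) = ∞)
    (σ : ℕ → ℝ → ℝ) (ξ : ℕ → ℝ → S → E) (hσ : ∀ n, Measurable (σ n))
    (hξ : ∀ n, Measurable (Function.uncurry (ξ n)))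
    (hσlim : ∀ s ∈ Icc (0 : ℝ) 1, Tendsto (fun n => σ n s) atTop (𝓝 s))
    (hres : ∀ n, ∀ t ∈ Icc (0 : ℝ) 1,
      ∫⁻ p, ‖ξ n t p - (x₀ p + ∫ r in (0 : ℝ)..t, b (ζ p) (σ n r) (ξ n r p))‖ₑ ∂Q ≤
        2⁻¹ ^ n) (t : ℝ) (ht : t ∈ Icc (0 : ℝ) 1) :
    ∀ᵐ p ∂Q, ∀ c : ℝ≥0∞, c ≠ ∞ → ∀ φ : ℕ → ℕ, StrictMono φ →
      (∀ n, ∫⁻ s in Icc (0 : ℝ) 1, Φ (ζ p, σ (φ n) s, ξ (φ n) s p) ≤ c) →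
      ∃ (ψ : ℕ → ℕ) (γ : ℝ → E), StrictMono ψ ∧
        IsSolutionFrom (b (ζ p)) {q | (ζ p, q.1, q.2) ∈ D} (x₀ p) γ ∧
        Tendsto (fun n => ξ (φ (ψ n)) t p) atTop (𝓝 (γ t)) := by
  -- the residual as a jointly measurable function
  have hkm : ∀ n, Measurable (fun q : S × ℝ =>
      ‖ξ n q.2 q.1 - (x₀ q.1 + ∫ r in Ioc 0 q.2, b (ζ q.1) (σ n r) (ξ n r q.1))‖ₑ) := by
    intro n
    refine Measurable.enorm (Measurable.sub ((hξ n).comp measurable_swap) ?_)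
    exact (hx₀.comp measurable_fst).add (measurable_integral_field hb hζ (hσ n) (hξ n))
  have hIoc : ∀ n p, ∀ s ∈ Icc (0 : ℝ) 1,
      ‖ξ n s p - (x₀ p + ∫ r in (0 : ℝ)..s, b (ζ p) (σ n r) (ξ n r p))‖ₑ =
      ‖ξ n s p - (x₀ p + ∫ r in Ioc 0 s, b (ζ p) (σ n r) (ξ n r p))‖ₑ := by
    intro n p s hs
    rw [intervalIntegral.integral_of_le hs.1]
  -- The time-integrated residual yields a solution in the limit; the residual at `t` is added
  -- because convergence of `ξ` is wanted at this very time. Summability of the means makes the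
  -- whole sequence `R n` tend to zero almost surely, so the subsequence may depend on `p`.
  set R : ℕ → S → ℝ≥0∞ := fun n p => (∫⁻ s in Icc (0 : ℝ) 1,
      ‖ξ n s p - (x₀ p + ∫ r in Ioc 0 s, b (ζ p) (σ n r) (ξ n r p))‖ₑ) +
      ‖ξ n t p - (x₀ p + ∫ r in Ioc 0 t, b (ζ p) (σ n r) (ξ n r p))‖ₑ with hR
  have hR1m : ∀ n, Measurable fun p => ∫⁻ s in Icc (0 : ℝ) 1,
      ‖ξ n s p - (x₀ p + ∫ r in Ioc 0 s, b (ζ p) (σ n r) (ξ n r p))‖ₑ := fun n =>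
    (hkm n).lintegral_prod_right'
  have hRm : ∀ n, Measurable (R n) := fun n =>
    (hR1m n).add ((hkm n).comp (measurable_id.prodMk measurable_const))
  have hRle : ∀ n, ∫⁻ p, R n p ∂Q ≤ 2 * 2⁻¹ ^ n := by
    intro n
    rw [hR, lintegral_add_left (hR1m n), two_mul]
    refine add_le_add ?_ ?_
    · rw [lintegral_lintegral_swap (f := fun p s =>
        ‖ξ n s p - (x₀ p + ∫ r in Ioc 0 s, b (ζ p) (σ n r) (ξ n r p))‖ₑ) (hkm n).aemeasurable]
      calc _ ≤ ∫⁻ s in Icc (0 : ℝ) 1, 2⁻¹ ^ n := by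
            refine setLIntegral_mono measurable_const fun s hs => ?_
            simp_rw [← hIoc n _ s hs]
            exact hres n s hs
        _ = 2⁻¹ ^ n := by simp
    · simp_rw [← hIoc n _ t ht]
      exact hres n t ht
  have hRsum : ∫⁻ p, ∑' n, R n p ∂Q ≠ ∞ := by
    rw [lintegral_tsum fun n => (hRm n).aemeasurable]
    refine ((ENNReal.tsum_le_tsum hRle).trans_lt ?_).ne
    rw [ENNReal.tsum_mul_left, ENNReal.tsum_geometric, ENNReal.one_sub_inv_two, inv_inv]
    exact ENNReal.mul_lt_top (by simp) (by simp)
  have hRlim : ∀ᵐ p ∂Q, Tendsto (fun n => R n p) atTop (𝓝 0) := by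
    filter_upwards [ae_lt_top (Measurable.tsum hRm) hRsum] with p hp
    have := ENNReal.tendsto_atTop_zero_of_tsum_ne_top hp.ne
    exact this
  filter_upwards [hRlim] with p hp c hc φ hφ hle
  have hbp : Measurable (Function.uncurry (b (ζ p))) :=
    hb.comp (measurable_const.prodMk measurable_id)
  have hcont : Continuous fun q : ℝ × E => (ζ p, q.1, q.2) := by fun_prop
  have hξp : ∀ n, Measurable fun s => ξ n s p := fun n =>
    (hξ n).comp (measurable_id.prodMk measurable_const)
  have hR1 : Tendsto (fun n => ∫⁻ s in Icc (0 : ℝ) 1,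
      ‖ξ n s p - (x₀ p + ∫ r in (0 : ℝ)..s, b (ζ p) (σ n r) (ξ n r p))‖ₑ) atTop (𝓝 0) := by
    refine tendsto_of_tendsto_of_tendsto_of_le_of_le tendsto_const_nhds hp (fun n => zero_le)
      fun n => ?_
    refine (setLIntegral_congr_fun measurableSet_Icc fun s hs => hIoc n p s hs).le.trans ?_
    exact le_self_add
  obtain ⟨γ, ψ, hψ, h1, h2, h3, h4⟩ := exists_subseq_tendsto_solution (b (ζ p)) hbp
    (fun q => Φ (ζ p, q.1, q.2)) (hΦ.comp hcont) (fun k q => w k (ζ p, q.1, q.2))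
    (fun k => (hw k).comp hcont) M (fun k q => hM k _) (fun k s y => hbw k (ζ p, s, y))
    (fun n => σ (φ n)) (fun n s => ξ (φ n) s p) (fun n => hσ _) (fun n => hξp _)
    (fun s hs => (hσlim s hs).comp hφ.tendsto_atTop) c hc hle (x₀ p)
    (hR1.comp hφ.tendsto_atTop)
  refine ⟨ψ, γ, hψ, ⟨h1, h2, ?_⟩, ?_⟩
  · have hγc : ContinuousOn γ (Icc 0 1) := by
      have := intervalIntegral.continuousOn_primitive_interval
        (f := fun r => b (ζ p) r (γ r)) (a := 0) (b := 1) (μ := volume)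
        (by rw [uIcc_of_le zero_le_one, integrableOn_Icc_iff_integrableOn_Ioc]
            exact (intervalIntegrable_iff_integrableOn_Ioc_of_le zero_le_one).1 h1)
      rw [uIcc_of_le zero_le_one] at this
      exact (continuousOn_const.add this).congr fun s hs => h2 s hs
    have hmeas : AEMeasurable (fun s => Φ (ζ p, s, γ s)) (volume.restrict (Icc (0 : ℝ) 1)) :=
      hΦ.measurable.comp_aemeasurable (aemeasurable_const.prodMk (aemeasurable_id.prodMk
        (hγc.aemeasurable measurableSet_Icc)))
    -- The gauge is finite at almost every time along the limit and infinite off `D`, so the limit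
    -- stays in `D`.
    filter_upwards [ae_lt_top' hmeas (h3.trans_lt hc.lt_top).ne, ae_restrict_mem measurableSet_Icc]
      with s hs hs1
    by_contra hcon
    exact hs.ne (hΦD _ s hs1 _ hcon)
  · have hRt : Tendsto (fun n => ξ (φ (ψ n)) t p -
        (x₀ p + ∫ r in (0 : ℝ)..t, b (ζ p) (σ (φ (ψ n)) r) (ξ (φ (ψ n)) r p))) atTop (𝓝 0) := by
      rw [tendsto_zero_iff_enorm_tendsto_zero]
      refine tendsto_of_tendsto_of_tendsto_of_le_of_le tendsto_const_nhds
        (hp.comp (hφ.comp hψ).tendsto_atTop) (fun n => zero_le) fun n => ?_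
      simp only [Function.comp]
      rw [hIoc _ _ t ht]
      exact le_add_self
    have := hRt.add (h4 t ht)
    simpa using this

end Limit

/-! ### Uniqueness of the marginals -/

section Marginals

variable {X Ω E : Type*} [MeasurableSpace X] [MeasurableSpace Ω]
  [NormedAddCommGroup E] [InnerProductSpace ℝ E] [FiniteDimensional ℝ E]
  [MeasurableSpace E] [BorelSpace E]

/-- The marginals of a process which follows a field on average are the limits of the marginals of
random curves which converge, along subsequences, to solutions of the field. -/
lemma IsDriven.exists_tendsto_solution [TopologicalSpace X] [PolishSpace X] [BorelSpace X]
    {P : Measure Ω} [IsFiniteMeasure P] {ζ : Ω → X} {Z₀ : Ω → E}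
    {V : ℝ → Ω → E} {b : X → ℝ → E → E} (hD : IsDriven P ζ Z₀ V b)
    (hb : Measurable fun q : X × ℝ × E => b q.1 q.2.1 q.2.2)
    (hb0 : ∀ x, ∀ s < 0, ∀ y, b x s y = 0) (D : Set (X × ℝ × E)) (hDm : MeasurableSet D)
    (hZD : ∀ᵐ s ∂(volume.restrict (Icc (0 : ℝ) 1)), ∀ᵐ ω ∂P, (ζ ω, s, drivenPath Z₀ V s ω) ∈ D)
    (t : ℝ) (ht : t ∈ Icc (0 : ℝ) 1) :
    ∃ (A : ℕ → (X × E) × (ℕ → unitInterval) → E)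
      (c : ℕ → (X × E) × (ℕ → unitInterval) → ℝ≥0∞) (K : ℝ≥0∞), K ≠ ∞ ∧
      (∀ n, Measurable (A n)) ∧ (∀ n, Measurable (c n)) ∧
      (∀ n, ∫⁻ p, c n p ∂((P.map fun ω => (ζ ω, Z₀ ω)).prod uniformNoise) ≤ K) ∧
      (∀ᵐ p ∂((P.map fun ω => (ζ ω, Z₀ ω)).prod uniformNoise), ∀ C : ℝ≥0∞, C ≠ ∞ →
        ∀ φ : ℕ → ℕ, StrictMono φ → (∀ n, c (φ n) p ≤ C) →
        ∃ (ψ : ℕ → ℕ) (γ : ℝ → E), StrictMono ψ ∧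
          IsSolutionFrom (b p.1.1) {q | (p.1.1, q.1, q.2) ∈ D} p.1.2 γ ∧
          Tendsto (fun n => A (φ (ψ n)) p) atTop (𝓝 (γ t))) ∧
      ∀ f : BoundedContinuousFunction (X × E) ℝ, Tendsto
        (fun n => ∫ p, f (p.1.1, A n p) ∂((P.map fun ω => (ζ ω, Z₀ ω)).prod uniformNoise)) atTop
        (𝓝 (∫ ω, f (ζ ω, drivenPath Z₀ V t ω) ∂P)) := by
  have hζ := hD.measurable_param
  have hpath := measurable_drivenPath hD.measurable_start hD.stronglyMeasurable
  have hpaths : ∀ s, Measurable (drivenPath Z₀ V s) := fun s =>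
    hpath.comp (measurable_const.prodMk measurable_id)
  -- the gauge
  set L : ℝ × Ω → X × ℝ × E := fun q => (ζ q.2, q.1, drivenPath Z₀ V q.1 q.2) with hL
  have hLm : Measurable L := (hζ.comp measurable_snd).prodMk (measurable_fst.prodMk hpath)
  -- The occupation measure of the process, extended to negative times because the shifted grids
  -- start before `0`.
  set m : Measure (X × ℝ × E) := ((volume.restrict (Ioc (-1 : ℝ) 1)).prod P).map L with hm
  have hmfin : IsFiniteMeasure m := by rw [hm]; infer_instance
  have hbint : Integrable (fun q : X × ℝ × E => b q.1 q.2.1 q.2.2) m := by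
    refine ⟨hb.aestronglyMeasurable, ?_⟩
    have h0 : Measurable fun q : ℝ × Ω => ‖b (L q).1 (L q).2.1 (L q).2.2‖ₑ := hb.enorm.comp hLm
    rw [HasFiniteIntegral, hm, lintegral_map hb.enorm hLm, lintegral_prod _ h0.aemeasurable]
    have h1 : ∫⁻ s, ∫⁻ ω, ‖V s ω‖ₑ ∂P < ∞ := by
      have := hD.integrable.2
      rw [HasFiniteIntegral, lintegral_prod _ hD.stronglyMeasurable.enorm.aemeasurable] at this
      exact this
    refine lt_of_le_of_lt ?_ h1
    refine (lintegral_mono_ae (ae_restrict_of_ae ?_)).trans (setLIntegral_le_lintegral _ _)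
    filter_upwards [hD.drift] with s hs
    have h3 := eLpNorm_condExp_le_eLpNorm (m := MeasurableSpace.comap
      (fun ω => (ζ ω, drivenPath Z₀ V s ω)) inferInstance) (μ := P) (V s) (p := 1) le_rfl
    rw [eLpNorm_one_eq_lintegral_enorm, eLpNorm_one_eq_lintegral_enorm] at h3
    refine le_trans (le_of_eq (lintegral_congr_ae ?_)) h3
    filter_upwards [hs] with ω hω
    rw [← hω]
  -- Membership in `D` is known only for times in `[0, 1]`; other times are declared admissible.
  set D' : Set (X × ℝ × E) := D ∪ {q | q.2.1 ∉ Icc (0 : ℝ) 1} with hD'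
  have hcomp : MeasurableSet {q : X × ℝ × E | q.2.1 ∉ Icc (0 : ℝ) 1} :=
    (measurableSet_Icc.preimage (measurable_fst.comp measurable_snd)).compl
  have hD'm : MeasurableSet D' := hDm.union hcomp
  have hmD : m D'ᶜ = 0 := by
    rw [hm, Measure.map_apply hLm hD'm.compl, Measure.measure_prod_null (hLm hD'm.compl)]
    have h1 := (ae_restrict_iff' measurableSet_Icc).1 hZD
    filter_upwards [ae_restrict_of_ae h1] with s hs
    by_cases hs1 : s ∈ Icc (0 : ℝ) 1
    · refine measure_mono_null ?_ (hs hs1)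
      intro ω hω hcon
      exact hω (Or.inl hcon)
    · refine measure_mono_null (t := ∅) ?_ measure_empty
      intro ω hω
      exact hω (Or.inr hs1)
  obtain ⟨Φ, w, M, hΦ, hw, hM, hbw, hΦint, hΦD⟩ := exists_gauge m
    (fun q : X × ℝ × E => b q.1 q.2.1 q.2.2) hb hbint D' hD'm hmD
  have hΦC : ∫⁻ s in Ioc (-1 : ℝ) 1, ∫⁻ ω, Φ (ζ ω, s, drivenPath Z₀ V s ω) ∂P ≤ ∫⁻ q, Φ q ∂m := by
    have h0 : Measurable fun q : ℝ × Ω => Φ (L q) := hΦ.measurable.comp hLm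
    rw [hm, lintegral_map hΦ.measurable hLm, lintegral_prod _ h0.aemeasurable]
  -- the approximations
  have happ := fun n : ℕ => hD.exists_approx hb hb0 Φ hΦ.measurable _ hΦint hΦC ((1 / 2) ^ n)
    (by positivity)
  choose σ ξ hσ hξ hσn hgauge hres hlaw using happ
  have hpow : Tendsto (fun n : ℕ => (1 / 2 : ℝ) ^ n) atTop (𝓝 0) :=
    tendsto_pow_atTop_nhds_zero_of_lt_one (by norm_num) (by norm_num)
  have hσlim : ∀ s ∈ Icc (0 : ℝ) 1, Tendsto (fun n => σ n s) atTop (𝓝 s) := by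
    intro s hs
    rw [tendsto_iff_dist_tendsto_zero]
    exact squeeze_zero (fun _ => dist_nonneg) (fun n => hσn n s hs) hpow
  have hξt : ∀ n t, Measurable (ξ n t) := fun n t =>
    (hξ n).comp (measurable_const.prodMk measurable_id)
  have hcm : ∀ n, Measurable fun p : (X × E) × (ℕ → unitInterval) =>
      ∫⁻ s in Icc (0 : ℝ) 1, Φ (p.1.1, σ n s, ξ n s p) := by
    intro n
    have : Measurable fun q : ((X × E) × (ℕ → unitInterval)) × ℝ =>
        Φ (q.1.1.1, σ n q.2, ξ n q.2 q.1) :=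
      hΦ.measurable.comp ((measurable_fst.comp (measurable_fst.comp measurable_fst)).prodMk
        (((hσ n).comp measurable_snd).prodMk ((hξ n).comp measurable_swap)))
    exact this.lintegral_prod_right'
  refine ⟨fun n => ξ n t, fun n p => ∫⁻ s in Icc (0 : ℝ) 1, Φ (p.1.1, σ n s, ξ n s p),
    (∫⁻ q, Φ q ∂m) + 1, by simp [hΦint], fun n => hξt n t, hcm, hgauge, ?_, ?_⟩
  · refine ae_exists_subseq_tendsto_solution (measurable_fst.comp measurable_fst)
      (measurable_snd.comp measurable_fst) b hb D Φ hΦ w hw M hM hbw ?_ σ ξ hσ hξ hσlim ?_ t ht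
    · intro x s hs y hy
      refine hΦD _ ?_
      rintro (h | h)
      · exact hy h
      · exact h hs
    · intro n u hu
      refine (hres n u hu).trans (le_of_eq ?_)
      rw [ENNReal.ofReal_pow (by norm_num), one_div, ENNReal.ofReal_inv_of_pos (by norm_num)]
      simp
  · intro f
    have hf : Measurable f := f.continuous.measurable
    have h1 : ∀ n, ∫ p, f (p.1.1, ξ n t p) ∂((P.map fun ω => (ζ ω, Z₀ ω)).prod uniformNoise) =
        ∫ ω, f (ζ ω, drivenPath Z₀ V (σ n t) ω) ∂P := by
      intro n
      have hx : Measurable fun p : (X × E) × (ℕ → unitInterval) => (p.1.1, ξ n t p) :=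
        (measurable_fst.comp measurable_fst).prodMk (hξt n t)
      have hy : Measurable fun ω => (ζ ω, drivenPath Z₀ V (σ n t) ω) := hζ.prodMk (hpaths _)
      rw [← integral_map hx.aemeasurable hf.aestronglyMeasurable, hlaw n t ht,
        integral_map hy.aemeasurable hf.aestronglyMeasurable]
    simp_rw [h1]
    refine tendsto_integral_of_dominated_convergence (fun _ => ‖f‖)
      (fun n => (hf.comp (hζ.prodMk (hpaths _))).aestronglyMeasurable) (integrable_const _)
      (fun n => ae_of_all _ fun ω => f.norm_coe_le_norm _) ?_
    -- The marginals of the approximations are those of the process at the grid times `σ n t`;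
    -- continuity of the paths moves them to `t`.
    filter_upwards [hD.integrable.prod_left_ae] with ω hω
    refine (f.continuous.tendsto _).comp (tendsto_const_nhds.prodMk_nhds ?_)
    exact ((continuous_drivenPath (Z₀ := Z₀) hω).tendsto t).comp (hσlim t ht)

/-- Two sequences of random vectors whose subsequential limits are values of the same deterministic
solutions have the same limit law. -/
lemma eq_of_tendsto_solution [TopologicalSpace X] [PolishSpace X] [BorelSpace X]
    {S : Type*} [MeasurableSpace S] {μ : Measure S} [IsFiniteMeasure μ] {ζ : S → X}
    (hζ : Measurable ζ) (good : S → E → Prop) (A A' : ℕ → S → E) (c c' : ℕ → S → ℝ≥0∞)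
    (K K' : ℝ≥0∞) (hK : K ≠ ∞) (hK' : K' ≠ ∞)
    (hA : ∀ n, Measurable (A n)) (hA' : ∀ n, Measurable (A' n))
    (hc : ∀ n, Measurable (c n)) (hc' : ∀ n, Measurable (c' n))
    (hcK : ∀ n, ∫⁻ p, c n p ∂μ ≤ K) (hcK' : ∀ n, ∫⁻ p, c' n p ∂μ ≤ K')
    (hlim : ∀ᵐ p ∂μ, ∀ C : ℝ≥0∞, C ≠ ∞ → ∀ φ : ℕ → ℕ, StrictMono φ → (∀ n, c (φ n) p ≤ C) →
      ∃ (ψ : ℕ → ℕ) (y : E), StrictMono ψ ∧ good p y ∧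
        Tendsto (fun n => A (φ (ψ n)) p) atTop (𝓝 y))
    (hlim' : ∀ᵐ p ∂μ, ∀ C : ℝ≥0∞, C ≠ ∞ → ∀ φ : ℕ → ℕ, StrictMono φ → (∀ n, c' (φ n) p ≤ C) →
      ∃ (ψ : ℕ → ℕ) (y : E), StrictMono ψ ∧ good p y ∧
        Tendsto (fun n => A' (φ (ψ n)) p) atTop (𝓝 y))
    (hgood : ∀ᵐ p ∂μ, ∀ y y', good p y → good p y' → y = y')
    (ν ν' : Measure (X × E)) [IsFiniteMeasure ν] [IsFiniteMeasure ν']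
    (hν : ∀ f : BoundedContinuousFunction (X × E) ℝ,
      Tendsto (fun n => ∫ p, f (ζ p, A n p) ∂μ) atTop (𝓝 (∫ q, f q ∂ν)))
    (hν' : ∀ f : BoundedContinuousFunction (X × E) ℝ,
      Tendsto (fun n => ∫ p, f (ζ p, A' n p) ∂μ) atTop (𝓝 (∫ q, f q ∂ν'))) : ν = ν' := by
  refine ext_of_forall_integral_eq_of_IsFiniteMeasure fun f => ?_
  have hf : Measurable f := f.continuous.measurable
  have hfA : ∀ n, Measurable fun p => f (ζ p, A n p) := fun n => hf.comp (hζ.prodMk (hA n))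
  have hfA' : ∀ n, Measurable fun p => f (ζ p, A' n p) := fun n => hf.comp (hζ.prodMk (hA' n))
  have hd : Tendsto (fun n => ∫⁻ p, ‖f (ζ p, A n p) - f (ζ p, A' n p)‖ₑ ∂μ) atTop (𝓝 0) := by
    refine tendsto_lintegral_zero_of_subseq
      (fun n p => ‖f (ζ p, A n p) - f (ζ p, A' n p)‖ₑ) (fun n => ((hfA n).sub (hfA' n)).enorm)
      (ENNReal.ofReal (‖f‖ + ‖f‖)) ofReal_ne_top (fun n p => ?_) (fun n p => c n p + c' n p)
      (fun n => (hc n).add (hc' n)) (K + K') (by simp [hK, hK']) (fun n => ?_) ?_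
    · rw [← ofReal_norm]
      exact ENNReal.ofReal_le_ofReal ((norm_sub_le _ _).trans (add_le_add (f.norm_coe_le_norm _)
        (f.norm_coe_le_norm _)))
    · rw [lintegral_add_left (hc n)]
      exact add_le_add (hcK n) (hcK' n)
    · filter_upwards [hlim, hlim', hgood] with p h1 h2 h3 C hC φ hφ hle
      -- A bound on `c + c'` bounds both gauges. Extracting for `A` and then for `A'` gives two good
      -- limits at the same `p`, which must coincide.
      obtain ⟨ψ, y, hψ, hy, hlimy⟩ := h1 C hC φ hφ fun n => le_self_add.trans (hle n)
      obtain ⟨ψ', y', hψ', hy', hlimy'⟩ := h2 C hC (φ ∘ ψ) (hφ.comp hψ) fun n =>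
        le_add_self.trans (hle (ψ n))
      obtain rfl := h3 y y' hy hy'
      refine ⟨ψ ∘ ψ', hψ.comp hψ', ?_⟩
      rw [← tendsto_zero_iff_enorm_tendsto_zero (f := fun n =>
        f (ζ p, A (φ ((ψ ∘ ψ') n)) p) - f (ζ p, A' (φ ((ψ ∘ ψ') n)) p))]
      rw [← _root_.sub_self (f (ζ p, y))]
      refine Tendsto.sub ?_ ?_
      · exact (f.continuous.tendsto _).comp (tendsto_const_nhds.prodMk_nhds
          (hlimy.comp hψ'.tendsto_atTop))
      · exact (f.continuous.tendsto _).comp (tendsto_const_nhds.prodMk_nhds hlimy')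
  have hi : ∀ n, Integrable (fun p => f (ζ p, A n p)) μ := fun n =>
    Integrable.of_bound (hfA n).aestronglyMeasurable ‖f‖ (ae_of_all _ fun p => f.norm_coe_le_norm _)
  have hi' : ∀ n, Integrable (fun p => f (ζ p, A' n p)) μ := fun n =>
    Integrable.of_bound (hfA' n).aestronglyMeasurable ‖f‖ (ae_of_all _ fun p => f.norm_coe_le_norm _)
  have h0 : Tendsto (fun n => (∫ p, f (ζ p, A n p) ∂μ) - ∫ p, f (ζ p, A' n p) ∂μ) atTop (𝓝 0) := by
    rw [tendsto_zero_iff_enorm_tendsto_zero]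
    refine tendsto_of_tendsto_of_tendsto_of_le_of_le tendsto_const_nhds hd (fun n => zero_le)
      fun n => ?_
    rw [← integral_sub (hi n) (hi' n)]
    exact enorm_integral_le_lintegral_enorm _
  have := tendsto_nhds_unique h0 ((hν f).sub (hν' f))
  linarith

/-- Solutions of `γ' = b s γ` which stay in `D` are determined by their starting point. -/
def HasUniqueSolutionFrom {E : Type*} [NormedAddCommGroup E] [NormedSpace ℝ E] (b : ℝ → E → E)
    (D : Set (ℝ × E)) (x₀ : E) : Prop :=
  ∀ γ γ', IsSolutionFrom b D x₀ γ → IsSolutionFrom b D x₀ γ' →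
    ∀ t ∈ Icc (0 : ℝ) 1, γ t = γ' t

/-- Two processes which follow the same field on average, from the same initial law, have the same
marginals, if the solutions of the field are unique. -/
theorem IsDriven.map_eq_map [TopologicalSpace X] [PolishSpace X] [BorelSpace X]
    {Ω' : Type*} [MeasurableSpace Ω'] {P : Measure Ω} [IsFiniteMeasure P] {P' : Measure Ω'}
    [IsFiniteMeasure P'] {ζ : Ω → X} {ζ' : Ω' → X} {Z₀ : Ω → E} {Z₀' : Ω' → E}
    {V : ℝ → Ω → E} {V' : ℝ → Ω' → E} {b : X → ℝ → E → E} (h : IsDriven P ζ Z₀ V b)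
    (h' : IsDriven P' ζ' Z₀' V' b) (hb : Measurable fun q : X × ℝ × E => b q.1 q.2.1 q.2.2)
    (hb0 : ∀ x, ∀ s < 0, ∀ y, b x s y = 0) (D : Set (X × ℝ × E)) (hDm : MeasurableSet D)
    (hZD : ∀ᵐ s ∂(volume.restrict (Icc (0 : ℝ) 1)), ∀ᵐ ω ∂P, (ζ ω, s, drivenPath Z₀ V s ω) ∈ D)
    (hZD' : ∀ᵐ s ∂(volume.restrict (Icc (0 : ℝ) 1)), ∀ᵐ ω ∂P',
      (ζ' ω, s, drivenPath Z₀' V' s ω) ∈ D)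
    (hinit : P.map (fun ω => (ζ ω, Z₀ ω)) = P'.map (fun ω => (ζ' ω, Z₀' ω)))
    (huniq : ∀ᵐ p ∂(P.map fun ω => (ζ ω, Z₀ ω)),
      HasUniqueSolutionFrom (b p.1) {q | (p.1, q.1, q.2) ∈ D} p.2)
    (t : ℝ) (ht : t ∈ Icc (0 : ℝ) 1) :
    P.map (fun ω => (ζ ω, drivenPath Z₀ V t ω)) =
      P'.map (fun ω => (ζ' ω, drivenPath Z₀' V' t ω)) := by
  obtain ⟨A, c, K, hK, hA, hc, hcK, hlim, hf⟩ := h.exists_tendsto_solution hb hb0 D hDm hZD t ht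
  obtain ⟨A', c', K', hK', hA', hc', hcK', hlim', hf'⟩ :=
    h'.exists_tendsto_solution hb hb0 D hDm hZD' t ht
  -- With equal initial laws both approximations live on one space with the same parameter and
  -- starting point, so uniqueness can be used pointwise.
  rw [← hinit] at hcK' hlim' hf'
  have hm : Measurable fun ω => (ζ ω, drivenPath Z₀ V t ω) := h.measurable_param.prodMk
    ((measurable_drivenPath h.measurable_start h.stronglyMeasurable).comp
      (measurable_const.prodMk measurable_id))
  have hm' : Measurable fun ω => (ζ' ω, drivenPath Z₀' V' t ω) := h'.measurable_param.prodMk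
    ((measurable_drivenPath h'.measurable_start h'.stronglyMeasurable).comp
      (measurable_const.prodMk measurable_id))
  refine eq_of_tendsto_solution (ζ := fun p : (X × E) × (ℕ → unitInterval) => p.1.1)
    (measurable_fst.comp measurable_fst)
    (fun p y => ∃ γ, IsSolutionFrom (b p.1.1) {q | (p.1.1, q.1, q.2) ∈ D} p.1.2 γ ∧ y = γ t)
    A A' c c' K K' hK hK' hA hA' hc hc' hcK hcK' ?_ ?_ ?_ _ _ ?_ ?_
  · filter_upwards [hlim] with p hp C hC φ hφ hle
    obtain ⟨ψ, γ, hψ, hγ, hl⟩ := hp C hC φ hφ hle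
    exact ⟨ψ, γ t, hψ, ⟨γ, hγ, rfl⟩, hl⟩
  · filter_upwards [hlim'] with p hp C hC φ hφ hle
    obtain ⟨ψ, γ, hψ, hγ, hl⟩ := hp C hC φ hφ hle
    exact ⟨ψ, γ t, hψ, ⟨γ, hγ, rfl⟩, hl⟩
  · have := Measure.quasiMeasurePreserving_fst (μ := P.map fun ω => (ζ ω, Z₀ ω))
      (ν := uniformNoise) |>.ae huniq
    filter_upwards [this] with p hp
    rintro y y' ⟨γ, hγ, rfl⟩ ⟨γ', hγ', rfl⟩
    exact hp γ γ' hγ hγ' t ht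
  · intro f
    rw [integral_map hm.aemeasurable f.continuous.measurable.aestronglyMeasurable]
    exact hf f
  · intro f
    rw [integral_map hm'.aemeasurable f.continuous.measurable.aestronglyMeasurable]
    exact hf' f

/-- A process which follows a field on average has the marginals of any random solution with the
same initial law, if the solutions of the field are unique. -/
theorem IsDriven.map_eq_map_of_isSolutionFrom [TopologicalSpace X] [PolishSpace X] [BorelSpace X]
    {Ω' : Type*} [MeasurableSpace Ω'] {P : Measure Ω} [IsFiniteMeasure P] {P' : Measure Ω'}
    [IsFiniteMeasure P'] {ζ : Ω → X} {ζ' : Ω' → X} {Z₀ : Ω → E} {Z₀' U : Ω' → E}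
    {V : ℝ → Ω → E} {b : X → ℝ → E → E} (h : IsDriven P ζ Z₀ V b)
    (hb : Measurable fun q : X × ℝ × E => b q.1 q.2.1 q.2.2)
    (hb0 : ∀ x, ∀ s < 0, ∀ y, b x s y = 0) (D : Set (X × ℝ × E)) (hDm : MeasurableSet D)
    (hZD : ∀ᵐ s ∂(volume.restrict (Icc (0 : ℝ) 1)), ∀ᵐ ω ∂P, (ζ ω, s, drivenPath Z₀ V s ω) ∈ D)
    (hζ' : Measurable ζ') (hZ₀' : Measurable Z₀') (hU : Measurable U)
    (hinit : P.map (fun ω => (ζ ω, Z₀ ω)) = P'.map (fun ω => (ζ' ω, Z₀' ω)))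
    (t : ℝ) (ht : t ∈ Icc (0 : ℝ) 1)
    (hsol : ∀ᵐ ω ∂P', ∃ γ,
      IsSolutionFrom (b (ζ' ω)) {q | (ζ' ω, q.1, q.2) ∈ D} (Z₀' ω) γ ∧ U ω = γ t)
    (huniq : ∀ᵐ p ∂(P.map fun ω => (ζ ω, Z₀ ω)),
      HasUniqueSolutionFrom (b p.1) {q | (p.1, q.1, q.2) ∈ D} p.2) :
    P.map (fun ω => (ζ ω, drivenPath Z₀ V t ω)) = P'.map (fun ω => (ζ' ω, U ω)) := by
  obtain ⟨A, c, K, hK, hA, hc, hcK, hlim, hf⟩ := h.exists_tendsto_solution hb hb0 D hDm hZD t ht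
  have hm : Measurable fun ω => (ζ ω, drivenPath Z₀ V t ω) := h.measurable_param.prodMk
    ((measurable_drivenPath h.measurable_start h.stronglyMeasurable).comp
      (measurable_const.prodMk measurable_id))
  have hi : Measurable fun ω => (ζ' ω, Z₀' ω) := hζ'.prodMk hZ₀'
  set T : Ω' × (ℕ → unitInterval) → (X × E) × (ℕ → unitInterval) :=
    Prod.map (fun ω => (ζ' ω, Z₀' ω)) id with hT
  have hTm : Measurable T := hi.prodMap measurable_id
  have hTmap : (P'.prod uniformNoise).map T = (P.map fun ω => (ζ ω, Z₀ ω)).prod uniformNoise := by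
    rw [hinit, hT, ← Measure.map_prod_map _ _ hi measurable_id, Measure.map_id]
  rw [← hTmap] at hcK hlim hf
  have hfst := Measure.quasiMeasurePreserving_fst (μ := P') (ν := uniformNoise)
  -- The approximations are pulled back to the space carrying the given solution. That solution
  -- enters as a constant sequence with gauge `0`, so it need not be measurable in time.
  refine eq_of_tendsto_solution (μ := P'.prod uniformNoise) (ζ := fun p => ζ' p.1)
    (hζ'.comp measurable_fst)
    (fun p y => ∃ γ, IsSolutionFrom (b (ζ' p.1)) {q | (ζ' p.1, q.1, q.2) ∈ D} (Z₀' p.1) γ ∧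
      y = γ t)
    (fun n p => A n (T p)) (fun _ p => U p.1) (fun n p => c n (T p)) (fun _ _ => 0) K 0 hK (by simp)
    (fun n => (hA n).comp hTm) (fun _ => hU.comp measurable_fst) (fun n => (hc n).comp hTm)
    (fun _ => measurable_const) (fun n => ?_) (by simp) ?_ ?_ ?_ _ _ ?_ ?_
  · rw [← lintegral_map (hc n) hTm]
    exact hcK n
  · filter_upwards [ae_of_ae_map hTm.aemeasurable hlim] with p hp C hC φ hφ hle
    obtain ⟨ψ, γ, hψ, hγ, hl⟩ := hp C hC φ hφ hle
    exact ⟨ψ, γ t, hψ, ⟨γ, hγ, rfl⟩, hl⟩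
  · filter_upwards [hfst.ae hsol] with p hp C hC φ hφ hle
    exact ⟨id, U p.1, strictMono_id, hp, tendsto_const_nhds⟩
  · rw [hinit] at huniq
    filter_upwards [hfst.ae (ae_of_ae_map hi.aemeasurable huniq)] with p hp
    rintro y y' ⟨γ, hγ, rfl⟩ ⟨γ', hγ', rfl⟩
    exact hp γ γ' hγ hγ' t ht
  · intro f
    rw [integral_map hm.aemeasurable f.continuous.measurable.aestronglyMeasurable]
    have hfm : ∀ n, Measurable fun p : (X × E) × (ℕ → unitInterval) => f (p.1.1, A n p) := fun n =>
      f.continuous.measurable.comp ((measurable_fst.comp measurable_fst).prodMk (hA n))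
    exact (hf f).congr fun n => integral_map hTm.aemeasurable (hfm n).aestronglyMeasurable
  · intro f
    have hm2 : Measurable fun ω => (ζ' ω, U ω) := hζ'.prodMk hU
    have hm3 : Measurable fun ω => f (ζ' ω, U ω) := f.continuous.measurable.comp hm2
    rw [integral_map hm2.aemeasurable f.continuous.measurable.aestronglyMeasurable]
    have h1 : ∫ p, f (ζ' p.1, U p.1) ∂(P'.prod uniformNoise) = ∫ ω, f (ζ' ω, U ω) ∂P' := by
      rw [integral_fun_fst (fun ω => f (ζ' ω, U ω))]
      rw [probReal_univ, one_smul]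
    rw [h1]
    exact tendsto_const_nhds

end Marginals

/-! ### Fields cut off outside the unit time interval -/

section CutoffField

variable {d : ℕ}

/-- Only times in `[0, 1]` enter the equation, so the cutoff needed for grids starting before `0`
changes no solution. -/
lemma isSolutionFrom_indicator_iff
    {b : ℝ → EuclideanSpace ℝ (Fin d) → EuclideanSpace ℝ (Fin d)}
    {D : Set (ℝ × EuclideanSpace ℝ (Fin d))} {x₀ : EuclideanSpace ℝ (Fin d)}
    {γ : ℝ → EuclideanSpace ℝ (Fin d)} :
    IsSolutionFrom ((Icc (0 : ℝ) 1).indicator b) D x₀ γ ↔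
      SolvesODE b γ ∧ (∀ᵐ s ∂(volume.restrict (Icc (0 : ℝ) 1)), (s, γ s) ∈ D) ∧ γ 0 = x₀ := by
  have h1 : ∀ s ∈ Icc (0 : ℝ) 1, (Icc (0 : ℝ) 1).indicator b s (γ s) = b s (γ s) := fun s hs => by
    rw [indicator_of_mem hs]
  have hint : IntervalIntegrable (fun s => (Icc (0 : ℝ) 1).indicator b s (γ s)) volume 0 1 ↔
      IntervalIntegrable (fun s => b s (γ s)) volume 0 1 := by
    refine intervalIntegrable_congr fun s hs => ?_
    rw [uIoc_of_le zero_le_one] at hs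
    exact h1 s (Ioc_subset_Icc_self hs)
  have heq : ∀ t ∈ Icc (0 : ℝ) 1,
      ∫ s in (0 : ℝ)..t, (Icc (0 : ℝ) 1).indicator b s (γ s) = ∫ s in (0 : ℝ)..t, b s (γ s) := by
    intro t ht
    refine intervalIntegral.integral_congr fun s hs => ?_
    rw [uIcc_of_le ht.1] at hs
    exact h1 s ⟨hs.1, hs.2.trans ht.2⟩
  constructor
  · rintro ⟨ha, hb, hc⟩
    have h0 : γ 0 = x₀ := by simpa using hb 0 ⟨le_rfl, zero_le_one⟩
    refine ⟨⟨hint.1 ha, fun t ht => ?_⟩, hc, h0⟩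
    rw [h0, hb t ht, heq t ht]
  · rintro ⟨⟨ha, hb⟩, hc, h0⟩
    refine ⟨hint.2 ha, fun t ht => ?_, hc⟩
    rw [hb t ht, h0, heq t ht]

lemma UniqueODEFrom.hasUniqueSolutionFrom
    {b : ℝ → EuclideanSpace ℝ (Fin d) → EuclideanSpace ℝ (Fin d)}
    {D : Set (ℝ × EuclideanSpace ℝ (Fin d))} {x₀ : EuclideanSpace ℝ (Fin d)}
    (h : UniqueODEFrom b D x₀) : HasUniqueSolutionFrom ((Icc (0 : ℝ) 1).indicator b) D x₀ := by
  intro γ γ' hγ hγ'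
  rw [isSolutionFrom_indicator_iff] at hγ hγ'
  exact h γ γ' hγ.1 hγ'.1 hγ.2.1 hγ'.2.1 hγ.2.2 hγ'.2.2

end CutoffField

/-! ### Conditional means as drifts -/

section Drift

lemma measurable_indicator_field {X E : Type*} [MeasurableSpace X] [Zero E] [MeasurableSpace E]
    {b : ℝ → E → E} (hb : Measurable (Function.uncurry b)) :
    Measurable fun q : X × ℝ × E => (Icc (0 : ℝ) 1).indicator b q.2.1 q.2.2 := by
  have h : (fun q : X × ℝ × E => (Icc (0 : ℝ) 1).indicator b q.2.1 q.2.2) =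
      ((fun q : X × ℝ × E => q.2.1) ⁻¹' Icc (0 : ℝ) 1).indicator fun q => b q.2.1 q.2.2 := by
    funext q
    by_cases hq : q.2.1 ∈ Icc (0 : ℝ) 1
    · rw [indicator_of_mem hq, indicator_of_mem (by exact hq)]
    · rw [indicator_of_notMem hq, indicator_of_notMem (by exact hq), Pi.zero_apply]
  rw [h]
  exact (hb.comp measurable_snd).indicator
    ((measurable_fst.comp measurable_snd) measurableSet_Icc)

variable {Ω E : Type*} [MeasurableSpace Ω]
  [NormedAddCommGroup E] [InnerProductSpace ℝ E] [FiniteDimensional ℝ E]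
  [MeasurableSpace E] [BorelSpace E]

/-- If `κ` is the conditional distribution of `W` given `Y`, then the conditional mean of `W` given
`Y` is the mean of `κ` at `Y`. -/
lemma condExp_comap_ae_eq_integral_kernel {P : Measure Ω} [IsFiniteMeasure P] {Y W : Ω → E}
    (hY : Measurable Y) (hW : Integrable W P) {κ : Kernel E E} [IsFiniteKernel κ]
    (h : P.map (fun ω => (Y ω, W ω)) = P.map Y ⊗ₘ κ) :
    (fun ω => ∫ v, v ∂κ (Y ω)) =ᵐ[P] P[W | MeasurableSpace.comap Y inferInstance] := by
  have h1 := condExp_ae_eq_integral_condDistrib' hY hW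
  have h2 := ae_of_ae_map hY.aemeasurable
    (condDistrib_ae_eq_of_measure_eq_compProd Y hW.1.aemeasurable h)
  filter_upwards [h1, h2] with ω ha hb
  rw [ha, hb]

/-- A trivial parameter adds nothing to the conditioning σ-algebra, and outside `[0, 1]` both the
velocity and the field vanish. -/
lemma isDriven_unit {P : Measure Ω} [IsFiniteMeasure P] {Z₀ : Ω → E} {V : ℝ → Ω → E}
    {b : ℝ → E → E} (hZ₀ : Measurable Z₀) (hV : StronglyMeasurable (Function.uncurry V))
    (hVi : Integrable (Function.uncurry V) (volume.prod P))
    (hV0 : ∀ s ∉ Icc (0 : ℝ) 1, ∀ ω, V s ω = 0)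
    (hdrift : ∀ᵐ s ∂(volume.restrict (Icc (0 : ℝ) 1)),
      (fun ω => b s (drivenPath Z₀ V s ω)) =ᵐ[P]
        P[V s | MeasurableSpace.comap (drivenPath Z₀ V s) inferInstance]) :
    IsDriven P (fun _ => ()) Z₀ V (fun _ => (Icc (0 : ℝ) 1).indicator b) where
  measurable_param := measurable_const
  measurable_start := hZ₀
  stronglyMeasurable := hV
  integrable := hVi
  eq_zero s hs := hV0 s fun h => absurd h.1 (not_le.2 hs)
  drift := by
    filter_upwards [(ae_restrict_iff' measurableSet_Icc).1 hdrift] with s hs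
    have hσ : MeasurableSpace.comap (fun ω => ((), drivenPath Z₀ V s ω)) inferInstance =
        MeasurableSpace.comap (drivenPath Z₀ V s) inferInstance :=
      (MeasurableSpace.comap_prodMk _ _).trans (by rw [MeasurableSpace.comap_const, bot_sup_eq])
    rw [hσ]
    by_cases h : s ∈ Icc (0 : ℝ) 1
    · rw [indicator_of_mem h]
      exact hs h
    · have hz : V s = 0 := funext (hV0 s h)
      rw [indicator_of_notMem h, hz, condExp_zero]
      rfl

end Drift

/-! ### Linear interpolation and the inner equation -/

section Interpolation

variable {d : ℕ}

lemma measurable_interp (t : ℝ) : Measurable (interp (d := d) t) := by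
  unfold interp
  fun_prop

/-- The velocity of `t ↦ interp t p`, cut off outside `[0, 1]`. -/
noncomputable def interpVelocity (t : ℝ) (p : EuclideanSpace ℝ (Fin d) × EuclideanSpace ℝ (Fin d)) :
    EuclideanSpace ℝ (Fin d) :=
  (Icc (0 : ℝ) 1).indicator (fun _ => p.2 - p.1) t

lemma drivenPath_interpVelocity {t : ℝ} (ht : t ∈ Icc (0 : ℝ) 1) :
    drivenPath Prod.fst (interpVelocity (d := d)) t = interp t := by
  funext p
  have h1 : Iic t ∩ Icc (0 : ℝ) 1 = Icc 0 t := by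
    ext r
    simp only [mem_inter_iff, mem_Iic, mem_Icc]
    exact ⟨fun h => ⟨h.2.1, h.1⟩, fun h => ⟨h.2, h.1, h.2.trans ht.2⟩⟩
  unfold drivenPath interpVelocity interp
  rw [setIntegral_indicator measurableSet_Icc, h1, setIntegral_const, Real.volume_real_Icc_of_le ht.1]
  module

/-- The path is straight with velocity `p.2 - p.1`, so the drift condition is exactly the defining
property of `b`; first moments make the velocity integrable. -/
lemma isDriven_interp {μ ν : Measure (EuclideanSpace ℝ (Fin d))} [IsProbabilityMeasure μ]
    [IsProbabilityMeasure ν] (hμ : Integrable id μ) (hν : Integrable id ν)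
    {b : ℝ → EuclideanSpace ℝ (Fin d) → EuclideanSpace ℝ (Fin d)}
    (hdrift : IsExpectedDrift μ ν b) :
    IsDriven (μ.prod ν) (fun _ => ()) Prod.fst interpVelocity
      (fun _ => (Icc (0 : ℝ) 1).indicator b) := by
  have hm : Measurable (Function.uncurry (interpVelocity (d := d))) := by
    change Measurable fun q : ℝ × (EuclideanSpace ℝ (Fin d) × EuclideanSpace ℝ (Fin d)) =>
      (Prod.fst ⁻¹' Icc (0 : ℝ) 1).indicator (fun q => q.2.2 - q.2.1) q
    exact Measurable.indicator (by fun_prop) (measurable_fst measurableSet_Icc)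
  have hsub : Integrable (fun p : EuclideanSpace ℝ (Fin d) × EuclideanSpace ℝ (Fin d) =>
      p.2 - p.1) (μ.prod ν) := (hν.comp_snd μ).sub (hμ.comp_fst ν)
  refine isDriven_unit measurable_fst hm.stronglyMeasurable ?_
    (fun s hs p => indicator_of_notMem hs _) ?_
  · change Integrable (fun q : ℝ × (EuclideanSpace ℝ (Fin d) × EuclideanSpace ℝ (Fin d)) =>
      (Prod.fst ⁻¹' Icc (0 : ℝ) 1).indicator (fun q => q.2.2 - q.2.1) q) _
    rw [integrable_indicator_iff (measurable_fst measurableSet_Icc), IntegrableOn,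
      ← prod_univ, ← Measure.prod_restrict, Measure.restrict_univ]
    exact hsub.comp_snd _
  · filter_upwards [ae_restrict_mem measurableSet_Icc] with s hs
    have hV : interpVelocity s = fun p : EuclideanSpace ℝ (Fin d) × EuclideanSpace ℝ (Fin d) =>
        p.2 - p.1 := funext fun p => indicator_of_mem hs _
    rw [drivenPath_interpVelocity hs, hV]
    exact hdrift s hs

/-- The equation `u' = b τ u`, where `b` is the expected drift of the interpolation between `π₀` and
`π`, turns `π₀` into `π`. -/
theorem map_eq_of_solvesODE {π₀ π : Measure (EuclideanSpace ℝ (Fin d))} [IsProbabilityMeasure π₀]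
    [IsProbabilityMeasure π] (hπ₀ : Integrable id π₀) (hπ : Integrable id π)
    {b : ℝ → EuclideanSpace ℝ (Fin d) → EuclideanSpace ℝ (Fin d)}
    (hb : Measurable (Function.uncurry b)) (hdrift : IsExpectedDrift π₀ π b)
    (huniq : ∀ᵐ u ∂π₀, UniqueODEFrom b univ u) {Ω : Type*} [MeasurableSpace Ω] {P : Measure Ω}
    [IsProbabilityMeasure P] {U : ℝ → Ω → EuclideanSpace ℝ (Fin d)} (hU0 : Measurable (U 0))
    (hU1 : Measurable (U 1)) (hinit : P.map (U 0) = π₀)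
    (hode : ∀ᵐ ω ∂P, SolvesODE b (fun τ => U τ ω)) : P.map (U 1) = π := by
  have h1 : (1 : ℝ) ∈ Icc (0 : ℝ) 1 := ⟨zero_le_one, le_rfl⟩
  have hfst : (π₀.prod π).map Prod.fst = π₀ := by
    rw [Measure.map_fst_prod, measure_univ, one_smul]
  have hb' : Measurable fun q : Unit × ℝ × EuclideanSpace ℝ (Fin d) =>
      (Icc (0 : ℝ) 1).indicator b q.2.1 q.2.2 := measurable_indicator_field hb
  have key := (isDriven_interp hπ₀ hπ hdrift).map_eq_map_of_isSolutionFrom (P' := P)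
    (ζ' := fun _ => ()) (Z₀' := U 0) (U := U 1) hb' (fun _ s hs y => by
      rw [indicator_of_notMem fun h => absurd h.1 (not_le.2 hs), Pi.zero_apply]) univ
    MeasurableSet.univ (by simp) measurable_const hU0 hU1 ?_ 1 h1 ?_ ?_
  · rw [drivenPath_interpVelocity h1] at key
    have h2 := congrArg (Measure.map Prod.snd) key
    rw [Measure.map_map measurable_snd (measurable_const.prodMk (measurable_interp 1)),
      Measure.map_map measurable_snd (measurable_const.prodMk hU1)] at h2
    change (π₀.prod π).map (interp 1) = P.map (U 1) at h2
    have h3 : interp (d := d) 1 = Prod.snd := by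
      funext p
      simp [interp]
    rw [← h2, h3, Measure.map_snd_prod, measure_univ, one_smul]
  · have e1 := Measure.map_map (μ := π₀.prod π) (f := Prod.fst)
      (g := fun u : EuclideanSpace ℝ (Fin d) => ((), u)) (by fun_prop) measurable_fst
    have e2 := Measure.map_map (μ := P) (f := U 0)
      (g := fun u : EuclideanSpace ℝ (Fin d) => ((), u)) (by fun_prop) hU0
    rw [hfst] at e1
    rw [hinit] at e2
    exact e1.symm.trans e2
  · filter_upwards [hode] with ω hω
    refine ⟨fun τ => U τ ω, isSolutionFrom_indicator_iff.2 ⟨hω, ?_, rfl⟩, rfl⟩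
    exact ae_of_all _ fun _ => mem_univ _
  · have e1 : ((π₀.prod π).map fun p : EuclideanSpace ℝ (Fin d) × EuclideanSpace ℝ (Fin d) =>
        ((), p.1)).map Prod.snd = π₀ := by
      rw [Measure.map_map measurable_snd (by fun_prop)]
      exact hfst
    rw [← e1] at huniq
    filter_upwards [ae_of_ae_map measurable_snd.aemeasurable huniq] with p hp
    exact hp.hasUniqueSolutionFrom

end Interpolation

/-! ### Continuous paths encoded by their values at rational times -/

section RationalPaths

variable {E : Type*} [NormedAddCommGroup E] [InnerProductSpace ℝ E] [FiniteDimensional ℝ E]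
  [MeasurableSpace E] [BorelSpace E]

/-- The largest multiple of `1 / (n + 1)` below `t`, as a rational number. -/
noncomputable def ratFloor (n : ℕ) (t : ℝ) : ℚ := ⌊t * (n + 1)⌋₊ / (n + 1)

lemma measurable_ratFloor (n : ℕ) : Measurable (ratFloor n) := by
  have h : Measurable fun k : ℕ => (k / (n + 1) : ℚ) := measurable_from_nat
  exact h.comp (Nat.measurable_floor.comp (by fun_prop))

lemma ratFloor_mem_Icc {n : ℕ} {t : ℝ} (ht : t ∈ Icc (0 : ℝ) 1) :
    (ratFloor n t : ℝ) ∈ Icc (0 : ℝ) t := by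
  have hn : (0 : ℝ) < n + 1 := by positivity
  unfold ratFloor
  push_cast
  refine ⟨by positivity, ?_⟩
  rw [div_le_iff₀ hn]
  exact Nat.floor_le (mul_nonneg ht.1 hn.le)

lemma tendsto_ratFloor {t : ℝ} (ht : t ∈ Icc (0 : ℝ) 1) :
    Tendsto (fun n => (ratFloor n t : ℝ)) atTop (𝓝 t) := by
  have h1 : Tendsto (fun n : ℕ => t - 1 / ((n : ℝ) + 1)) atTop (𝓝 t) := by
    simpa using tendsto_const_nhds.sub (tendsto_one_div_add_atTop_nhds_zero_nat (𝕜 := ℝ))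
  refine tendsto_of_tendsto_of_tendsto_of_le_of_le h1 tendsto_const_nhds (fun n => ?_)
    fun n => (ratFloor_mem_Icc ht).2
  have hn : (0 : ℝ) < n + 1 := by positivity
  unfold ratFloor
  push_cast
  rw [le_div_iff₀ hn, sub_mul, one_div, inv_mul_cancel₀ hn.ne']
  linarith [Nat.lt_floor_add_one (t * (n + 1))]

/-- The path with the values `w` at the rational times. -/
noncomputable def ratPath (t : ℝ) (w : ℚ → E) : E :=
  limUnder atTop fun n => w (ratFloor n t)

lemma measurable_ratPath : Measurable (Function.uncurry (ratPath (E := E))) := by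
  have h : ∀ n : ℕ, StronglyMeasurable fun q : ℝ × (ℚ → E) => q.2 (ratFloor n q.1) := by
    intro n
    have h1 : Measurable fun q : (ℚ → E) × ℚ => q.1 q.2 :=
      measurable_from_prod_countable_left fun r => measurable_pi_apply r
    exact (h1.comp (measurable_snd.prodMk
      ((measurable_ratFloor n).comp measurable_fst))).stronglyMeasurable
  exact (StronglyMeasurable.limUnder h).measurable

/-- Approximation from below by rationals of `[0, 1]` recovers a continuous path, so a countable
family of values, a point of a standard Borel space, carries the whole path. -/
lemma ratPath_eq {γ : ℝ → E} {w : ℚ → E} (hγ : ContinuousOn γ (Icc 0 1))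
    (h : ∀ r : ℚ, (r : ℝ) ∈ Icc (0 : ℝ) 1 → w r = γ r) {t : ℝ} (ht : t ∈ Icc (0 : ℝ) 1) :
    ratPath t w = γ t := by
  refine Tendsto.limUnder_eq ?_
  have hm : ∀ n, (ratFloor n t : ℝ) ∈ Icc (0 : ℝ) 1 := fun n =>
    ⟨(ratFloor_mem_Icc ht).1, (ratFloor_mem_Icc ht).2.trans ht.2⟩
  simp_rw [fun n => h _ (hm n)]
  exact (hγ t ht).tendsto.comp (tendsto_nhdsWithin_iff.2
    ⟨tendsto_ratFloor ht, Eventually.of_forall hm⟩)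

end RationalPaths

/-! ### The inner equation at a random location -/

section RandomLocation

variable {d : ℕ}

lemma SolvesODE.continuousOn {b : ℝ → EuclideanSpace ℝ (Fin d) → EuclideanSpace ℝ (Fin d)}
    {γ : ℝ → EuclideanSpace ℝ (Fin d)} (h : SolvesODE b γ) : ContinuousOn γ (Icc 0 1) := by
  have h1 : IntegrableOn (fun s => b s (γ s)) (uIcc 0 1) := by
    rw [uIcc_of_le zero_le_one]
    exact (intervalIntegrable_iff_integrableOn_Icc_of_le zero_le_one).1 h.1
  have h2 := intervalIntegral.continuousOn_primitive_interval h1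
  rw [uIcc_of_le zero_le_one] at h2
  exact (continuousOn_const.add h2).congr fun t ht => h.2 t ht

/-- Being the restriction to the rational times of a solution is a measurable condition. -/
lemma exists_measurableSet_solvesODE {X : Type*} [MeasurableSpace X]
    {b : X → ℝ → EuclideanSpace ℝ (Fin d) → EuclideanSpace ℝ (Fin d)}
    (hb : Measurable fun q : X × ℝ × EuclideanSpace ℝ (Fin d) => b q.1 q.2.1 q.2.2) :
    ∃ S : Set (X × (ℚ → EuclideanSpace ℝ (Fin d))), MeasurableSet S ∧
      (∀ p ∈ S, SolvesODE (b p.1) fun τ => ratPath τ p.2) ∧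
      ∀ x w γ, SolvesODE (b x) γ → (∀ r : ℚ, (r : ℝ) ∈ Icc (0 : ℝ) 1 → w r = γ r) →
        (x, w) ∈ S := by
  have hξ : Measurable (Function.uncurry fun (s : ℝ)
      (p : X × (ℚ → EuclideanSpace ℝ (Fin d))) => ratPath s p.2) :=
    measurable_ratPath.comp (measurable_fst.prodMk (measurable_snd.comp measurable_snd))
  have hI := measurable_integral_field hb
    (measurable_fst : Measurable (Prod.fst : X × (ℚ → EuclideanSpace ℝ (Fin d)) → X))
    measurable_id hξ
  have hF : StronglyMeasurable (Function.uncurry fun (p : X × (ℚ → EuclideanSpace ℝ (Fin d)))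
      (s : ℝ) => b p.1 s (ratPath s p.2)) :=
    (hb.comp ((measurable_fst.comp measurable_fst).prodMk
      (measurable_snd.prodMk (hξ.comp measurable_swap)))).stronglyMeasurable
  -- Imposing the integral equation only at rational times leaves countably many measurable
  -- conditions; continuity of the integral restores all times.
  set S : Set (X × (ℚ → EuclideanSpace ℝ (Fin d))) :=
    {p | Integrable (fun s => b p.1 s (ratPath s p.2)) (volume.restrict (Ioc 0 1))} ∩
    ⋂ r : ℚ, {p | (r : ℝ) ∈ Icc (0 : ℝ) 1 →
      p.2 r = p.2 0 + ∫ s in Ioc (0 : ℝ) r, b p.1 s (ratPath s p.2)} with hS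
  refine ⟨S, ?_, ?_, ?_⟩
  · rw [hS]
    refine MeasurableSet.inter (measurableSet_integrable hF) ?_
    refine MeasurableSet.iInter fun r => ?_
    by_cases hr : (r : ℝ) ∈ Icc (0 : ℝ) 1
    · simp only [hr, forall_const]
      refine measurableSet_eq_fun (by fun_prop) (Measurable.add (by fun_prop) ?_)
      exact hI.comp (measurable_id.prodMk measurable_const)
    · simp only [hr, false_imp_iff, ofPred_true, MeasurableSet.univ]
  · rintro ⟨x, w⟩ ⟨h1, h2⟩
    have hint : IntervalIntegrable (fun s => b x s (ratPath s w)) volume 0 1 :=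
      (intervalIntegrable_iff_integrableOn_Ioc_of_le zero_le_one).2 h1
    -- A continuous curve that agrees with `w` at the rational times of `[0, 1]`; hence `ratPath`
    -- reproduces it and inherits the equation at every time.
    set η : ℝ → EuclideanSpace ℝ (Fin d) := fun t =>
      w 0 + ∫ s in (0 : ℝ)..t, b x s (ratPath s w) with hη
    have hηc : ContinuousOn η (Icc 0 1) := by
      have h3 := intervalIntegral.continuousOn_primitive_interval (a := (0 : ℝ)) (b := 1)
        (μ := volume) (f := fun s => b x s (ratPath s w)) (by
          rw [uIcc_of_le zero_le_one]
          exact (intervalIntegrable_iff_integrableOn_Icc_of_le zero_le_one).1 hint)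
      rw [uIcc_of_le zero_le_one] at h3
      exact continuousOn_const.add h3
    have heq : ∀ t ∈ Icc (0 : ℝ) 1, ratPath t w = η t := fun t ht =>
      ratPath_eq hηc (fun r hr => by
        rw [hη]
        simp only
        rw [intervalIntegral.integral_of_le hr.1]
        exact mem_iInter.1 h2 r hr) ht
    refine ⟨hint, fun t ht => ?_⟩
    change ratPath t w = ratPath 0 w + _
    rw [heq t ht, heq 0 ⟨le_rfl, zero_le_one⟩]
    simp [hη]
  · intro x w γ hγ hw
    have heq : ∀ t ∈ Icc (0 : ℝ) 1, ratPath t w = γ t := fun t ht =>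
      ratPath_eq hγ.continuousOn hw ht
    have hIoc : ∀ t ∈ Icc (0 : ℝ) 1, EqOn (fun s => b x s (ratPath s w)) (fun s => b x s (γ s))
        (Ioc 0 t) := fun t ht s hs => by
      simp only
      rw [heq s ⟨hs.1.le, hs.2.trans ht.2⟩]
    refine ⟨?_, mem_iInter.2 fun r hr => ?_⟩
    · exact ((intervalIntegrable_iff_integrableOn_Ioc_of_le zero_le_one).1 hγ.1).congr_fun
        (hIoc 1 ⟨zero_le_one, le_rfl⟩).symm measurableSet_Ioc
    · have h0 : w 0 = γ 0 := by
        have := hw 0 (by simp)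
        simpa using this
      change w r = w 0 + _
      rw [hw r hr, h0, setIntegral_congr_fun measurableSet_Ioc (hIoc r hr),
        ← intervalIntegral.integral_of_le hr.1]
      exact hγ.2 r hr

/-- If the inner equation turns `π₀` into `κ x` at almost every location `x`, then, at a random
location `Y`, it produces a velocity with conditional distribution `κ` given `Y`. -/
theorem IsInnerFlow.map_prodMk_eq_compProd
    {π₀ : Measure (EuclideanSpace ℝ (Fin d))} [IsProbabilityMeasure π₀] (hπ₀ : Integrable id π₀)
    {κ : Kernel (EuclideanSpace ℝ (Fin d)) (EuclideanSpace ℝ (Fin d))} [IsMarkovKernel κ]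
    {a : EuclideanSpace ℝ (Fin d) → ℝ → EuclideanSpace ℝ (Fin d) → ℝ → EuclideanSpace ℝ (Fin d)}
    (ha_meas : Measurable
      (fun q : EuclideanSpace ℝ (Fin d) × ℝ × EuclideanSpace ℝ (Fin d) × ℝ =>
        a q.1 q.2.1 q.2.2.1 q.2.2.2))
    {Ω : Type*} [MeasurableSpace Ω] {P : Measure Ω} [IsProbabilityMeasure P] {t : ℝ}
    {Y : Ω → EuclideanSpace ℝ (Fin d)} {U : ℝ → Ω → EuclideanSpace ℝ (Fin d)} (hY : Measurable Y)
    (hκ : ∀ᵐ x ∂(P.map Y), Integrable id (κ x))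
    (hdrift : ∀ᵐ x ∂(P.map Y), IsExpectedDrift π₀ (κ x) (fun τ u => a x t u τ))
    (huniq : ∀ᵐ x ∂(P.map Y), ∀ᵐ u₀ ∂π₀, UniqueODEFrom (fun τ u => a x t u τ) univ u₀)
    (h : IsInnerFlow P π₀ a t Y U) :
    P.map (fun ω => (Y ω, U 1 ω)) = P.map Y ⊗ₘ κ := by
  have hb : Measurable fun q : EuclideanSpace ℝ (Fin d) × ℝ × EuclideanSpace ℝ (Fin d) =>
      a q.1 t q.2.2 q.2.1 :=
    ha_meas.comp (measurable_fst.prodMk (measurable_const.prodMk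
      ((measurable_snd.comp measurable_snd).prodMk (measurable_fst.comp measurable_snd))))
  have m0 : (0 : ℝ) ∈ Icc (0 : ℝ) 1 := ⟨le_rfl, zero_le_one⟩
  have m1 : (1 : ℝ) ∈ Icc (0 : ℝ) 1 := ⟨zero_le_one, le_rfl⟩
  obtain ⟨S, hSm, hS, hSmem⟩ := exists_measurableSet_solvesODE
    (b := fun x τ u => a x t u τ) hb
  -- Rationals outside `[0, 1]` are projected onto it, since `U τ` is known to be measurable only
  -- for `τ` in `[0, 1]`.
  set W : Ω → ℚ → EuclideanSpace ℝ (Fin d) := fun ω r => U (projIcc (0 : ℝ) 1 zero_le_one r) ω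
    with hW
  have hWm : Measurable W := measurable_pi_lambda _ fun r => h.measurable _ (Subtype.coe_prop _)
  have hWr : ∀ ω (r : ℚ), (r : ℝ) ∈ Icc (0 : ℝ) 1 → W ω r = U r ω := fun ω r hr => by
    simp only [hW, projIcc_of_mem zero_le_one hr]
  have hpm : ∀ τ, Measurable (ratPath (E := EuclideanSpace ℝ (Fin d)) τ) := fun τ =>
    measurable_ratPath.comp (measurable_const.prodMk measurable_id)
  have hpath : ∀ τ ∈ Icc (0 : ℝ) 1, U τ =ᵐ[P] ratPath τ ∘ W := by
    intro τ hτ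
    filter_upwards [h.ode] with ω hω
    exact (ratPath_eq hω.continuousOn (hWr ω) hτ).symm
  have hcond : ∀ τ ∈ Icc (0 : ℝ) 1,
      condDistrib (U τ) Y P =ᵐ[P.map Y] (condDistrib W Y P).map (ratPath τ) := by
    intro τ hτ
    rw [condDistrib_congr (hpath τ hτ) (ae_eq_refl Y)]
    exact condDistrib_comp Y hWm.aemeasurable (hpm τ)
  -- Independence of the initial velocity and the location: conditioning on `Y` leaves the law `π₀`
  -- unchanged.
  have hinit : condDistrib (U 0) Y P =ᵐ[P.map Y] Kernel.const _ π₀ := by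
    refine condDistrib_ae_eq_of_measure_eq_compProd Y (h.measurable 0 m0).aemeasurable ?_
    rw [Measure.compProd_const, h.indep.symm.map_prod_eq_prod_map_map hY.aemeasurable
      (h.measurable 0 m0).aemeasurable, h.initial]
  have hsol : ∀ᵐ x ∂(P.map Y), ∀ᵐ w ∂(condDistrib W Y P x),
      SolvesODE (fun τ u => a x t u τ) fun τ => ratPath τ w := by
    have h1 : ∀ᵐ p ∂(P.map fun ω => (Y ω, W ω)), p ∈ S := by
      refine (ae_map_iff (hY.prodMk hWm).aemeasurable hSm).2 ?_
      filter_upwards [h.ode] with ω hω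
      exact hSmem _ _ _ hω (hWr ω)
    rw [← compProd_map_condDistrib hWm.aemeasurable] at h1
    filter_upwards [Measure.ae_ae_of_ae_compProd h1] with x hx
    filter_upwards [hx] with w hw
    exact hS _ hw
  have hfin : condDistrib (U 1) Y P =ᵐ[P.map Y] κ := by
    filter_upwards [hcond 0 m0, hcond 1 m1, hinit, hsol, hκ, hdrift, huniq]
      with x h0 h1 h2 h3 h4 h5 h6
    rw [h1, Kernel.map_apply _ (hpm 1)]
    -- For fixed `x` the conditional law of the encoded path serves as probability space; on it the
    -- path is a random solution at the deterministic location `x`, with initial law `π₀`.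
    refine map_eq_of_solvesODE hπ₀ h4 (b := fun τ u => a x t u τ) ?_ h5 h6 (hpm 0) (hpm 1) ?_ h3
    · exact hb.comp (measurable_const.prodMk measurable_id)
    · rw [← Kernel.map_apply _ (hpm 0), ← h0, h2, Kernel.const_apply]
  rw [← compProd_map_condDistrib (h.measurable 1 m1).aemeasurable, Measure.compProd_congr hfin]

end RandomLocation

/-! ### The coupled equations and the marginals of the interpolation -/

section CoupledFlow

variable {d : ℕ} {ρ₀ ρ₁ π₀ : Measure (EuclideanSpace ℝ (Fin d))} [IsProbabilityMeasure ρ₀]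
  [IsProbabilityMeasure ρ₁] [IsProbabilityMeasure π₀]
  {D : Set (ℝ × EuclideanSpace ℝ (Fin d))}
  {π₁ : Kernel (ℝ × EuclideanSpace ℝ (Fin d)) (EuclideanSpace ℝ (Fin d))} [IsMarkovKernel π₁]
  {a : EuclideanSpace ℝ (Fin d) → ℝ → EuclideanSpace ℝ (Fin d) → ℝ → EuclideanSpace ℝ (Fin d)}
  {Ω : Type*} [MeasurableSpace Ω] {P : Measure Ω} [IsProbabilityMeasure P]

lemma IsVelocityDistribution.isExpectedDrift (hρ₀ : Integrable id ρ₀) (hρ₁ : Integrable id ρ₁)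
    (hπ₁ : IsVelocityDistribution ρ₀ ρ₁ D π₁) : IsExpectedDrift ρ₀ ρ₁ (meanVelocity π₁) :=
  fun t ht => condExp_comap_ae_eq_integral_kernel (measurable_interp t)
    ((hρ₁.comp_snd ρ₀).sub (hρ₀.comp_fst ρ₁)) (hπ₁.disintegration t ht).symm

lemma measurable_meanVelocity : Measurable (Function.uncurry (meanVelocity π₁)) :=
  (stronglyMeasurable_id.integral_kernel (κ := π₁)).measurable

lemma IsInnerFlow.map_prodMk_eq_compProd_velocity (hπ₀ : Integrable id π₀)
    (hπ₁ : IsVelocityDistribution ρ₀ ρ₁ D π₁)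
    (ha_meas : Measurable
      (fun q : EuclideanSpace ℝ (Fin d) × ℝ × EuclideanSpace ℝ (Fin d) × ℝ =>
        a q.1 q.2.1 q.2.2.1 q.2.2.2))
    (ha : ∀ t ∈ Icc (0 : ℝ) 1, ∀ x, (t, x) ∈ D →
      IsExpectedDrift π₀ (π₁ (t, x)) (fun τ u => a x t u τ))
    (ha_unique : ∀ t ∈ Icc (0 : ℝ) 1, ∀ x, (t, x) ∈ D →
      ∀ᵐ u₀ ∂π₀, UniqueODEFrom (fun τ u => a x t u τ) univ u₀)
    {t : ℝ} (ht : t ∈ Icc (0 : ℝ) 1) {Y : Ω → EuclideanSpace ℝ (Fin d)}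
    {U : ℝ → Ω → EuclideanSpace ℝ (Fin d)} (hY : Measurable Y)
    (hYD : ∀ᵐ x ∂(P.map Y), (t, x) ∈ D) (h : IsInnerFlow P π₀ a t Y U) :
    P.map (fun ω => (Y ω, U 1 ω)) =
      P.map Y ⊗ₘ π₁.comap (fun x => (t, x)) measurable_prodMk_left :=
  h.map_prodMk_eq_compProd hπ₀ ha_meas hY (hYD.mono fun x hx => hπ₁.integrable t ht x hx)
    (hYD.mono fun x hx => ha t ht x hx) (hYD.mono fun x hx => ha_unique t ht x hx)

lemma locationLaw_zero : locationLaw ρ₀ ρ₁ 0 = ρ₀ := by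
  have h : interp (d := d) 0 = Prod.fst := by
    funext p
    simp [interp]
  rw [locationLaw, h, Measure.map_fst_prod, measure_univ, one_smul]

/-- By induction, `Z` at a partition time has the law of the interpolation, so location and drawn
velocity together have the law of `(X_s, X₁ - X₀)`. Moving along the velocity for time `t - s` sends
the latter pair to `X_t`. No uniqueness for the outer equation enters. -/
lemma IsPiecewiseStraightFlow.map_eq_locationLaw (hπ₀ : Integrable id π₀)
    (hπ₁ : IsVelocityDistribution ρ₀ ρ₁ D π₁)
    (ha_meas : Measurable
      (fun q : EuclideanSpace ℝ (Fin d) × ℝ × EuclideanSpace ℝ (Fin d) × ℝ =>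
        a q.1 q.2.1 q.2.2.1 q.2.2.2))
    (ha : ∀ t ∈ Icc (0 : ℝ) 1, ∀ x, (t, x) ∈ D →
      IsExpectedDrift π₀ (π₁ (t, x)) (fun τ u => a x t u τ))
    (ha_unique : ∀ t ∈ Icc (0 : ℝ) 1, ∀ x, (t, x) ∈ D →
      ∀ᵐ u₀ ∂π₀, UniqueODEFrom (fun τ u => a x t u τ) univ u₀)
    {J : ℕ} {s : ℕ → ℝ} {Z : ℝ → Ω → EuclideanSpace ℝ (Fin d)}
    {U : ℕ → ℝ → Ω → EuclideanSpace ℝ (Fin d)} (h : IsPiecewiseStraightFlow P ρ₀ π₀ a J s Z U)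
    {t : ℝ} (ht : t ∈ Icc (0 : ℝ) 1) : P.map (Z t) = locationLaw ρ₀ ρ₁ t := by
  have hmono : ∀ k j, j + k ≤ J → s j ≤ s (j + k) := by
    intro k
    induction k with
    | zero => exact fun j _ => le_rfl
    | succ k ih =>
      intro j hj
      exact (ih j (by omega)).trans (h.mono (j + k) (by omega))
  have hmem : ∀ j ≤ J, s j ∈ Icc (0 : ℝ) 1 := by
    intro j hj
    constructor
    · simpa [h.start] using hmono j 0 (by omega)
    · have := hmono (J - j) j (by omega)
      rwa [Nat.add_sub_cancel' hj, h.stop_eq] at this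
  have key : ∀ j ≤ J, ∀ t ∈ Icc (0 : ℝ) (s j), P.map (Z t) = locationLaw ρ₀ ρ₁ t := by
    intro j
    induction j with
    | zero =>
      intro _ t ht
      rw [h.start] at ht
      rw [le_antisymm ht.2 ht.1, h.initial, locationLaw_zero]
    | succ j ih =>
      intro hj t ht
      rcases le_total t (s j) with htj | htj
      · exact ih (by omega) t ⟨ht.1, htj⟩
      have hsj := hmem j (by omega)
      have hZ := h.measurable (s j) hsj
      have hin := h.inner j (by omega)
      have hlaw := ih (by omega) (s j) ⟨hsj.1, le_rfl⟩
      have hZU := hin.map_prodMk_eq_compProd_velocity hπ₀ hπ₁ ha_meas ha ha_unique hsj hZ (by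
        rw [hlaw]
        exact hπ₁.ae_mem (s j) hsj)
      rw [hlaw, hπ₁.disintegration (s j) hsj] at hZU
      have hU : Measurable (U j 1) := hin.measurable 1 ⟨zero_le_one, le_rfl⟩
      have hZt : Z t =ᵐ[P] fun ω => Z (s j) ω + (t - s j) • U j 1 ω := by
        filter_upwards [h.outer j (by omega)] with ω hω
        exact hω t ⟨htj, ht.2⟩
      have hg : Measurable fun q : EuclideanSpace ℝ (Fin d) × EuclideanSpace ℝ (Fin d) =>
          q.1 + (t - s j) • q.2 := by fun_prop
      have hX : Measurable fun p : EuclideanSpace ℝ (Fin d) × EuclideanSpace ℝ (Fin d) =>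
          (interp (s j) p, p.2 - p.1) :=
        (measurable_interp (s j)).prodMk (measurable_snd.sub measurable_fst)
      have e := congrArg (Measure.map fun q => q.1 + (t - s j) • q.2) hZU
      rw [Measure.map_map hg (hZ.prodMk hU), Measure.map_map hg hX] at e
      rw [Measure.map_congr hZt, locationLaw]
      refine e.trans (congrArg (fun f => (ρ₀.prod ρ₁).map f) ?_)
      funext p
      simp only [Function.comp, interp]
      module
  exact key J le_rfl t (by rwa [h.stop_eq])

/-- Given the location at almost every time, the velocity of `Z` has the conditional law of the
interpolation velocity, hence mean `meanVelocity π₁`. Both processes are driven by this field from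
the law `ρ₀` and stay in `D`. -/
lemma IsCoupledFlow.map_eq_locationLaw (hρ₀ : Integrable id ρ₀) (hρ₁ : Integrable id ρ₁)
    (hπ₀ : Integrable id π₀) (hπ₁ : IsVelocityDistribution ρ₀ ρ₁ D π₁)
    (ha_meas : Measurable
      (fun q : EuclideanSpace ℝ (Fin d) × ℝ × EuclideanSpace ℝ (Fin d) × ℝ =>
        a q.1 q.2.1 q.2.2.1 q.2.2.2))
    (ha : ∀ t ∈ Icc (0 : ℝ) 1, ∀ x, (t, x) ∈ D →
      IsExpectedDrift π₀ (π₁ (t, x)) (fun τ u => a x t u τ))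
    (ha_unique : ∀ t ∈ Icc (0 : ℝ) 1, ∀ x, (t, x) ∈ D →
      ∀ᵐ u₀ ∂π₀, UniqueODEFrom (fun τ u => a x t u τ) univ u₀)
    (huniq : ∀ᵐ x₀ ∂ρ₀, UniqueODEFrom (meanVelocity π₁) D x₀)
    {Z : ℝ → Ω → EuclideanSpace ℝ (Fin d)} {U : ℝ → ℝ → Ω → EuclideanSpace ℝ (Fin d)}
    (h : IsCoupledFlow P ρ₀ π₀ D a Z U) {t : ℝ} (ht : t ∈ Icc (0 : ℝ) 1) :
    P.map (Z t) = locationLaw ρ₀ ρ₁ t := by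
  have m0 : (0 : ℝ) ∈ Icc (0 : ℝ) 1 := ⟨le_rfl, zero_le_one⟩
  -- The velocity is only almost everywhere equal to a jointly measurable function; such a version
  -- is substituted, and the path it drives agrees with `Z t` almost surely for each `t`.
  set g := h.integrable.1.mk with hg
  have hgm : StronglyMeasurable g := h.integrable.1.stronglyMeasurable_mk
  have hgU : (fun q : ℝ × Ω => U q.1 1 q.2) =ᵐ[(volume.restrict (Icc (0 : ℝ) 1)).prod P] g :=
    h.integrable.1.ae_eq_mk
  set V : ℝ → Ω → EuclideanSpace ℝ (Fin d) := fun s ω =>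
    (Icc (0 : ℝ) 1).indicator (fun s => g (s, ω)) s with hV
  have hVeq : Function.uncurry V =
      (Prod.fst ⁻¹' Icc (0 : ℝ) 1).indicator g := rfl
  have hVm : StronglyMeasurable (Function.uncurry V) := by
    rw [hVeq]
    exact hgm.indicator (measurable_fst measurableSet_Icc)
  have hVi : Integrable (Function.uncurry V) (volume.prod P) := by
    rw [hVeq, integrable_indicator_iff (measurable_fst measurableSet_Icc), IntegrableOn,
      ← prod_univ, ← Measure.prod_restrict, Measure.restrict_univ]
    exact h.integrable.congr hgU
  have hpath : ∀ t ∈ Icc (0 : ℝ) 1, drivenPath (Z 0) V t =ᵐ[P] Z t := by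
    intro t ht
    -- After exchanging the factors, almost every `ω` has a time section on which the version agrees
    -- with the velocity almost everywhere.
    have hsw := (Measure.measurePreserving_swap (μ := P)
      (ν := volume.restrict (Icc (0 : ℝ) 1))).quasiMeasurePreserving.ae hgU
    filter_upwards [h.outer, Measure.ae_ae_of_ae_prod hsw] with ω h1 h2
    have hI : Iic t ∩ Icc (0 : ℝ) 1 = Icc 0 t := by
      ext r
      simp only [mem_inter_iff, mem_Iic, mem_Icc]
      exact ⟨fun h => ⟨h.2.1, h.1⟩, fun h => ⟨h.2, h.1, h.2.trans ht.2⟩⟩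
    rw [h1 t ht, drivenPath]
    simp only [hV]
    rw [setIntegral_indicator measurableSet_Icc, hI, intervalIntegral.integral_of_le ht.1,
      ← integral_Icc_eq_integral_Ioc]
    congr 1
    refine integral_congr_ae ?_
    filter_upwards [ae_restrict_of_ae_restrict_of_subset (Icc_subset_Icc_right ht.2) h2] with s hs
    exact hs.symm
  have hVU : ∀ᵐ s ∂(volume.restrict (Icc (0 : ℝ) 1)), V s =ᵐ[P] U s 1 := by
    filter_upwards [Measure.ae_ae_of_ae_prod hgU, ae_restrict_mem measurableSet_Icc] with s hs hs1
    filter_upwards [hs] with ω hω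
    simp only [hV, indicator_of_mem hs1]
    exact hω.symm
  have hD := hπ₁.measurableSet
  have hpm : ∀ s, Measurable (drivenPath (Z 0) V s) := fun s =>
    (measurable_drivenPath (h.measurable 0 m0) hVm).comp (measurable_const.prodMk measurable_id)
  have hdriven : IsDriven P (fun _ => ()) (Z 0) V
      (fun _ => (Icc (0 : ℝ) 1).indicator (meanVelocity π₁)) := by
    refine isDriven_unit (h.measurable 0 m0) hVm hVi
      (fun s hs ω => indicator_of_notMem hs _) ?_
    filter_upwards [h.mem_domain, h.inner, hVU, ae_restrict_mem measurableSet_Icc,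
      ae_restrict_of_ae hVi.prod_right_ae] with s h1 h2 h3 hs hVs
    have hYD : ∀ᵐ x ∂(P.map (Z s)), (s, x) ∈ D :=
      (ae_map_iff (h.measurable s hs).aemeasurable (measurable_prodMk_left hD)).2 h1
    have hlaw := h2.map_prodMk_eq_compProd_velocity hπ₀ hπ₁ ha_meas ha ha_unique hs
      (h.measurable s hs) hYD
    refine condExp_comap_ae_eq_integral_kernel (hpm s) hVs (κ := π₁.comap (fun x => (s, x))
      measurable_prodMk_left) ?_
    rw [Measure.map_congr (hpath s hs), ← hlaw]
    refine Measure.map_congr ?_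
    filter_upwards [hpath s hs, h3] with ω ha hb
    rw [ha, ← hb]
    rfl
  have hb' : Measurable fun q : Unit × ℝ × EuclideanSpace ℝ (Fin d) =>
      (Icc (0 : ℝ) 1).indicator (meanVelocity π₁) q.2.1 q.2.2 :=
    measurable_indicator_field measurable_meanVelocity
  have hfst : (ρ₀.prod ρ₁).map Prod.fst = ρ₀ := by
    rw [Measure.map_fst_prod, measure_univ, one_smul]
  have hX := isDriven_interp hρ₀ hρ₁ (hπ₁.isExpectedDrift hρ₀ hρ₁)
  have key := hdriven.map_eq_map hX hb' (fun _ s hs y => by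
      rw [indicator_of_notMem fun h => absurd h.1 (not_le.2 hs), Pi.zero_apply])
    (Prod.snd ⁻¹' D) (measurable_snd hD) ?_ ?_ ?_ ?_ t ht
  · have h2 := congrArg (Measure.map Prod.snd) key
    rw [Measure.map_map measurable_snd (measurable_const.prodMk (hpm t)),
      drivenPath_interpVelocity ht,
      Measure.map_map measurable_snd (measurable_const.prodMk (measurable_interp t))] at h2
    rw [← Measure.map_congr (hpath t ht)]
    exact h2
  · filter_upwards [h.mem_domain, ae_restrict_mem measurableSet_Icc] with s h1 hs
    filter_upwards [h1, hpath s hs] with ω h2 h3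
    change (s, drivenPath (Z 0) V s ω) ∈ D
    rwa [h3]
  · filter_upwards [ae_restrict_mem measurableSet_Icc] with s hs
    rw [drivenPath_interpVelocity hs]
    exact ae_of_ae_map (measurable_interp s).aemeasurable (hπ₁.ae_mem s hs)
  · have e1 := Measure.map_map (μ := ρ₀.prod ρ₁) (f := Prod.fst)
      (g := fun u : EuclideanSpace ℝ (Fin d) => ((), u)) (by fun_prop) measurable_fst
    have e2 := Measure.map_map (μ := P) (f := Z 0)
      (g := fun u : EuclideanSpace ℝ (Fin d) => ((), u)) (by fun_prop) (h.measurable 0 m0)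
    rw [hfst] at e1
    rw [h.initial] at e2
    exact e2.symm.trans e1
  · have e1 : (P.map fun ω => ((), Z 0 ω)).map Prod.snd = ρ₀ := by
      rw [Measure.map_map measurable_snd (measurable_const.prodMk (h.measurable 0 m0))]
      exact h.initial
    rw [← e1] at huniq
    filter_upwards [ae_of_ae_map measurable_snd.aemeasurable huniq] with p hp
    exact hp.hasUniqueSolutionFrom

end CoupledFlow
theorem theorem2 {d : ℕ}
    -- the source and target distributions of the locations, and the source distribution of
    -- the velocities, with finite means
    (ρ₀ ρ₁ π₀ : Measure (EuclideanSpace ℝ (Fin d)))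
    [IsProbabilityMeasure ρ₀] [IsProbabilityMeasure ρ₁] [IsProbabilityMeasure π₀]
    (hρ₀ : Integrable id ρ₀) (hρ₁ : Integrable id ρ₁) (hπ₀ : Integrable id π₀)
    -- the velocity distribution `π₁(· ; x, t)`, defined for `(t, x) ∈ D`
    (D : Set (ℝ × EuclideanSpace ℝ (Fin d)))
    (π₁ : Kernel (ℝ × EuclideanSpace ℝ (Fin d)) (EuclideanSpace ℝ (Fin d))) [IsMarkovKernel π₁]
    (hπ₁ : IsVelocityDistribution ρ₀ ρ₁ D π₁)
    -- the expected acceleration field `a (x, t, u, τ)`, with a well-posed inner equation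
    (a : EuclideanSpace ℝ (Fin d) → ℝ → EuclideanSpace ℝ (Fin d) → ℝ → EuclideanSpace ℝ (Fin d))
    (ha_meas : Measurable
      (fun q : EuclideanSpace ℝ (Fin d) × ℝ × EuclideanSpace ℝ (Fin d) × ℝ =>
        a q.1 q.2.1 q.2.2.1 q.2.2.2))
    (ha : ∀ t ∈ Icc (0 : ℝ) 1, ∀ x, (t, x) ∈ D →
      IsExpectedDrift π₀ (π₁ (t, x)) (fun τ u => a x t u τ))
    (ha_unique : ∀ t ∈ Icc (0 : ℝ) 1, ∀ x, (t, x) ∈ D →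
      ∀ᵐ u₀ ∂π₀, UniqueODEFrom (fun τ u => a x t u τ) univ u₀)
    {Ω : Type*} [MeasurableSpace Ω] (P : Measure Ω) [IsProbabilityMeasure P] :
    -- the inner equation turns `π₀` into the velocity distribution
    (∀ t ∈ Icc (0 : ℝ) 1, ∀ x, (t, x) ∈ D → ∀ U : ℝ → Ω → EuclideanSpace ℝ (Fin d),
      IsInnerFlow P π₀ a t (fun _ => x) U → P.map (U 1) = π₁ (t, x)) ∧
    -- the process generated by the coupled equations has the marginals of the interpolation
    ((∀ᵐ x₀ ∂ρ₀, UniqueODEFrom (meanVelocity π₁) D x₀) →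
      ∀ (Z : ℝ → Ω → EuclideanSpace ℝ (Fin d)) (U : ℝ → ℝ → Ω → EuclideanSpace ℝ (Fin d)),
        IsCoupledFlow P ρ₀ π₀ D a Z U →
        ∀ t ∈ Icc (0 : ℝ) 1, IdentDistrib (Z t) (interp t) P (ρ₀.prod ρ₁)) ∧
    -- the same for piecewise straight paths, along any partition
    (∀ (J : ℕ) (s : ℕ → ℝ) (Z : ℝ → Ω → EuclideanSpace ℝ (Fin d))
        (U : ℕ → ℝ → Ω → EuclideanSpace ℝ (Fin d)),
        IsPiecewiseStraightFlow P ρ₀ π₀ a J s Z U →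
        ∀ t ∈ Icc (0 : ℝ) 1, IdentDistrib (Z t) (interp t) P (ρ₀.prod ρ₁)) := by
  have m1 : (1 : ℝ) ∈ Icc (0 : ℝ) 1 := ⟨zero_le_one, le_rfl⟩
  refine ⟨fun t ht x hx U hU => ?_, fun huniq Z U hZ t ht => ?_, fun J s Z U hZ t ht => ?_⟩
  · have hb : Measurable (Function.uncurry fun τ u => a x t u τ) :=
      ha_meas.comp (measurable_const.prodMk (measurable_const.prodMk
        (measurable_snd.prodMk measurable_fst)))
    exact map_eq_of_solvesODE hπ₀ (hπ₁.integrable t ht x hx) hb (ha t ht x hx)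
      (ha_unique t ht x hx) (hU.measurable 0 ⟨le_rfl, zero_le_one⟩) (hU.measurable 1 m1)
      hU.initial hU.ode
  · exact ⟨(hZ.measurable t ht).aemeasurable, (measurable_interp t).aemeasurable,
      hZ.map_eq_locationLaw hρ₀ hρ₁ hπ₀ hπ₁ ha_meas ha ha_unique huniq ht⟩
  · exact ⟨(hZ.measurable t ht).aemeasurable, (measurable_interp t).aemeasurable,
      hZ.map_eq_locationLaw hπ₀ hπ₁ ha_meas ha ha_unique ht⟩
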